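/- Conventions. Let $d\ge 2$, $r\ge 3$, and let $G=G(d,1,r)\subset GL_r(\mathbb C)$ be the group of monomial matrices whose nonzero entries are $d$-th roots of unity. A reflection of $G$ is an element $s\in G$ such that $\ker(s-1)$ is a hyperplane. For the hyperplane $H$ of a reflection of $G$, let $G_H$ be the subgroup of the elements of $G$ that fix $H$ pointwise, $e_H=|G_H|$, and let $s_H$ be the generator of $G_H$ with determinant $\exp(2i\pi/e_H)$. For a finite-dimensional $\mathbb CG$-module $M$ write $$\mathrm{Res}_{G_H}M\simeq{\det}^{-j_1}\oplus\cdots\oplus{\det}^{-j_m},\qquad 0\le j_i\le e_H-1,\qquad n_H(M)=\sum_i j_i ,$$ and for a linear character $\chi:G\to\mathbb C^\times$ let $n_H(\chi)=n_H(\mathbb C_\chi)$. The hyperplane $H$ is called - $M$-good if $n_H(M)<e_H$; - $M$-excellent if $s_H$ acts on $M$ as the identity or as a reflection; - $(M,\chi)$-good if $n_H(M)+n_H(\chi)<e_H$; - $(M,\chi)$-acceptable if for every partition $\{1,\dots,m\}=I_1\sqcup I_2$ one has $\sum_{i\in I_1}j_i<e_H-n_H(\chi)$ or $\sum_{i\in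 I_2}j_i<e_H-n_H(\chi)$. Let $\underline r=(n_0,\dots,n_{d-1})$ be a family of non-negative integers with sum $r$, and let $\rho$ be an irreducible complex representation of $\mathfrak S_{n_0}\times\cdots\times\mathfrak S_{n_{d-1}}$. Cut $\{1,\dots,r\}$ into consecutive blocks of sizes $n_0,\dots,n_{d-1}$, let $j(i)$ be the index of the block of $i$, and let $D\subset G$ be the group of diagonal matrices. Then $\beta_{\underline r,\rho}$ is the representation of $G$ induced from the representation of $D\rtimes(\mathfrak S_{n_0}\times\cdots\times\mathfrak S_{n_{d-1}})$ in which $\mathrm{diag}(a_1,\dots,a_r)$ acts by the scalar $\prod_i a_i^{-j(i)}$ and $\mathfrak S_{n_0}\times\cdots\times\mathfrak S_{n_{d-1}}$ acts by $\rho$. Below, $1$ is the trivial representation, $\varepsilon$ the sign character, and a partition $\lambda$ of $m$ stands for the irreducible (Specht) representation of $\mathfrak S_m$ that it indexes, $(m)$ being the trivial one. The standard representation of $\mathfrak S_m$ is the space of vectors of $\mathbb C^m$ with zero sum. A representation of one factor $\mathfrak S_{n_j}$ is viewed as a representation of the product; if exactly one factor is a symmetric group of degree $\geq 2$, then $\varepsilon$,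 "standard" and partitions refer to that factor. Equalities of representations are up to isomorphism. Dots in $\underline r$ stand for zeros, in any number (possibly none). Theorem. Let $H$ be the hyperplane of a reflection of $G$ that is not a diagonal matrix, let $\chi$ be a linear character of $G$, and let $\rho'\simeq\beta_{\underline r,\rho}$ with $\underline r,\rho$ as above. (i) Each of the following four conditions: "$H$ is $\rho'$-excellent"; "$H$ is $\rho'$-good"; if $\chi(G_H)=1$, "$H$ is $(\rho',\chi)$-good"; if $\chi(G_H)\ne1$, "$H$ is $(\rho',\chi)$-acceptable", holds if and only if one of the following holds: - a) $\underline r=(\dots,r,\dots)$, and $\rho$ is $1$, $\varepsilon$, the standard representation or, if $r=4$, $(2,2)$; - b) $\underline r=(\dots,1,\dots,r-1,\dots)$ and $\rho=1$; - c) $\underline r=(\dots,r-1,\dots,1,\dots)$ and $\rho=1$. (ii) If $\chi(G_H)\neq1$, then $H$ is $(\rho',\chi)$-good if and only if $\underline r=(\dots,r,\dots)$ and $\rho=1$. (iii) If $\chi(G_H)=1$, then $H$ is $(\rho',\chi)$-acceptable if and only if one of the following holds: - a) $\underline r=(\dots,r,\dots)$, and $\rho$ is $1$, $\varepsilon$ or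 the standard representation, or $r\le5$ (and $\rho$ is arbitrary), or $r=6$ and $\rho\in\{(3,3),(2,2,2),(4,2)\}$; - b) $\underline r=(\dots,1,\dots,r-1,\dots)$, and $\rho=1$, or $r\in\{3,4\}$ and $\rho=\varepsilon$, or $r=3$ and $\rho$ is the standard representation; - c) $\underline r=(\dots,r-1,\dots,1,\dots)$, and $\rho=1$, or $r\in\{3,4\}$ and $\rho=\varepsilon$, or $r=3$ and $\rho$ is the standard representation; - d) $\underline r=(\dots,2,\dots,3,\dots)$ and $\rho=1$; - e) $\underline r=(\dots,3,\dots,2,\dots)$ and $\rho=1$; - f) $\underline r=(\dots,2,\dots,2,\dots)$ and $\rho\in\{1,\ \varepsilon\otimes1,\ 1\otimes\varepsilon\}$; - g) $\underline r=(\dots,1,\dots,1,\dots,1,\dots)$ and $\rho=1$. -/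

import Mathlib

open scoped Matrix

noncomputable section

namespace HyperplaneTypes

/-! ### Reflection groups, hyperplanes and their types

A group is a subgroup `G` of `GL(ℂ^ℓ)`, written in coordinates; a `G`-module is a
`Representation ℂ G M`. -/

section General

variable {ℓ : ℕ}

/-- The space `ker (g - 1)` of fixed points of `g` in `ℂ^ℓ`. -/
def fixedSpace (g : GL (Fin ℓ) ℂ) : Submodule ℂ (Fin ℓ → ℂ) :=
  LinearMap.ker (Matrix.toLin' (g : Matrix (Fin ℓ) (Fin ℓ) ℂ) - LinearMap.id)

/-- `dim ker (g - 1) = ℓ - 1`. -/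
def IsReflection (g : GL (Fin ℓ) ℂ) : Prop :=
  Module.finrank ℂ (fixedSpace g) + 1 = ℓ

/-- The set of reflecting hyperplanes of `G`. -/
def hyperplanes (G : Subgroup (GL (Fin ℓ) ℂ)) : Set (Submodule ℂ (Fin ℓ → ℂ)) :=
  {H | ∃ s ∈ G, IsReflection s ∧ H = fixedSpace s}

variable (G : Subgroup (GL (Fin ℓ) ℂ)) (H : Submodule ℂ (Fin ℓ → ℂ))

/-- The subgroup `G_H` of the elements of `G` that fix every point of `H`. -/
def fixer : Subgroup G where
  carrier := {g | ∀ x ∈ H, ((g : GL (Fin ℓ) ℂ) : Matrix (Fin ℓ) (Fin ℓ) ℂ) *ᵥ x = x}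
  one_mem' := by
    intro x _
    simp
  mul_mem' := by
    intro a b ha hb x hx
    have h1 := ha x hx
    have h2 := hb x hx
    simp only [Subgroup.coe_mul, Units.val_mul, ← Matrix.mulVec_mulVec, h2, h1]
  inv_mem' := by
    intro a ha x hx
    have h1 := ha x hx
    calc _ = ((a⁻¹ : G) : GL (Fin ℓ) ℂ).1 *ᵥ ((a : GL (Fin ℓ) ℂ).1 *ᵥ x) := by rw [h1]
      _ = x := by
        rw [Matrix.mulVec_mulVec, ← Units.val_mul, ← Subgroup.coe_mul]
        simp

/-- `e_H`, the order of `G_H`. -/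
def orderE : ℕ := Nat.card (fixer G H)

/-- The determinant of `g`, on the reflection representation `ℂ^ℓ`. -/
def detV (g : G) : ℂ := Matrix.det ((g : GL (Fin ℓ) ℂ) : Matrix (Fin ℓ) (Fin ℓ) ℂ)

variable {M : Type*} [AddCommGroup M] [Module ℂ M] (ρ : Representation ℂ G M)

/-- `n_{j,H}(M)`: the multiplicity of the character `det ^ (-j)` of `G_H` in the restriction of
`M` to `G_H`, as the dimension of its isotypic component. -/
def multN (j : ℕ) : ℕ :=
  Module.finrank ℂ
    (⨅ g : fixer G H, LinearMap.ker (ρ (g : G) - ((detV G (g : G))⁻¹ ^ j) • LinearMap.id) :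
      Submodule ℂ M)

/-- `n_H(M) = ∑ j n_{j,H}(M)`, for `0 ≤ j ≤ e_H - 1`. -/
def nH : ℕ := ∑ j ∈ Finset.range (orderE G H), j * multN G H ρ j

/-- The one-dimensional representation with character `χ`. -/
def charRep (χ : G →* ℂˣ) : Representation ℂ G ℂ where
  toFun g := (χ g : ℂ) • LinearMap.id
  map_one' := by ext; simp
  map_mul' a b := by ext; simp [mul_comm]

/-- The multiset `{j_1, …, j_r}`, `0 ≤ j_i ≤ e_H - 1`, such that the restriction of `M` to `G_H`
is the direct sum of the characters `det ^ (-j_i)`. -/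
def jMultiset : Multiset ℕ :=
  ∑ j ∈ Finset.range (orderE G H), Multiset.replicate (multN G H ρ j) j

/-- `H` is `M`-good. -/
def IsGood : Prop := nH G H ρ < orderE G H

/-- `H` is `M`-excellent: the generator `s_H` of `G_H` with determinant `exp (2iπ / e_H)` acts on
`M` as the identity or as a reflection, that is, `dim ker (s_H - 1) ≥ dim M - 1`. -/
def IsExcellent : Prop :=
  ∃ s ∈ fixer G H, detV G s = Complex.exp (2 * Real.pi * Complex.I / (orderE G H : ℂ)) ∧
    Module.finrank ℂ M ≤ Module.finrank ℂ (LinearMap.ker (ρ s - LinearMap.id)) + 1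

/-- `H` is `(M, χ)`-good. -/
def IsGoodFor (χ : G →* ℂˣ) : Prop :=
  nH G H ρ + nH G H (charRep G χ) < orderE G H

/-- `H` is `(M, χ)`-acceptable: whenever the family of the `j_i` is split in two parts `A`, `B`,
one of them has a sum `< e_H - n_H(χ)`. -/
def IsAcceptable (χ : G →* ℂˣ) : Prop :=
  ∀ A B : Multiset ℕ, A + B = jMultiset G H ρ →
    A.sum + nH G H (charRep G χ) < orderE G H ∨ B.sum + nH G H (charRep G χ) < orderE G H

end General

/-! ### The group `G(d,1,r)` -/

section Wreath

variable (d r : ℕ)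

/-- The wreath product `μ_d ≀ S_r = (μ_d)^r ⋊ S_r`, where `σ • a = a ∘ σ⁻¹`. -/
abbrev Wreath : Type :=
  (Fin r → rootsOfUnity d ℂ) ⋊[(mulAutArrow : Equiv.Perm (Fin r) →* _)] Equiv.Perm (Fin r)

/-- The monomial matrix `diag(a) P_σ`, which sends `e_j` to `a_{σ j} e_{σ j}`. -/
def monomialMatrix (x : Wreath d r) : Matrix (Fin r) (Fin r) ℂ :=
  Matrix.of fun i j => if i = x.right j then ((x.left i : ℂˣ) : ℂ) else 0

/-- `monomialMatrix` as a homomorphism to `GL_r(ℂ)`. -/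
def monomialHom : Wreath d r →* GL (Fin r) ℂ :=
  MonoidHom.toHomUnits
    { toFun := monomialMatrix d r
      map_one' := by
        ext i j
        rw [Matrix.one_apply]
        by_cases h : i = j <;> simp [monomialMatrix, h]
      map_mul' := by
        intro x y
        ext i j
        rw [Matrix.mul_apply, Finset.sum_eq_single (y.right j)]
        · by_cases h : i = x.right (y.right j)
          · subst h
            have h2 : (mulAutArrow x.right y.left) (x.right (y.right j)) = y.left (y.right j) :=
              congrArg y.left (x.right.symm_apply_apply (y.right j))
            simp only [monomialMatrix, Matrix.of_apply, SemidirectProduct.mul_left,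
              SemidirectProduct.mul_right, Pi.mul_apply, Equiv.Perm.mul_apply, if_true, h2]
            simp
          · simp [monomialMatrix, h]
        · intro b _ hb
          simp [monomialMatrix, hb]
        · simp }

/-- The group `G(d,1,r)` of the monomial matrices whose nonzero entries are `d`-th roots of
unity. -/
def groupG : Subgroup (GL (Fin r) ℂ) := (monomialHom d r).range

/-- The hyperplane of a reflection of `G(d,1,r)` that is not a diagonal matrix. -/
def IsNonDiagonalHyperplane (H : Submodule ℂ (Fin r → ℂ)) : Prop :=
  ∃ s ∈ groupG d r, IsReflection s ∧ ¬ (s : Matrix (Fin r) (Fin r) ℂ).IsDiag ∧ H = fixedSpace s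

end Wreath

/-! ### The representations `β_{n,ρ}` -/

section Beta

variable {d r : ℕ} (n : Fin d → ℕ)

/-- The product `S_{n_0} × ⋯ × S_{n_{d-1}}`. -/
abbrev YoungGroup : Type := ∀ j : Fin d, Equiv.Perm (Fin (n j))

variable {n} (hn : ∑ j, n j = r)

/-- `{1, …, r}` cut into consecutive blocks of sizes `n_0, …, n_{d-1}`. -/
def blockEquiv : (Σ j : Fin d, Fin (n j)) ≃ Fin r :=
  finSigmaFinEquiv.trans (finCongr hn)

/-- The index of the block that contains `i`. -/
def block (i : Fin r) : Fin d := ((blockEquiv hn).symm i).1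

/-- The embedding of `S_{n_0} × ⋯ × S_{n_{d-1}}` in `S_r`. -/
def youngHom : YoungGroup n →* Equiv.Perm (Fin r) :=
  (blockEquiv hn).permCongrHom.toMonoidHom.comp
    (Equiv.Perm.sigmaCongrRightHom fun j : Fin d => Fin (n j))

theorem block_youngHom (τ : YoungGroup n) (i : Fin r) :
    block hn (youngHom hn τ i) = block hn i := by
  simp [block, youngHom, Equiv.Perm.sigmaCongrRightHom, Equiv.permCongrHom]

/-- The inertia group `(μ_d)^r ⋊ (S_{n_0} × ⋯ × S_{n_{d-1}})`. -/
abbrev Inertia : Type :=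
  (Fin r → rootsOfUnity d ℂ) ⋊[(mulAutArrow : Equiv.Perm (Fin r) →* _).comp (youngHom hn)]
    YoungGroup n

/-- The embedding of the inertia group in `G(d,1,r)`. -/
def inertiaHom : Inertia hn →* groupG d r :=
  (monomialHom d r).rangeRestrict.comp
    (SemidirectProduct.map (MonoidHom.id _) (youngHom hn) (fun _ => rfl))

/-- The linear character `diag(a) ↦ ∏ a_i ^ (-j(i))` of the group of the diagonal matrices, where
`j(i)` is the index of the block of `i`. -/
def blockChar : (Fin r → rootsOfUnity d ℂ) →* ℂˣ where
  toFun a := ∏ i, ((a i : ℂˣ)⁻¹) ^ (block hn i : ℕ)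
  map_one' := by simp
  map_mul' a b := by
    rw [← Finset.prod_mul_distrib]
    refine Finset.prod_congr rfl fun i _ => ?_
    simp [mul_pow, mul_comm]

theorem blockChar_smul (τ : YoungGroup n) (a : Fin r → rootsOfUnity d ℂ) :
    blockChar hn (mulAutArrow (youngHom hn τ) a) = blockChar hn a := by
  simp only [blockChar, MonoidHom.coe_mk, OneHom.coe_mk]
  refine Fintype.prod_equiv (youngHom hn τ)⁻¹ _ _ fun i => ?_
  have h := block_youngHom hn τ ((youngHom hn τ)⁻¹ i)
  have h3 : youngHom hn τ ((youngHom hn τ)⁻¹ i) = i := (youngHom hn τ).apply_symm_apply i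
  rw [h3] at h
  rw [← h]
  rfl

variable {W : Type*} [AddCommGroup W] [Module ℂ W] (ρ : Representation ℂ (YoungGroup n) W)

/-- The representation of the inertia group on `W` where the diagonal matrices act by `blockChar`
and `S_{n_0} × ⋯ × S_{n_{d-1}}` acts by `ρ`. -/
def inertiaRep : Representation ℂ (Inertia hn) W where
  toFun x := (blockChar hn x.left : ℂ) • ρ x.right
  map_one' := by simp
  map_mul' x y := by
    have h : blockChar hn (x * y).left = blockChar hn x.left * blockChar hn y.left := by
      rw [SemidirectProduct.mul_left, map_mul]
      congr 1
      exact blockChar_smul hn _ _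
    ext w
    simp only [h, SemidirectProduct.mul_right, map_mul, Units.val_mul, LinearMap.smul_apply,
      Module.End.mul_apply, map_smul, smul_smul]
    rw [mul_comm]

/-- `β_{n,ρ}`: the representation of `G(d,1,r)` induced from `inertiaRep`. -/
abbrev beta : Representation ℂ (groupG d r) (Representation.IndV (inertiaHom hn) (inertiaRep hn ρ)) :=
  Representation.ind (inertiaHom hn) (inertiaRep hn ρ)

end Beta

/-! ### Representations of symmetric groups -/

section Symmetric

/-- The sign character `ε` of `S_m`. -/
def signRep (m : ℕ) : Representation ℂ (Equiv.Perm (Fin m)) ℂ where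
  toFun σ := ((Equiv.Perm.sign σ : ℤ) : ℂ) • LinearMap.id
  map_one' := by ext; simp
  map_mul' a b := by ext; simp [mul_comm]

/-- The action of `S_m` on `ℂ^m` that permutes the coordinates. -/
def permRep (m : ℕ) : Representation ℂ (Equiv.Perm (Fin m)) (Fin m → ℂ) where
  toFun σ := LinearMap.funLeft ℂ ℂ (σ⁻¹ : Equiv.Perm (Fin m))
  map_one' := by ext; simp [LinearMap.funLeft]
  map_mul' a b := by ext; simp [LinearMap.funLeft]

/-- The vectors of `ℂ^m` with zero sum. -/
def standardSub (m : ℕ) : Subrepresentation (permRep m) where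
  toSubmodule := LinearMap.ker (∑ i, LinearMap.proj i : (Fin m → ℂ) →ₗ[ℂ] ℂ)
  apply_mem_toSubmodule σ v hv := by
    simp only [LinearMap.mem_ker, LinearMap.sum_apply, LinearMap.proj_apply] at hv ⊢
    rw [← hv]
    exact Equiv.sum_comp (σ⁻¹ : Equiv.Perm (Fin m)) v

/-- The standard representation of `S_m`, of dimension `m - 1`. -/
def standardRep (m : ℕ) : Representation ℂ (Equiv.Perm (Fin m)) (standardSub m).toSubmodule :=
  (standardSub m).toRepresentation

/-- The permutation module on the maps `f : {1, …, m} → ℕ`, with `σ • f = f ∘ σ⁻¹`. A tabloid is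
the map which gives the row of each entry. -/
def tabloidRep (m : ℕ) : Representation ℂ (Equiv.Perm (Fin m)) ((Fin m → ℕ) →₀ ℂ) where
  toFun σ := Finsupp.lmapDomain ℂ ℂ fun f : Fin m → ℕ => f ∘ (σ⁻¹ : Equiv.Perm (Fin m))
  map_one' := by
    refine Finsupp.lhom_ext fun f c => ?_
    simp
  map_mul' a b := by
    refine Finsupp.lhom_ext fun f c => ?_
    simp [Function.comp_def]

/-- A Young tableau of shape `μ`, given by the cell `t i` where each `i` is written. -/
abbrev Tableau (m : ℕ) (μ : YoungDiagram) : Type := Fin m ≃ μ.cells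

/-- The polytabloid `e_t = ∑ sgn(q) q{t}`, where `q` runs through the permutations that preserve
the columns of `t`. -/
def polytabloid {m : ℕ} {μ : YoungDiagram} (t : Tableau m μ) : (Fin m → ℕ) →₀ ℂ :=
  ∑ q : {q : Equiv.Perm (Fin m) // ∀ i, (t (q i)).1.2 = (t i).1.2},
    ((Equiv.Perm.sign q.1 : ℤ) : ℂ) •
      tabloidRep m q.1 (Finsupp.single (fun i => (t i).1.1) 1)

theorem tabloidRep_polytabloid {m : ℕ} {μ : YoungDiagram} (t : Tableau m μ)
    (σ : Equiv.Perm (Fin m)) :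
    tabloidRep m σ (polytabloid t) = polytabloid ((σ⁻¹ : Equiv.Perm (Fin m)).trans t) := by
  simp only [polytabloid, map_sum, map_smul]
  refine Fintype.sum_equiv
    ((MulAut.conj σ).toEquiv.subtypeEquiv (fun q => ?_)) _ _ (fun q => ?_)
  · constructor
    · intro h i
      simpa [MulAut.conj_apply] using h (σ⁻¹ i)
    · intro h i
      simpa [MulAut.conj_apply] using h (σ i)
  · have h2 : tabloidRep m σ (Finsupp.single (fun i => (t i).1.1) 1) =
        Finsupp.single (fun i => (t (σ⁻¹ i)).1.1) 1 := by
      simp [tabloidRep, Function.comp_def]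
    have h4 : ∀ p : Equiv.Perm (Fin m), p = σ * q.1 * σ⁻¹ →
        ((Equiv.Perm.sign q.1 : ℤ) : ℂ) •
          tabloidRep m σ (tabloidRep m q.1 (Finsupp.single (fun i => (t i).1.1) 1)) =
        ((Equiv.Perm.sign p : ℤ) : ℂ) •
          tabloidRep m p (Finsupp.single (fun i => (t (σ⁻¹ i)).1.1) 1) := by
      rintro p rfl
      have h5 : Equiv.Perm.sign (σ * q.1 * σ⁻¹) = Equiv.Perm.sign q.1 := by
        rw [map_mul, map_mul, mul_comm (Equiv.Perm.sign σ), mul_assoc, ← map_mul]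
        simp
      rw [h5, ← h2, ← Module.End.mul_apply, ← map_mul, ← Module.End.mul_apply, ← map_mul]
      simp
    exact h4 _ rfl

/-- The Specht module of `μ`: the span of the polytabloids of the tableaux of shape `μ`. -/
def spechtSub (m : ℕ) (μ : YoungDiagram) : Subrepresentation (tabloidRep m) where
  toSubmodule := Submodule.span ℂ (Set.range fun t : Tableau m μ => polytabloid t)
  apply_mem_toSubmodule σ v hv := by
    induction hv using Submodule.span_induction with
    | mem x hx =>
      obtain ⟨t, rfl⟩ := hx
      rw [tabloidRep_polytabloid]
      exact Submodule.subset_span ⟨_, rfl⟩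
    | zero => simp
    | add x y _ _ hx hy => rw [map_add]; exact add_mem hx hy
    | smul c x _ hx => rw [map_smul]; exact Submodule.smul_mem _ c hx

/-- The irreducible representation of `S_m` associated to the partition `μ` of `m`. -/
def spechtRep (m : ℕ) (μ : YoungDiagram) :
    Representation ℂ (Equiv.Perm (Fin m)) (spechtSub m μ).toSubmodule :=
  (spechtSub m μ).toRepresentation

/-- The partition `(2,2)`. -/
def shape22 : YoungDiagram := YoungDiagram.ofRowLens [2, 2] (by decide)

/-- The partition `(3,3)`. -/
def shape33 : YoungDiagram := YoungDiagram.ofRowLens [3, 3] (by decide)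

/-- The partition `(2,2,2)`. -/
def shape222 : YoungDiagram := YoungDiagram.ofRowLens [2, 2, 2] (by decide)

/-- The partition `(4,2)`. -/
def shape42 : YoungDiagram := YoungDiagram.ofRowLens [4, 2] (by decide)

end Symmetric

/-! ### The lists -/

section Lists

variable {d : ℕ} {n : Fin d → ℕ} {W : Type*} [AddCommGroup W] [Module ℂ W]
  (ρ : Representation ℂ (YoungGroup n) W)

/-- `ρ = 1`. -/
def IsTrivialRep : Prop := Nonempty (ρ.Equiv (Representation.trivial ℂ (YoungGroup n) ℂ))

/-- `ρ` is the representation `σ` of the factor `S_{n_j}`, the other factors acting trivially. -/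
def IsFactorRep {U : Type*} [AddCommMonoid U] [Module ℂ U] (j : Fin d)
    (σ : Representation ℂ (Equiv.Perm (Fin (n j))) U) : Prop :=
  Nonempty (ρ.Equiv
    (σ.comp (Pi.evalMonoidHom (fun i : Fin d => Equiv.Perm (Fin (n i))) j) :
      Representation ℂ (YoungGroup n) U))

/-- `ρ` is the sign character of the factor `S_{n_j}`. -/
def IsSign (j : Fin d) : Prop := IsFactorRep ρ j (signRep (n j))

/-- `ρ` is the standard representation of the factor `S_{n_j}`. -/
def IsStandard (j : Fin d) : Prop := IsFactorRep ρ j (standardRep (n j))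

/-- `ρ` is the representation of the factor `S_{n_j}` associated to the partition `μ`. -/
def IsSpecht (j : Fin d) (μ : YoungDiagram) : Prop := IsFactorRep ρ j (spechtRep (n j) μ)

/-- The first list: `n = (0,…,r,…,0)` with `ρ` equal to `1`, `ε`, the standard representation or,
if `r = 4`, `(2,2)`; or `n` has the two nonzero entries `1` and `r - 1`, in one order or the other,
and `ρ = 1`. -/
def ListOne (r : ℕ) : Prop :=
  (∃ j, n = Pi.single j r ∧
    (IsTrivialRep ρ ∨ IsSign ρ j ∨ IsStandard ρ j ∨ (r = 4 ∧ IsSpecht ρ j shape22))) ∨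
  (∃ j k, j < k ∧ n = Pi.single j 1 + Pi.single k (r - 1) ∧ IsTrivialRep ρ) ∨
  (∃ j k, j < k ∧ n = Pi.single j (r - 1) + Pi.single k 1 ∧ IsTrivialRep ρ)

/-- The second list: `n = (0,…,r,…,0)` and `ρ = 1`. -/
def ListTwo (r : ℕ) : Prop := ∃ j, n = Pi.single j r ∧ IsTrivialRep ρ

/-- The third list, whose items are in order: `(0,…,r,…,0)`, `(…,1,…,r-1,…)`, `(…,r-1,…,1,…)`,
`(…,2,…,3,…)`, `(…,3,…,2,…)`, `(…,2,…,2,…)` and `(…,1,…,1,…,1,…)`. -/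
def ListThree (r : ℕ) : Prop :=
  (∃ j, n = Pi.single j r ∧
    (IsTrivialRep ρ ∨ IsSign ρ j ∨ IsStandard ρ j ∨ r ≤ 5 ∨
      (r = 6 ∧ (IsSpecht ρ j shape33 ∨ IsSpecht ρ j shape222 ∨ IsSpecht ρ j shape42)))) ∨
  (∃ j k, j < k ∧ n = Pi.single j 1 + Pi.single k (r - 1) ∧
    (IsTrivialRep ρ ∨ ((r = 3 ∨ r = 4) ∧ IsSign ρ k) ∨ (r = 3 ∧ IsStandard ρ k))) ∨
  (∃ j k, j < k ∧ n = Pi.single j (r - 1) + Pi.single k 1 ∧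
    (IsTrivialRep ρ ∨ ((r = 3 ∨ r = 4) ∧ IsSign ρ j) ∨ (r = 3 ∧ IsStandard ρ j))) ∨
  (∃ j k, j < k ∧ n = Pi.single j 2 + Pi.single k 3 ∧ IsTrivialRep ρ) ∨
  (∃ j k, j < k ∧ n = Pi.single j 3 + Pi.single k 2 ∧ IsTrivialRep ρ) ∨
  (∃ j k, j < k ∧ n = Pi.single j 2 + Pi.single k 2 ∧
    (IsTrivialRep ρ ∨ IsSign ρ j ∨ IsSign ρ k)) ∨
  (∃ i j k, i < j ∧ j < k ∧ n = Pi.single i 1 + Pi.single j 1 + Pi.single k 1 ∧ IsTrivialRep ρ)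

end Lists

end HyperplaneTypes

end

/-! A non-diagonal reflection of G is a monomial matrix over a transposition (i j), with a_i a_j =
1. A diagonal matrix conjugates it to the permutation matrix of (i j), and G_H = {1, s}
(`exists_generator`). Hence e_H = 2, every j_i is 0 or 1, and n_H(χ) is 0 or 1. All the conditions
become bounds on one number m, the multiplicity of the eigenvalue -1 of a transposition on β: m = 0,
m ≤ 1 or m ≤ 3, matching `ListTwo`, `ListOne` and `ListThree`.

The number m is read off the induced character. Let D = dim ρ and let x_k be the multiplicity of -1
for a transposition of the factor k. An ordered pair of distinct points contributes D if its points
lie in different blocks, and 2 x_k if both lie in block k. This gives `two_mul_negDim_beta`: 2 m ∏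
n_k! = (r-2)! ∑ n_k ((r-n_k) D + (n_k-1) 2 x_k). With two blocks of sizes a and b, m is at least
binom(a+b-2, a-1), so m ≤ 3 leaves few shapes (`eq_of_two_blocks`). With three or more blocks, m ≤ 3
forces r = 3 (`four_le_negDim_beta`).

With one block, m is the multiplicity of -1 for a transposition in an irreducible representation of
S_r. The classification for m ≤ 1 and m ≤ 3 (`negDim_le_one_iff`, `negDim_le_three_iff`) uses
neither branching rules nor dimension formulas. One finds a vector on which a large symmetric
subgroup acts trivially, possibly after tensoring with ε, and spreads it into an equivariant family
indexed by points, pairs or triples. Partial sums are families with fewer indices: either a nonzero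
one identifies the representation, or all of them vanish. Families on points give the trivial and
standard representations (`trivial_or_standard`). For pair and triple families with zero sums,
explicit independent vectors bound eigenspaces from below and explicit spanning sets bound them from
above.

The initial vector comes from an eigenline when m = 1 (`neg_line_cases`), from the action of S_{r-2}
on the small -1-eigenspace when r ≥ 7 (`exists_neg_character`), and from a fixed vector of a 3-cycle
when r is 5 or 6 (`exists_character_three_of_five`). Specht modules are recognized by one
row-invariant and one column-alternating vector (`nonempty_equiv_specht`). -/

noncomputable section
namespace HyperplaneTypes

/-! ### Eigenspaces of involutions -/

section Involution

open Module

variable {G V V' : Type*} [Group G] [AddCommGroup V] [Module ℂ V] [AddCommGroup V'] [Module ℂ V']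

/-- The dimension of the `(-1)`-eigenspace of `g`. -/
def negDim (ρ : Representation ℂ G V) (g : G) : ℕ :=
  finrank ℂ (LinearMap.ker (ρ g + 1))

/-- The dimension of the space of fixed points of `g`. -/
def posDim (ρ : Representation ℂ G V) (g : G) : ℕ :=
  finrank ℂ (LinearMap.ker (ρ g - 1))

theorem mem_ker_add_one {f : V →ₗ[ℂ] V} {v : V} : v ∈ LinearMap.ker (f + 1) ↔ f v = -v := by
  simp [LinearMap.mem_ker, add_eq_zero_iff_eq_neg]

theorem mem_ker_sub_one {f : V →ₗ[ℂ] V} {v : V} : v ∈ LinearMap.ker (f - 1) ↔ f v = v := by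
  simp [LinearMap.mem_ker, sub_eq_zero]

theorem apply_apply_of_mul_self {ρ : Representation ℂ G V} {g : G} (hg : g * g = 1) (v : V) :
    ρ g (ρ g v) = v := by
  rw [← Module.End.mul_apply, ← map_mul, hg]; simp

/-- For an involution, (1 - g)/2 projects onto the -1-eigenspace, so its trace is the multiplicity
of -1. This is the bridge from characters to `negDim`. -/
theorem trace_eq_finrank_sub_negDim [FiniteDimensional ℂ V] (ρ : Representation ℂ G V) {g : G}
    (hg : g * g = 1) : LinearMap.trace ℂ V (ρ g) = finrank ℂ V - 2 * negDim ρ g := by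
  have h : LinearMap.IsProj (LinearMap.ker (ρ g + 1)) ((1 / 2 : ℂ) • (1 - ρ g)) := by
    constructor
    · intro x
      rw [mem_ker_add_one]
      simp [apply_apply_of_mul_self hg, smul_sub]
    · intro x hx
      rw [mem_ker_add_one] at hx
      simp only [LinearMap.smul_apply, LinearMap.sub_apply, Module.End.one_apply, hx]
      module
  have h2 := h.trace
  rw [map_smul, map_sub, LinearMap.trace_one, smul_eq_mul] at h2
  rw [negDim, ← h2]
  ring

theorem finrank_eq_posDim_add_negDim [FiniteDimensional ℂ V] (ρ : Representation ℂ G V) {g : G}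
    (hg : g * g = 1) : finrank ℂ V = posDim ρ g + negDim ρ g := by
  have h : LinearMap.IsProj (LinearMap.ker (ρ g - 1)) ((1 / 2 : ℂ) • (1 + ρ g)) := by
    constructor
    · intro x
      rw [mem_ker_sub_one]
      simp [apply_apply_of_mul_self hg, add_comm]
    · intro x hx
      rw [mem_ker_sub_one] at hx
      simp only [LinearMap.smul_apply, LinearMap.add_apply, Module.End.one_apply, hx]
      module
  have h2 := h.trace
  rw [map_smul, map_add, LinearMap.trace_one, smul_eq_mul,
    trace_eq_finrank_sub_negDim ρ hg] at h2
  have h3 : (finrank ℂ V : ℂ) = ((posDim ρ g + negDim ρ g : ℕ) : ℂ) := by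
    push_cast
    rw [posDim, ← h2]
    ring
  exact_mod_cast h3

theorem negDim_conj (ρ : Representation ℂ G V) (g h : G) :
    negDim ρ (h * g * h⁻¹) = negDim ρ g := by
  have hinj : Function.Injective (ρ h) := by
    intro x y hxy
    have := congrArg (ρ h⁻¹) hxy
    rwa [← Module.End.mul_apply, ← Module.End.mul_apply, ← map_mul, inv_mul_cancel, map_one] at this
  have : LinearMap.ker (ρ (h * g * h⁻¹) + 1) = (LinearMap.ker (ρ g + 1)).map (ρ h) := by
    ext v
    rw [mem_ker_add_one, Submodule.mem_map]
    constructor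
    · intro hv
      refine ⟨ρ h⁻¹ v, ?_, ?_⟩
      · rw [mem_ker_add_one, ← map_neg, ← hv]
        simp only [← Module.End.mul_apply, ← map_mul]
        congr 2
        group
      · simp only [← Module.End.mul_apply, ← map_mul]
        simp
    · rintro ⟨w, hw, rfl⟩
      rw [mem_ker_add_one] at hw
      rw [← map_neg, ← hw]
      simp only [← Module.End.mul_apply, ← map_mul]
      congr 2
      group
  rw [negDim, this]
  exact (Submodule.equivMapOfInjective _ hinj _).finrank_eq.symm

theorem exists_linearEquiv {ρ : Representation ℂ G V} {ρ' : Representation ℂ G V'}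
    (e : ρ.Equiv ρ') : ∃ f : V ≃ₗ[ℂ] V', ∀ g v, f (ρ g v) = ρ' g (f v) :=
  ⟨e.toLinearEquiv,
    fun g v => Representation.IntertwiningMap.isIntertwining _ _ e.toIntertwiningMap g v⟩

theorem negDim_equiv {ρ : Representation ℂ G V} {ρ' : Representation ℂ G V'} (e : ρ.Equiv ρ')
    (g : G) : negDim ρ g = negDim ρ' g := by
  obtain ⟨f, hc⟩ := exists_linearEquiv e
  have : LinearMap.ker (ρ' g + 1) = (LinearMap.ker (ρ g + 1)).map f.toLinearMap := by
    ext v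
    rw [mem_ker_add_one, Submodule.mem_map]
    constructor
    · intro hv
      refine ⟨f.symm v, ?_, by simp⟩
      rw [mem_ker_add_one]
      apply f.injective
      rw [hc]
      simp [hv]
    · rintro ⟨w, hw, rfl⟩
      rw [mem_ker_add_one] at hw
      rw [LinearEquiv.coe_coe, ← hc, hw, map_neg]
  rw [negDim, negDim, this]
  exact (Submodule.equivMapOfInjective _ f.injective _).finrank_eq

/-- On a -1-eigenvector 1 - g is multiplication by 2, so the eigenspace lies in the image of 1 - g.
Upper bounds for `negDim` then only require controlling x - g x on generators. -/
theorem ker_add_one_le_span (ρ : Representation ℂ G V) {g : G}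
    {S : Set V} (hS : Submodule.span ℂ S = ⊤) :
    LinearMap.ker (ρ g + 1) ≤ Submodule.span ℂ ((fun x => x - ρ g x) '' S) := by
  intro v hv
  rw [mem_ker_add_one] at hv
  have h1 : (1 - ρ g) v ∈ (Submodule.span ℂ S).map (1 - ρ g) :=
    ⟨v, by simp [hS], rfl⟩
  rw [Submodule.map_span] at h1
  have h2 : v = (1 / 2 : ℂ) • (1 - ρ g) v := by
    simp only [LinearMap.sub_apply, Module.End.one_apply, hv]; module
  rw [h2]
  exact Submodule.smul_mem _ _ h1

theorem ker_sub_one_le_span (ρ : Representation ℂ G V) {g : G}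
    {S : Set V} (hS : Submodule.span ℂ S = ⊤) :
    LinearMap.ker (ρ g - 1) ≤ Submodule.span ℂ ((fun x => x + ρ g x) '' S) := by
  intro v hv
  rw [mem_ker_sub_one] at hv
  have h1 : (1 + ρ g) v ∈ (Submodule.span ℂ S).map (1 + ρ g) :=
    ⟨v, by simp [hS], rfl⟩
  rw [Submodule.map_span] at h1
  have h2 : v = (1 / 2 : ℂ) • (1 + ρ g) v := by
    simp only [LinearMap.add_apply, Module.End.one_apply, hv]; module
  rw [h2]
  exact Submodule.smul_mem _ _ h1

theorem negDim_le_of_span {ρ : Representation ℂ G V} {g : G} {S : Set V}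
    (hS : Submodule.span ℂ S = ⊤) {ι : Type*} [Fintype ι] (b : ι → V)
    (h : ∀ x ∈ S, x - ρ g x ∈ Submodule.span ℂ (Set.range b)) : negDim ρ g ≤ Fintype.card ι := by
  have h1 : LinearMap.ker (ρ g + 1) ≤ Submodule.span ℂ (Set.range b) := by
    refine (ker_add_one_le_span ρ hS).trans (Submodule.span_le.2 ?_)
    rintro _ ⟨x, hx, rfl⟩
    exact h x hx
  have := FiniteDimensional.span_of_finite ℂ (Set.finite_range b)
  refine (Submodule.finrank_mono h1).trans ?_
  exact finrank_range_le_card (R := ℂ) b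

theorem posDim_le_of_span {ρ : Representation ℂ G V} {g : G} {S : Set V}
    (hS : Submodule.span ℂ S = ⊤) {ι : Type*} [Fintype ι] (b : ι → V)
    (h : ∀ x ∈ S, x + ρ g x ∈ Submodule.span ℂ (Set.range b)) : posDim ρ g ≤ Fintype.card ι := by
  have h1 : LinearMap.ker (ρ g - 1) ≤ Submodule.span ℂ (Set.range b) := by
    refine (ker_sub_one_le_span ρ hS).trans (Submodule.span_le.2 ?_)
    rintro _ ⟨x, hx, rfl⟩
    exact h x hx
  have := FiniteDimensional.span_of_finite ℂ (Set.finite_range b)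
  refine (Submodule.finrank_mono h1).trans ?_
  exact finrank_range_le_card (R := ℂ) b

theorem le_negDim_of_linearIndependent [FiniteDimensional ℂ V] {ρ : Representation ℂ G V} {g : G}
    {k : ℕ} (b : Fin k → V) (hb : LinearIndependent ℂ b) (h : ∀ i, ρ g (b i) = -b i) :
    k ≤ negDim ρ g := by
  have h2 : LinearIndependent ℂ (fun i => (⟨b i, mem_ker_add_one.2 (h i)⟩ :
      LinearMap.ker (ρ g + 1))) :=
    LinearIndependent.of_comp (LinearMap.ker (ρ g + 1)).subtype hb
  simpa [negDim, posDim] using h2.fintype_card_le_finrank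

theorem le_posDim_of_linearIndependent [FiniteDimensional ℂ V] {ρ : Representation ℂ G V} {g : G}
    {k : ℕ} (b : Fin k → V) (hb : LinearIndependent ℂ b) (h : ∀ i, ρ g (b i) = b i) :
    k ≤ posDim ρ g := by
  have h2 : LinearIndependent ℂ (fun i => (⟨b i, mem_ker_sub_one.2 (h i)⟩ :
      LinearMap.ker (ρ g - 1))) :=
    LinearIndependent.of_comp (LinearMap.ker (ρ g - 1)).subtype hb
  simpa [negDim, posDim] using h2.fintype_card_le_finrank

end Involution

/-! ### Irreducible representations -/

section Irreducible

variable {G V V' : Type*} [Group G] [AddCommGroup V] [Module ℂ V] [AddCommGroup V'] [Module ℂ V']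

theorem eq_top_of_irreducible {ρ : Representation ℂ G V} (hρ : ρ.IsIrreducible)
    (p : Submodule ℂ V) (hp : ∀ g, ∀ x ∈ p, ρ g x ∈ p) {v : V} (hv : v ∈ p) (h0 : v ≠ 0) :
    p = ⊤ := by
  have h := hρ.eq_bot_or_eq_top (⟨p, fun g x hx => hp g x hx⟩ : Subrepresentation ρ)
  rcases h with h | h
  · have h1 : p = ⊥ := congrArg Subrepresentation.toSubmodule h
    rw [h1, Submodule.mem_bot] at hv
    exact absurd hv h0
  · exact congrArg Subrepresentation.toSubmodule h

theorem span_eq_top_of_irreducible {ρ : Representation ℂ G V} (hρ : ρ.IsIrreducible)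
    (S : Set V) (hS : ∀ g, ∀ x ∈ S, ρ g x ∈ Submodule.span ℂ S) {v : V} (hv : v ∈ S) (h0 : v ≠ 0) :
    Submodule.span ℂ S = ⊤ := by
  refine eq_top_of_irreducible hρ _ (fun g x hx => ?_) (Submodule.subset_span hv) h0
  have : Submodule.span ℂ S ≤ (Submodule.span ℂ S).comap (ρ g) :=
    Submodule.span_le.2 fun x hx => hS g x hx
  exact this hx

theorem exists_ne_zero_of_irreducible {ρ : Representation ℂ G V} (hρ : ρ.IsIrreducible) :
    ∃ v : V, v ≠ 0 := by
  by_contra! h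
  have : (⊥ : Subrepresentation ρ) = ⊤ := by
    apply Subrepresentation.toSubmodule_injective
    exact ((Submodule.eq_bot_iff _).2 fun x _ => h x).symm
  exact bot_ne_top this

theorem isIrreducible_of_forall {ρ : Representation ℂ G V} {v : V} (hv : v ≠ 0)
    (h : ∀ p : Submodule ℂ V, (∀ g, ∀ x ∈ p, ρ g x ∈ p) → p ≠ ⊥ → p = ⊤) : ρ.IsIrreducible := by
  have : Nontrivial (Subrepresentation ρ) := by
    refine ⟨⊥, ⊤, fun h => hv ?_⟩
    have h1 : (⊥ : Submodule ℂ V) = ⊤ := congrArg Subrepresentation.toSubmodule h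
    have h2 : v ∈ (⊤ : Submodule ℂ V) := trivial
    rwa [← h1, Submodule.mem_bot] at h2
  refine ⟨fun σ => ?_⟩
  by_cases h0 : σ.toSubmodule = ⊥
  · exact Or.inl (Subrepresentation.toSubmodule_injective h0)
  · exact Or.inr (Subrepresentation.toSubmodule_injective
      (h _ (fun g x hx => σ.apply_mem_toSubmodule g hx) h0))

/-- A nonzero equivariant map between irreducible representations gives an equivalence. -/
theorem nonempty_equiv_of_ne_zero {ρ : Representation ℂ G V} {ρ' : Representation ℂ G V'}
    (hρ : ρ.IsIrreducible) (hρ' : ρ'.IsIrreducible) (f : V →ₗ[ℂ] V')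
    (hf : ∀ g v, f (ρ g v) = ρ' g (f v)) (h0 : f ≠ 0) : Nonempty (ρ.Equiv ρ') := by
  let F : ρ.IntertwiningMap ρ' := ⟨f, fun g => LinearMap.ext fun v => hf g v⟩
  rcases Representation.IsIrreducible.bijective_or_eq_zero F with h | h
  · exact ⟨F.ofBijective h⟩
  · exact absurd (congrArg Representation.IntertwiningMap.toLinearMap h) h0

/-- If every group element acts by a scalar, the representation is one-dimensional. -/
theorem nonempty_equiv_of_scalar {ρ : Representation ℂ G V} (hρ : ρ.IsIrreducible)
    (ρ' : Representation ℂ G ℂ) (h : ∀ g v, ρ g v = ρ' g 1 • v) : Nonempty (ρ.Equiv ρ') := by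
  obtain ⟨v, hv⟩ := exists_ne_zero_of_irreducible hρ
  have htop : Submodule.span ℂ {v} = ⊤ := by
    refine span_eq_top_of_irreducible hρ _ (fun g x hx => ?_) (Set.mem_singleton v) hv
    rw [h]
    exact Submodule.smul_mem _ _ (Submodule.subset_span hx)
  let e : ℂ ≃ₗ[ℂ] V := (LinearEquiv.toSpanNonzeroSingleton ℂ V v hv).trans
    (LinearEquiv.ofTop _ htop)
  have he : ∀ c : ℂ, e c = c • v := fun c => rfl
  have hs : ∀ g c, e (ρ' g c) = ρ g (e c) := by
    intro g c
    have h1 : ρ' g c = c * ρ' g 1 := by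
      rw [← smul_eq_mul, ← map_smul, smul_eq_mul, mul_one]
    rw [he, he, map_smul, h, h1, mul_smul]
  exact ⟨(Representation.Equiv.mk e fun g => LinearMap.ext fun c => hs g c).symm⟩

end Irreducible

/-! ### The pointwise stabilizer of a non-diagonal reflecting hyperplane -/

section Hyperplane

variable {d r : ℕ}

/-- `monomialHom` as a homomorphism to `G(d,1,r)`. -/
def wreathHom (d r : ℕ) : Wreath d r →* groupG d r := (monomialHom d r).rangeRestrict

/-- The matrix of a permutation, as an element of `G(d,1,r)`. -/
def permElt (d : ℕ) (σ : Equiv.Perm (Fin r)) : groupG d r :=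
  wreathHom d r (SemidirectProduct.inr σ)

theorem monomialMatrix_mulVec_single (x : Wreath d r) (k l : Fin r) :
    (monomialMatrix d r x *ᵥ Pi.single k 1) l =
      if x.right k = l then ((x.left l : ℂˣ) : ℂ) else 0 := by
  rw [Matrix.mulVec_single_one]
  simp [monomialMatrix, eq_comm]

theorem mem_fixedSpace {g : GL (Fin r) ℂ} {v : Fin r → ℂ} :
    v ∈ fixedSpace g ↔ (g : Matrix (Fin r) (Fin r) ℂ) *ᵥ v = v := by
  simp [fixedSpace, LinearMap.mem_ker, sub_eq_zero]

/-- The shape of a non-diagonal monomial reflection. -/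
theorem exists_swap_of_isReflection (x : Wreath d r) (hx : IsReflection (monomialHom d r x))
    (hd : ¬ (monomialMatrix d r x).IsDiag) :
    ∃ i j, i ≠ j ∧ x.right = Equiv.swap i j ∧ x.left i * x.left j = 1 ∧
      ∀ k, k ≠ i → k ≠ j → x.left k = 1 := by
  obtain ⟨a, σ⟩ := x
  have hj : ∃ j, σ j ≠ j := by
    by_contra! h
    refine hd fun i j hij => ?_
    simp [monomialMatrix, h, hij]
  obtain ⟨j, hj⟩ := hj
  obtain ⟨i, rfl⟩ : ∃ i, i = σ j := ⟨_, rfl⟩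
  set i := σ j with hi
  set f := Matrix.toLin' (monomialMatrix d r ⟨a, σ⟩) - LinearMap.id with hf
  have hrank : Module.finrank ℂ (LinearMap.range f) = 1 := by
    have h1 := LinearMap.finrank_range_add_finrank_ker f
    have h2 : Module.finrank ℂ (LinearMap.ker f) + 1 = r := hx
    simp only [Module.finrank_fintype_fun_eq_card, Fintype.card_fin] at h1
    omega
  have hval : ∀ k l, f (Pi.single k 1) l =
      (if σ k = l then ((a l : ℂˣ) : ℂ) else 0) - if k = l then 1 else 0 := by
    intro k l
    rw [hf, LinearMap.sub_apply, Pi.sub_apply, Matrix.toLin'_apply, monomialMatrix_mulVec_single]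
    simp [Pi.single_apply, eq_comm]
  have hne : (⟨f (Pi.single j 1), LinearMap.mem_range_self _ _⟩ : LinearMap.range f) ≠ 0 := by
    intro h
    have := congrFun (congrArg Subtype.val h) j
    simp [hval, ← hi, hj] at this
  -- Since s - 1 has rank one, every column is a multiple of the nonzero column j, which is a_i e_i
  -- - e_j.
  have hprop : ∀ k, ∃ c : ℂ, ∀ l, f (Pi.single k 1) l = c * f (Pi.single j 1) l := by
    intro k
    obtain ⟨c, hc⟩ := (finrank_eq_one_iff_of_nonzero' _ hne).1 hrank
      ⟨f (Pi.single k 1), LinearMap.mem_range_self _ _⟩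
    exact ⟨c, fun l => (congrFun (congrArg Subtype.val hc) l).symm⟩
  have hij : i ≠ j := hj
  have hσi : σ i ≠ i := fun h => hij (σ.injective (h.trans hi))
  have hai : ((a i : ℂˣ) : ℂ) ≠ 0 := Units.ne_zero _
  obtain ⟨c, hc⟩ := hprop i
  have hc1 := hc i
  have hc2 := hc j
  simp only [hval, if_neg hσi, ← hi, if_true, if_neg hij, if_neg hij.symm] at hc1 hc2
  have hc0 : c ≠ 0 := by rintro rfl; simp at hc1
  have hσij : σ i = j := by
    by_contra h
    simp [h, hc0] at hc2
  rw [if_pos hσij] at hc2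
  -- Column k is zero in row i, where column j has the entry a_i ≠ 0; so the whole column k of s - 1
  -- vanishes.
  have hother : ∀ k, k ≠ i → k ≠ j → σ k = k ∧ a k = 1 := by
    intro k hki hkj
    obtain ⟨e, he⟩ := hprop k
    have h1 := he i
    have h2 := he k
    have hσk : σ k ≠ i := fun h => hkj (σ.injective (h.trans hi))
    simp only [hval, ← hi, if_true, if_neg hσk, if_neg hki, if_neg hij.symm] at h1
    have he0 : e = 0 := by
      simp only [sub_zero, zero_eq_mul] at h1
      exact h1.resolve_right hai
    rw [he0, hval] at h2
    by_cases h : σ k = k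
    · refine ⟨h, ?_⟩
      simp only [h, if_true, zero_mul, sub_eq_zero] at h2
      exact Subtype.ext (Units.ext h2)
    · simp [h] at h2
  refine ⟨i, j, hij, ?_, ?_, fun k h1 h2 => (hother k h1 h2).2⟩
  · ext k
    by_cases h1 : k = i
    · subst h1; simp [hσij]
    · by_cases h2 : k = j
      · subst h2; simp [← hi]
      · simp [Equiv.swap_apply_of_ne_of_ne h1 h2, (hother k h1 h2).1]
  · refine Subtype.ext (Units.ext ?_)
    simp only [Subgroup.coe_mul, Units.val_mul, OneMemClass.coe_one, Units.val_one]
    have h3 : ((a j : ℂˣ) : ℂ) = -c := by simpa using hc2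
    rw [h3]
    linear_combination hc1

/-- The conjugating element is the diagonal matrix whose only possibly nontrivial entry is a_j, in
position j; the relation a_i a_j = 1 makes the entry in position i correct. -/
theorem wreath_eq_conj (x : Wreath d r) {i j : Fin r} (hij : i ≠ j)
    (hx : x.right = Equiv.swap i j) (h1 : x.left i * x.left j = 1)
    (h2 : ∀ k, k ≠ i → k ≠ j → x.left k = 1) :
    ∃ h : Wreath d r, x = h * SemidirectProduct.inr (Equiv.swap i j) * h⁻¹ := by
  refine ⟨SemidirectProduct.inl (Pi.mulSingle j (x.left j)), ?_⟩
  rw [← map_inv]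
  apply SemidirectProduct.ext
  · funext k
    have h3 : (mulAutArrow (Equiv.swap i j) ((Pi.mulSingle j (x.left j))⁻¹ :
        Fin r → rootsOfUnity d ℂ)) k = 
          ((Pi.mulSingle j (x.left j))⁻¹ : Fin r → rootsOfUnity d ℂ) (Equiv.swap i j k) := rfl
    simp only [SemidirectProduct.mul_left, SemidirectProduct.left_inl, SemidirectProduct.right_inl,
      SemidirectProduct.left_inr, SemidirectProduct.right_inr, map_one, mul_one, one_mul,
      SemidirectProduct.mul_right, Pi.mul_apply, h3, Pi.inv_apply]
    by_cases hki : k = i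
    · subst hki
      simp [hij, eq_inv_of_mul_eq_one_left h1]
    · by_cases hkj : k = j
      · subst hkj
        simp [hij]
      · simp [Equiv.swap_apply_of_ne_of_ne hki hkj, hkj, h2 k hki hkj]
  · simp [hx]

theorem detV_permElt_swap {i j : Fin r} (hij : i ≠ j) :
    detV (groupG d r) (permElt d (Equiv.swap i j)) = -1 := by
  have h : monomialMatrix d r (SemidirectProduct.inr (Equiv.swap i j)) =
      (Equiv.swap i j).permMatrix ℂ := by
    ext k l
    have : (k = Equiv.swap i j l) ↔ (Equiv.swap i j k = l) :=
      (Equiv.swap_apply_eq_iff (x := i) (y := j) (z := k) (w := l)).symm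
    simp [monomialMatrix, Equiv.Perm.permMatrix, PEquiv.toMatrix_apply, Equiv.toPEquiv_apply,
      this, eq_comm]
  change (monomialMatrix d r (SemidirectProduct.inr (Equiv.swap i j))).det = -1
  rw [h, Matrix.det_permutation, Equiv.Perm.sign_swap hij]
  simp

theorem detV_mul {G : Subgroup (GL (Fin r) ℂ)} (g h : G) :
    detV G (g * h) = detV G g * detV G h := by
  simp [detV]

theorem detV_one {G : Subgroup (GL (Fin r) ℂ)} : detV G 1 = 1 := by
  simp [detV]

/-- `G_H` has order two, and its generator is conjugate to a transposition matrix. -/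
theorem exists_generator {H : Submodule ℂ (Fin r → ℂ)} (hH : IsNonDiagonalHyperplane d r H) :
    ∃ s h : groupG d r, ∃ i j : Fin r, i ≠ j ∧ s = h * permElt d (Equiv.swap i j) * h⁻¹ ∧
      ∀ g, g ∈ fixer (groupG d r) H ↔ g = 1 ∨ g = s := by
  obtain ⟨s, ⟨x, rfl⟩, hrefl, hdiag, rfl⟩ := hH
  obtain ⟨i, j, hij, hx, h1, h2⟩ := exists_swap_of_isReflection x hrefl hdiag
  obtain ⟨h, hh⟩ := wreath_eq_conj x hij hx h1 h2
  refine ⟨wreathHom d r x, wreathHom d r h, i, j, hij, ?_, ?_⟩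
  · rw [permElt, ← map_inv, ← map_mul, ← map_mul, ← hh]
  · intro g
    constructor
    · intro hg
      obtain ⟨⟨_, ⟨z, rfl⟩⟩, rfl⟩ : ∃ g', g' = g := ⟨g, rfl⟩
      -- The hyperplane contains e_k for k ≠ i, j and the vector e_i + a_j e_j. Testing z on these
      -- leaves only z = 1 and z = s.
      have hfix : ∀ v, (monomialMatrix d r x) *ᵥ v = v → (monomialMatrix d r z) *ᵥ v = v :=
        fun v hv => hg v (mem_fixedSpace.2 hv)
      obtain ⟨a, σ⟩ := x
      obtain ⟨b, τ⟩ := z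
      simp only at hx h1 h2
      have hother : ∀ k, k ≠ i → k ≠ j → τ k = k ∧ b k = 1 := by
        intro k hki hkj
        have h3 := hfix (Pi.single k 1) (by
          ext l
          rw [monomialMatrix_mulVec_single, hx]
          simp only [Equiv.swap_apply_of_ne_of_ne hki hkj, Pi.single_apply]
          by_cases hl : k = l
          · subst hl; simp [h2 k hki hkj]
          · simp [hl, Ne.symm hl])
        have h4 := congrFun h3 k
        rw [monomialMatrix_mulVec_single, Pi.single_eq_same] at h4
        by_cases h5 : τ k = k
        · rw [if_pos h5] at h4
          exact ⟨h5, Subtype.ext (Units.ext h4)⟩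
        · simp [h5] at h4
      have h3 := hfix (Pi.single i 1 + ((a j : ℂˣ) : ℂ) • Pi.single j 1) (by
        rw [Matrix.mulVec_add, Matrix.mulVec_smul]
        ext l
        simp only [Pi.add_apply, Pi.smul_apply, monomialMatrix_mulVec_single, hx,
          Equiv.swap_apply_left, Equiv.swap_apply_right, smul_eq_mul, Pi.single_apply]
        by_cases hl : l = i
        · subst hl
          have h7 : ((a j : ℂˣ) : ℂ) * ((a l : ℂˣ) : ℂ) = 1 := by
            rw [mul_comm]
            exact congrArg (fun u : rootsOfUnity d ℂ => ((u : ℂˣ) : ℂ)) h1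
          simp [hij, hij.symm, h7]
        · by_cases hl2 : l = j
          · subst hl2; simp [hij, hij.symm]
          · simp [hl, hl2, Ne.symm hl, Ne.symm hl2])
      rw [Matrix.mulVec_add, Matrix.mulVec_smul] at h3
      have h4 := congrFun h3 i
      have h5 := congrFun h3 j
      simp only [Pi.add_apply, Pi.smul_apply, monomialMatrix_mulVec_single, smul_eq_mul,
        Pi.single_apply, if_true, if_neg hij, if_neg hij.symm] at h4 h5
      by_cases hτ : τ i = i
      · left
        have hτj : τ j = j := by
          by_contra hne
          have h6 : τ j ≠ i := fun h => hij (τ.injective (hτ.trans h.symm))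
          exact hne (τ.injective ((hother _ h6 hne).1))
        rw [hτ, hτj] at h4 h5
        simp only [if_true, if_neg hij, if_neg hij.symm] at h4 h5
        have hz : (⟨b, τ⟩ : Wreath d r) = 1 := by
          apply SemidirectProduct.ext
          · funext k
            by_cases hki : k = i
            · subst hki
              exact Subtype.ext (Units.ext (by simpa using h4))
            · by_cases hkj : k = j
              · subst hkj
                refine Subtype.ext (Units.ext ?_)
                simpa using h5
              · exact (hother k hki hkj).2
          · ext k
            by_cases hki : k = i
            · subst hki; simp [hτ]
            · by_cases hkj : k = j
              · subst hkj; simp [hτj]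
              · simp [(hother k hki hkj).1]
        exact (congrArg (wreathHom d r) hz).trans (map_one _)
      · right
        have hτi : τ i = j := by
          by_contra hne
          exact hτ (τ.injective ((hother _ hτ hne).1))
        have hτj : τ j = i := by
          by_contra hne
          have h6 : τ j ≠ j := fun h => hij (τ.injective (hτi.trans h.symm))
          exact h6 (τ.injective ((hother _ hne h6).1))
        rw [hτi, hτj] at h4 h5
        simp only [if_true, if_neg hij, if_neg hij.symm] at h4 h5
        have hz : (⟨b, τ⟩ : Wreath d r) = ⟨a, σ⟩ := by
          apply SemidirectProduct.ext
          · funext k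
            by_cases hki : k = i
            · subst hki
              have h7 : a j * b k = 1 := Subtype.ext (Units.ext (by simpa using h4))
              change b k = a k
              rw [eq_inv_of_mul_eq_one_right h7, eq_inv_of_mul_eq_one_left h1]
            · by_cases hkj : k = j
              · subst hkj
                refine Subtype.ext (Units.ext ?_)
                simpa using h5
              · exact (hother k hki hkj).2.trans (h2 k hki hkj).symm
          · ext k
            change ((τ k : Fin r) : ℕ) = σ k
            rw [hx]
            by_cases hki : k = i
            · subst hki; simp [hτi]
            · by_cases hkj : k = j
              · subst hkj; simp [hτj]
              · simp [(hother k hki hkj).1, Equiv.swap_apply_of_ne_of_ne hki hkj]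
        exact congrArg (wreathHom d r) hz
    · rintro (rfl | rfl)
      · exact one_mem _
      · exact fun v hv => mem_fixedSpace.1 hv

end Hyperplane

/-! ### The types of a hyperplane with a fixer of order two -/

section Types

variable {ℓ : ℕ} {G : Subgroup (GL (Fin ℓ) ℂ)} {H : Submodule ℂ (Fin ℓ → ℂ)} {s : G}
  {M : Type*} [AddCommGroup M] [Module ℂ M] (ρ : Representation ℂ G M)

theorem orderE_eq_two (hs : detV G s = -1) (hf : ∀ g, g ∈ fixer G H ↔ g = 1 ∨ g = s) :
    orderE G H = 2 := by
  have hne : (1 : G) ≠ s := by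
    rintro rfl
    rw [detV_one] at hs
    norm_num at hs
  have : ((fixer G H : Subgroup G) : Set G) = {1, s} := by
    ext g
    simpa using hf g
  rw [orderE, ← SetLike.coe_sort_coe, Nat.card_coe_set_eq, this, Set.ncard_pair hne]

theorem multN_zero (hs : detV G s = -1) (hf : ∀ g, g ∈ fixer G H ↔ g = 1 ∨ g = s) :
    multN G H ρ 0 = posDim ρ s := by
  have : (⨅ g : fixer G H, LinearMap.ker (ρ (g : G) - ((detV G (g : G))⁻¹ ^ 0) • LinearMap.id) :
      Submodule ℂ M) = LinearMap.ker (ρ s - 1) := by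
    ext v
    simp only [Submodule.mem_iInf, mem_ker_sub_one]
    constructor
    · intro h
      simpa [sub_eq_zero] using h ⟨s, (hf s).2 (Or.inr rfl)⟩
    · rintro h ⟨g, hg⟩
      rcases (hf g).1 hg with rfl | rfl
      · simp
      · simp [h]
  rw [multN, this, posDim]

theorem multN_one (hs : detV G s = -1) (hf : ∀ g, g ∈ fixer G H ↔ g = 1 ∨ g = s) :
    multN G H ρ 1 = negDim ρ s := by
  have : (⨅ g : fixer G H, LinearMap.ker (ρ (g : G) - ((detV G (g : G))⁻¹ ^ 1) • LinearMap.id) :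
      Submodule ℂ M) = LinearMap.ker (ρ s + 1) := by
    ext v
    simp only [Submodule.mem_iInf, mem_ker_add_one]
    constructor
    · intro h
      have h1 := h ⟨s, (hf s).2 (Or.inr rfl)⟩
      rw [hs] at h1
      simpa [add_eq_zero_iff_eq_neg] using h1
    · rintro h ⟨g, hg⟩
      rcases (hf g).1 hg with rfl | rfl
      · simp [detV_one]
      · simp [h, hs]
  rw [multN, this, negDim]

theorem nH_eq (hs : detV G s = -1) (hf : ∀ g, g ∈ fixer G H ↔ g = 1 ∨ g = s) :
    nH G H ρ = negDim ρ s := by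
  rw [nH, orderE_eq_two hs hf, Finset.sum_range_succ, Finset.sum_range_one, multN_one ρ hs hf]
  simp

theorem jMultiset_eq (hs : detV G s = -1) (hf : ∀ g, g ∈ fixer G H ↔ g = 1 ∨ g = s) :
    jMultiset G H ρ = Multiset.replicate (posDim ρ s) 0 + Multiset.replicate (negDim ρ s) 1 := by
  rw [jMultiset, orderE_eq_two hs hf, Finset.sum_range_succ, Finset.sum_range_one,
    multN_one ρ hs hf, multN_zero ρ hs hf]

theorem isGood_iff (hs : detV G s = -1) (hf : ∀ g, g ∈ fixer G H ↔ g = 1 ∨ g = s) :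
    IsGood G H ρ ↔ negDim ρ s ≤ 1 := by
  rw [IsGood, nH_eq ρ hs hf, orderE_eq_two hs hf]
  omega

theorem isExcellent_iff [FiniteDimensional ℂ M] (hss : s * s = 1) (hs : detV G s = -1)
    (hf : ∀ g, g ∈ fixer G H ↔ g = 1 ∨ g = s) : IsExcellent G H ρ ↔ negDim ρ s ≤ 1 := by
  have h1 := finrank_eq_posDim_add_negDim ρ hss
  have hexp : Complex.exp (2 * Real.pi * Complex.I / ((2 : ℕ) : ℂ)) = -1 := by
    rw [← Complex.exp_pi_mul_I]
    congr 1
    push_cast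
    ring
  rw [IsExcellent, orderE_eq_two hs hf, hexp]
  constructor
  · rintro ⟨g, hg, hdet, hle⟩
    rcases (hf g).1 hg with rfl | rfl
    · rw [detV_one] at hdet
      norm_num at hdet
    · change _ ≤ posDim ρ g + 1 at hle
      omega
  · intro h
    refine ⟨s, (hf s).2 (Or.inr rfl), hs, ?_⟩
    change _ ≤ posDim ρ s + 1
    omega

theorem nH_charRep_of_trivial (hs : detV G s = -1) (hf : ∀ g, g ∈ fixer G H ↔ g = 1 ∨ g = s)
    (χ : G →* ℂˣ) (hχ : ∀ g ∈ fixer G H, χ g = 1) : nH G H (charRep G χ) = 0 := by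
  rw [nH_eq _ hs hf, negDim]
  have : LinearMap.ker (charRep G χ s + 1) = ⊥ := by
    rw [Submodule.eq_bot_iff]
    intro v hv
    rw [mem_ker_add_one] at hv
    have h1 : charRep G χ s v = v := by simp [charRep, hχ s ((hf s).2 (Or.inr rfl))]
    rw [h1] at hv
    exact CharZero.eq_neg_self_iff.1 hv
  rw [this, finrank_bot]

theorem nH_charRep_of_nontrivial (hss : s * s = 1) (hs : detV G s = -1)
    (hf : ∀ g, g ∈ fixer G H ↔ g = 1 ∨ g = s)
    (χ : G →* ℂˣ) (hχ : ¬ ∀ g ∈ fixer G H, χ g = 1) : nH G H (charRep G χ) = 1 := by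
  have h1 : χ s ≠ 1 := by
    intro h
    refine hχ fun g hg => ?_
    rcases (hf g).1 hg with rfl | rfl
    · exact map_one χ
    · exact h
  have h2 : ((χ s : ℂˣ) : ℂ) = -1 := by
    have h3 : ((χ s : ℂˣ) : ℂ) * (χ s : ℂˣ) = 1 := by
      rw [← Units.val_mul, ← map_mul, hss, map_one, Units.val_one]
    rcases mul_self_eq_one_iff.1 h3 with h | h
    · exact absurd (Units.ext h) h1
    · exact h
  rw [nH_eq _ hs hf, negDim]
  have : LinearMap.ker (charRep G χ s + 1) = ⊤ := by
    rw [Submodule.eq_top_iff']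
    intro v
    rw [mem_ker_add_one]
    simp [charRep, h2]
  rw [this, finrank_top, Module.finrank_self]

/-- Zeros do not matter, so one splits m ones. With e = n_H(χ), both parts can reach 2 - e exactly
when m ≥ 2 (2 - e). -/
theorem isAcceptable_iff (hs : detV G s = -1) (hf : ∀ g, g ∈ fixer G H ↔ g = 1 ∨ g = s)
    (χ : G →* ℂˣ) : IsAcceptable G H ρ χ ↔
      negDim ρ s + 2 * nH G H (charRep G χ) ≤ 3 := by
  rw [IsAcceptable, orderE_eq_two hs hf, jMultiset_eq ρ hs hf]
  set e := nH G H (charRep G χ)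
  constructor
  · intro h
    by_contra! hlt
    have h2e : 2 - e ≤ negDim ρ s := by omega
    -- The violating partition: one part receives 2 - e ones, and the other still has at least as
    -- many.
    have := h (Multiset.replicate (posDim ρ s) 0 + Multiset.replicate (2 - e) 1)
      (Multiset.replicate (negDim ρ s - (2 - e)) 1) (by
        rw [add_assoc, ← Multiset.replicate_add, Nat.add_sub_cancel' h2e])
    simp only [Multiset.sum_add, Multiset.sum_replicate, smul_eq_mul, mul_zero, mul_one,
      zero_add] at this
    omega
  · intro h A B hAB
    have h1 := congrArg Multiset.sum hAB
    simp only [Multiset.sum_add, Multiset.sum_replicate, smul_eq_mul, mul_zero, mul_one,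
      zero_add] at h1
    omega

end Types

/-! ### The character of an induced representation -/

section Induced

open Representation MonoidAlgebra

variable {I G W : Type*} [Group I] [Group G] [AddCommGroup W] [Module ℂ W]

theorem trace_mapDomainLinearMap {X : Type*} [Fintype X] [DecidableEq X] (f : X → X) :
    LinearMap.trace ℂ (MonoidAlgebra ℂ X) (mapDomainLinearMap ℂ ℂ f) =
      ∑ x, if f x = x then (1 : ℂ) else 0 := by
  rw [LinearMap.trace_eq_matrix_trace ℂ (MonoidAlgebra.basis X ℂ), Matrix.trace]
  refine Finset.sum_congr rfl fun x _ => ?_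
  rw [Matrix.diag_apply, LinearMap.toMatrix_apply, MonoidAlgebra.basis_apply]
  change ((mapDomainLinearMap ℂ ℂ f) (single x 1)).coeff x = _
  simp [Finsupp.single_apply]

instance finiteDimensional_monoidAlgebra [Finite G] :
    FiniteDimensional ℂ (MonoidAlgebra ℂ G) :=
  (coeffLinearEquiv ℂ : MonoidAlgebra ℂ G ≃ₗ[ℂ] (G →₀ ℂ)).symm.finiteDimensional

instance finiteDimensional_indV [Finite G] [FiniteDimensional ℂ W] (φ : I →* G)
    (ρ : Representation ℂ I W) : FiniteDimensional ℂ (IndV φ ρ) :=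
  Module.Finite.of_surjective _ (Coinvariants.mk_surjective _)

/-- Frobenius' formula, multiplied by |I|, so that φ need not be injective. The sum over I of the
tensor action descends to a map `sec` out of the coinvariants whose composite with the projection is
|I|. Cyclicity of the trace then moves the computation to ℂ[G] ⊗ W. -/
theorem trace_ind [Fintype I] [Fintype G] [DecidableEq G] [FiniteDimensional ℂ W]
    (φ : I →* G) (ρ : Representation ℂ I W) (s : G) :
    (Fintype.card I : ℂ) * LinearMap.trace ℂ _ (ind φ ρ s) =
      ∑ x : G, ∑ h : I, if φ h = x * s * x⁻¹ then LinearMap.trace ℂ W (ρ h) else 0 := by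
  set T := tprod ((leftRegular ℂ G).comp φ) ρ with hT
  have hcard : (Fintype.card I : ℂ) ≠ 0 := by simp
  set S : TensorProduct ℂ (MonoidAlgebra ℂ G) W →ₗ[ℂ] TensorProduct ℂ (MonoidAlgebra ℂ G) W :=
    ∑ h, T h with hS
  let sec : IndV φ ρ →ₗ[ℂ] TensorProduct ℂ (MonoidAlgebra ℂ G) W :=
    Coinvariants.lift T S (fun g => by
      rw [hS, ← Module.End.mul_eq_comp, Finset.sum_mul]
      exact Fintype.sum_equiv (Equiv.mulRight g) _ _ fun h => by simp)
  set R : TensorProduct ℂ (MonoidAlgebra ℂ G) W →ₗ[ℂ] TensorProduct ℂ (MonoidAlgebra ℂ G) W :=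
    (mapDomainLinearMap ℂ ℂ fun x => x * s⁻¹).rTensor W with hR
  have h1 : (Coinvariants.mk T) ∘ₗ sec = (Fintype.card I : ℂ) • LinearMap.id := by
    refine Coinvariants.hom_ext (LinearMap.ext fun x => ?_)
    have hx : sec (Coinvariants.mk T x) = S x := rfl
    rw [LinearMap.comp_apply, LinearMap.comp_apply, hx, hS, LinearMap.sum_apply, map_sum]
    simp only [Coinvariants.mk_self_apply]
    simp only [Finset.sum_const, Finset.card_univ, Nat.cast_smul_eq_nsmul]
    rfl
  have h2 : ind φ ρ s ∘ₗ Coinvariants.mk T = Coinvariants.mk T ∘ₗ R := rfl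
  have h3 : (Fintype.card I : ℂ) * LinearMap.trace ℂ _ (ind φ ρ s) =
      LinearMap.trace ℂ _ (R ∘ₗ S) := by
    rw [← smul_eq_mul, ← map_smul]
    have h4 : (Fintype.card I : ℂ) • ind φ ρ s = Coinvariants.mk T ∘ₗ (R ∘ₗ sec) := by
      rw [← LinearMap.comp_assoc, ← h2, LinearMap.comp_assoc, h1, LinearMap.comp_smul,
        LinearMap.comp_id]
    have h5 : (R ∘ₗ sec) ∘ₗ Coinvariants.mk T = R ∘ₗ S := by
      rw [LinearMap.comp_assoc, Coinvariants.lift_comp_mk]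
    rw [h4, LinearMap.trace_comp_comm', h5]
  -- Each summand is a permutation of the basis of ℂ[G] tensored with ρ h, so its trace is the
  -- number of fixed points times the trace of ρ h.
  have h6 : ∀ h, R ∘ₗ T h =
      TensorProduct.map (mapDomainLinearMap ℂ ℂ fun x => φ h * x * s⁻¹) (ρ h) := by
    intro h
    ext x w
    simp [hR, hT]
  rw [h3, hS, ← Module.End.mul_eq_comp, Finset.mul_sum, map_sum]
  simp only [Module.End.mul_eq_comp, h6, LinearMap.trace_tensorProduct', trace_mapDomainLinearMap,
    Finset.sum_mul]
  rw [Finset.sum_comm]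
  refine Finset.sum_congr rfl fun x _ => Finset.sum_congr rfl fun h _ => ?_
  have : φ h * x * s⁻¹ = x ↔ φ h = x * s * x⁻¹ := by
    rw [mul_inv_eq_iff_eq_mul, eq_mul_inv_iff_mul_eq]
  simp only [this]
  split_ifs <;> simp

end Induced

/-! ### Transpositions of the factors -/

section FactorNeg

variable {d : ℕ} {n : Fin d → ℕ} {W : Type*} [AddCommGroup W] [Module ℂ W]
  (ρ : Representation ℂ (YoungGroup n) W)

/-- The multiplicity of `-1` for the transpositions of the factor `S_{n_j}`. -/
def factorNeg (j : Fin d) : ℕ :=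
  if h : 2 ≤ n j then
    negDim ρ (Pi.mulSingle j (Equiv.swap (⟨0, by omega⟩ : Fin (n j)) ⟨1, by omega⟩))
  else 0

theorem negDim_mulSingle_swap (j : Fin d) {x y : Fin (n j)} (hxy : x ≠ y) :
    negDim ρ (Pi.mulSingle j (Equiv.swap x y)) = factorNeg ρ j := by
  have h2 : 2 ≤ n j := by
    by_contra h
    exact hxy (Fin.ext (by omega))
  rw [factorNeg, dif_pos h2]
  have h01 : (⟨0, by omega⟩ : Fin (n j)) ≠ ⟨1, by omega⟩ := by simp
  obtain ⟨c, hc⟩ := isConj_iff.1 (Equiv.Perm.isConj_swap h01 hxy)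
  rw [← hc, Pi.mulSingle_mul, Pi.mulSingle_mul, Pi.mulSingle_inv, negDim_conj]

theorem mulSingle_swap_mul_self (j : Fin d) (x y : Fin (n j)) :
    (Pi.mulSingle j (Equiv.swap x y) : YoungGroup n) * Pi.mulSingle j (Equiv.swap x y) = 1 := by
  rw [← Pi.mulSingle_mul, Equiv.swap_mul_self, Pi.mulSingle_one]

/-- Twice the contribution of the pair `(p, q)` to the multiplicity of `-1`. -/
def pairWeight (p q : Σ j : Fin d, Fin (n j)) : ℕ :=
  if p.1 = q.1 then 2 * factorNeg ρ p.1 else Module.finrank ℂ W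

end FactorNeg

/-! ### The character of `β` at a permutation matrix -/

section BetaTrace

open Representation

variable {d r : ℕ} {n : Fin d → ℕ} (hn : ∑ j, n j = r)

theorem wreathHom_injective : Function.Injective (wreathHom d r) := by
  intro x y hxy
  have h : monomialMatrix d r x = monomialMatrix d r y :=
    congrArg (fun g : groupG d r => ((g : GL (Fin r) ℂ) : Matrix (Fin r) (Fin r) ℂ)) hxy
  have hne : ∀ (z : Wreath d r) (k l : Fin r), monomialMatrix d r z k l ≠ 0 ↔ k = z.right l := by
    intro z k l
    simp [monomialMatrix]
  have h1 : x.right = y.right := by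
    ext l
    have := (hne x (x.right l) l).2 rfl
    rw [h, hne] at this
    rw [this]
  apply SemidirectProduct.ext
  · funext k
    have := congrFun (congrFun h k) (x.right⁻¹ k)
    simp only [monomialMatrix, Matrix.of_apply, ← h1] at this
    exact Subtype.ext (Units.ext (by simpa using this))
  · exact h1

theorem wreathHom_surjective : Function.Surjective (wreathHom d r) :=
  (monomialHom d r).rangeRestrict_surjective

theorem youngHom_apply (τ : YoungGroup n) (k : Fin d) (z : Fin (n k)) :
    youngHom hn τ (blockEquiv hn ⟨k, z⟩) = blockEquiv hn ⟨k, τ k z⟩ := by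
  simp [youngHom, Equiv.Perm.sigmaCongrRightHom, Equiv.permCongrHom]

theorem block_blockEquiv (x : Σ j : Fin d, Fin (n j)) : block hn (blockEquiv hn x) = x.1 := by
  simp [block]

theorem youngHom_injective : Function.Injective (youngHom hn) := by
  intro σ τ h
  funext k
  ext z
  have h1 := congrArg (fun π : Equiv.Perm (Fin r) => π (blockEquiv hn ⟨k, z⟩)) h
  simp only [youngHom_apply] at h1
  have h2 := (blockEquiv hn).injective h1
  have h3 : σ k z = τ k z := by simpa using h2
  rw [h3]

theorem youngHom_mulSingle_swap (j : Fin d) (x y : Fin (n j)) :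
    youngHom hn (Pi.mulSingle j (Equiv.swap x y)) =
      Equiv.swap (blockEquiv hn ⟨j, x⟩) (blockEquiv hn ⟨j, y⟩) := by
  refine Equiv.ext fun p => ?_
  obtain ⟨⟨k, z⟩, rfl⟩ := (blockEquiv hn).surjective p
  rw [youngHom_apply]
  by_cases hk : k = j
  · subst hk
    rw [Pi.mulSingle_eq_same]
    by_cases hx : z = x
    · subst hx; simp
    · by_cases hy : z = y
      · subst hy; simp
      · rw [Equiv.swap_apply_of_ne_of_ne hx hy, Equiv.swap_apply_of_ne_of_ne] <;> simpa
  · rw [Pi.mulSingle_eq_of_ne hk, Equiv.swap_apply_of_ne_of_ne]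
    · simp
    · simp [hk]
    · simp [hk]

variable {W : Type*} [AddCommGroup W] [Module ℂ W] [FiniteDimensional ℂ W]
  (ρ : Representation ℂ (YoungGroup n) W)

-- Conjugating π by diag(a) σ gives τ = σ π σ⁻¹ with diagonal part a · τ(a)⁻¹. On it `blockChar` is
-- 1 when τ lies in the Young subgroup, by `blockChar_smul`. The sum over a is therefore a constant
-- factor, which cancels.
open Classical in
theorem trace_beta (hd : d ≠ 0) (π : Equiv.Perm (Fin r)) :
    (Fintype.card (YoungGroup n) : ℂ) * LinearMap.trace ℂ _ (beta hn ρ (permElt d π)) =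
      ∑ σ : Equiv.Perm (Fin r), ∑ y : YoungGroup n,
        if youngHom hn y = σ * π * σ⁻¹ then LinearMap.trace ℂ W (ρ y) else 0 := by
  have : NeZero d := ⟨hd⟩
  let e1 : Wreath d r ≃ (Fin r → rootsOfUnity d ℂ) × Equiv.Perm (Fin r) :=
    SemidirectProduct.equivProd
  let e2 : Inertia hn ≃ (Fin r → rootsOfUnity d ℂ) × YoungGroup n := SemidirectProduct.equivProd
  have : Finite (rootsOfUnity d ℂ) := inferInstance
  let : Fintype (rootsOfUnity d ℂ) := Fintype.ofFinite _
  let : Fintype (Wreath d r) := Fintype.ofEquiv _ e1.symm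
  let : Fintype (Inertia hn) := Fintype.ofEquiv _ e2.symm
  let e3 : Wreath d r ≃ groupG d r :=
    Equiv.ofBijective (wreathHom d r) ⟨wreathHom_injective, wreathHom_surjective⟩
  let : Fintype (groupG d r) := Fintype.ofEquiv _ e3
  have h1 := trace_ind (inertiaHom hn) (inertiaRep hn ρ) (permElt d π)
  have hD : (Fintype.card (Fin r → rootsOfUnity d ℂ) : ℂ) ≠ 0 := by simp
  apply mul_left_cancel₀ hD
  rw [← mul_assoc, ← Nat.cast_mul, ← Fintype.card_prod, ← Fintype.card_congr e2, h1]
  have h2 : ∀ (a : Fin r → rootsOfUnity d ℂ) (σ : Equiv.Perm (Fin r)),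
      (∑ h : Inertia hn, if inertiaHom hn h =
        wreathHom d r ⟨a, σ⟩ * permElt d π * (wreathHom d r ⟨a, σ⟩)⁻¹
        then LinearMap.trace ℂ W (inertiaRep hn ρ h) else 0) =
      ∑ y : YoungGroup n,
        if youngHom hn y = σ * π * σ⁻¹ then LinearMap.trace ℂ W (ρ y) else 0 := by
    intro a σ
    have hx : ∀ h : Inertia hn, inertiaHom hn h =
        wreathHom d r ⟨a, σ⟩ * permElt d π * (wreathHom d r ⟨a, σ⟩)⁻¹ ↔
        h.left = a * mulAutArrow (σ * π * σ⁻¹) a⁻¹ ∧ youngHom hn h.right = σ * π * σ⁻¹ := by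
      intro h
      rw [permElt, ← map_inv, ← map_mul, ← map_mul]
      have : inertiaHom hn h = wreathHom d r ⟨h.left, youngHom hn h.right⟩ := rfl
      rw [this, wreathHom_injective.eq_iff, SemidirectProduct.ext_iff]
      simp [mul_assoc]
    simp only [hx]
    refine (Fintype.sum_equiv e2 _ (fun p => if p.1 = a * mulAutArrow (σ * π * σ⁻¹) a⁻¹ ∧
      youngHom hn p.2 = σ * π * σ⁻¹ then LinearMap.trace ℂ W (inertiaRep hn ρ ⟨p.1, p.2⟩) else 0)
      (fun h => rfl)).trans ?_
    rw [Fintype.sum_prod_type, Finset.sum_comm]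
    refine Finset.sum_congr rfl fun y _ => ?_
    by_cases hy : youngHom hn y = σ * π * σ⁻¹
    · simp only [hy, and_true, if_true]
      rw [Finset.sum_ite_eq' Finset.univ, if_pos (Finset.mem_univ _)]
      have : blockChar hn (a * mulAutArrow (σ * π * σ⁻¹) a⁻¹) = 1 := by
        rw [map_mul, ← hy, blockChar_smul, ← map_mul, mul_inv_cancel, map_one]
      have h9 : inertiaRep hn ρ ⟨a * mulAutArrow (σ * π * σ⁻¹) a⁻¹, y⟩ = ρ y := by
        change (blockChar hn _ : ℂ) • ρ y = ρ y
        rw [this]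
        simp
      rw [h9]
    · simp [hy]
  refine (Fintype.sum_equiv e3 (fun x => ∑ y : YoungGroup n,
    if youngHom hn y = x.right * π * x.right⁻¹ then LinearMap.trace ℂ W (ρ y) else 0) _
    (fun x => (h2 x.left x.right).symm)).symm.trans ?_
  refine (Fintype.sum_equiv e1 _ (fun p => ∑ y : YoungGroup n,
    if youngHom hn y = p.2 * π * p.2⁻¹ then LinearMap.trace ℂ W (ρ y) else 0)
    (fun x => rfl)).trans ?_
  rw [Fintype.sum_prod_type]
  have h5 : ∀ c : ℂ, ∑ _x : Fin r → rootsOfUnity d ℂ, c =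
      Fintype.card (Fin r → rootsOfUnity d ℂ) * c := by simp
  exact h5 (∑ σ : Equiv.Perm (Fin r), ∑ y : YoungGroup n,
    if youngHom hn y = σ * π * σ⁻¹ then LinearMap.trace ℂ W (ρ y) else 0)

theorem permElt_swap_mul_self (i j : Fin r) :
    permElt d (Equiv.swap i j) * permElt d (Equiv.swap i j) = 1 := by
  rw [permElt, ← map_mul, ← map_mul, Equiv.swap_mul_self, map_one, map_one]

-- A transposition lies in the Young subgroup exactly when its two points share a block, and then it
-- comes from a single element of the product.
open Classical in
theorem sum_trace_swap (p q : Σ j : Fin d, Fin (n j)) (hpq : p ≠ q) :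
    (∑ y : YoungGroup n, if youngHom hn y = Equiv.swap (blockEquiv hn p) (blockEquiv hn q)
      then LinearMap.trace ℂ W (ρ y) else 0) = Module.finrank ℂ W - (pairWeight ρ p q : ℂ) := by
  obtain ⟨j, x⟩ := p
  obtain ⟨k, y⟩ := q
  by_cases hjk : j = k
  · subst hjk
    have hxy : x ≠ y := fun h => hpq (by rw [h])
    simp only [← youngHom_mulSingle_swap, (youngHom_injective hn).eq_iff]
    rw [Finset.sum_ite_eq' Finset.univ, if_pos (Finset.mem_univ _),
      trace_eq_finrank_sub_negDim ρ (mulSingle_swap_mul_self j x y), negDim_mulSingle_swap ρ j hxy]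
    simp [pairWeight]
  · rw [Finset.sum_eq_zero]
    · simp [pairWeight, hjk]
    · intro τ _
      rw [if_neg]
      intro h
      have h1 := block_youngHom hn τ (blockEquiv hn ⟨j, x⟩)
      rw [h, Equiv.swap_apply_left, block_blockEquiv, block_blockEquiv] at h1
      exact hjk h1.symm

/-- The character formula at the identity. -/
theorem finrank_indV (hd : d ≠ 0) :
    (Fintype.card (YoungGroup n) : ℂ) *
        Module.finrank ℂ (Representation.IndV (inertiaHom hn) (inertiaRep hn ρ)) =
      Fintype.card (Equiv.Perm (Fin r)) * Module.finrank ℂ W := by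
  classical
  have h := trace_beta hn ρ hd 1
  have h1 : permElt d (1 : Equiv.Perm (Fin r)) = 1 := by rw [permElt, map_one, map_one]
  have : NeZero d := ⟨hd⟩
  have : Finite (groupG d r) := by
    have : Finite (Wreath d r) := Finite.of_equiv
      ((Fin r → rootsOfUnity d ℂ) × Equiv.Perm (Fin r)) SemidirectProduct.equivProd.symm
    exact Finite.of_surjective _ wreathHom_surjective
  rw [h1, map_one, LinearMap.trace_one] at h
  rw [h]
  have h2 : ∀ y : YoungGroup n, youngHom hn y = 1 ↔ y = 1 := fun y => by
    rw [← map_one (youngHom hn), (youngHom_injective hn).eq_iff]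
  simp [h2, LinearMap.trace_one]

end BetaTrace

/-! ### Permutations with two prescribed values -/

section Counting

open Finset
open scoped Nat

variable {α : Type*} [Fintype α] [DecidableEq α]

omit [Fintype α] in
theorem exists_perm_pair {a b i j : α} (hab : a ≠ b) (hij : i ≠ j) :
    ∃ σ : Equiv.Perm α, σ a = i ∧ σ b = j := by
  refine ⟨Equiv.swap (Equiv.swap a i b) j * Equiv.swap a i, ?_, ?_⟩
  · rw [Equiv.Perm.mul_apply, Equiv.swap_apply_left, Equiv.swap_apply_of_ne_of_ne _ hij]
    intro h
    have h2 : Equiv.swap a i a = Equiv.swap a i b := by rw [Equiv.swap_apply_left]; exact h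
    exact hab ((Equiv.swap a i).injective h2)
  · rw [Equiv.Perm.mul_apply, Equiv.swap_apply_left]

/-- By double transitivity the count does not depend on the target pair, and the N(N-1) equal counts
add up to N!, where N is the cardinality of α. -/
theorem card_perm_pair {a b i j : α} (hab : a ≠ b) (hij : i ≠ j) :
    #{σ : Equiv.Perm α | σ a = i ∧ σ b = j} = (Fintype.card α - 2)! := by
  have hconst : ∀ p q, p ≠ q → #{σ : Equiv.Perm α | σ a = p ∧ σ b = q} =
      #{σ : Equiv.Perm α | σ a = i ∧ σ b = j} := by
    intro p q hpq
    obtain ⟨τ, h1, h2⟩ := exists_perm_pair hij hpq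
    refine (Finset.card_equiv (Equiv.mulLeft τ) fun σ => ?_).symm
    simp [← h1, ← h2]
  have hsum : (Fintype.card α)! = ∑ p : α × α with p.1 ≠ p.2,
      #{σ : Equiv.Perm α | σ a = p.1 ∧ σ b = p.2} := by
    rw [← Fintype.card_perm, ← Finset.card_univ,
      Finset.card_eq_sum_card_fiberwise (f := fun σ : Equiv.Perm α => (σ a, σ b))
        (t := Finset.univ.filter fun p : α × α => p.1 ≠ p.2)]
    · refine Finset.sum_congr rfl fun p _ => ?_
      congr 1
      ext σ
      simp [Prod.ext_iff]
    · intro σ _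
      simpa using hab
  rw [Finset.sum_congr rfl (fun p hp => hconst p.1 p.2 (Finset.mem_filter.1 hp).2),
    Finset.sum_const, smul_eq_mul] at hsum
  have hoff : #(Finset.univ.filter fun p : α × α => p.1 ≠ p.2) =
      Fintype.card α * Fintype.card α - Fintype.card α := by
    rw [← Finset.card_univ, ← Finset.offDiag_card]
    congr 1
    ext p
    simp
  rw [hoff] at hsum
  have hc : 2 ≤ Fintype.card α := by
    have := Finset.card_le_univ ({a, b} : Finset α)
    rwa [Finset.card_pair hab] at this
  obtain ⟨m, hm⟩ := Nat.exists_eq_add_of_le hc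
  rw [hm] at hsum ⊢
  have h3 : (2 + m) * (2 + m) - (2 + m) = (2 + m) * (1 + m) := by
    rw [← Nat.mul_sub_one]; congr 1; omega
  rw [h3, show 2 + m = (m + 1) + 1 by omega, Nat.factorial_succ, Nat.factorial_succ] at hsum
  have h4 : (m + 1 + 1) * (1 + m) * m ! =
      (m + 1 + 1) * (1 + m) * #{σ : Equiv.Perm α | σ a = i ∧ σ b = j} := by
    rw [← hsum]; ring
  have := Nat.eq_of_mul_eq_mul_left (by positivity) h4
  rw [← this]
  congr 1
  omega

theorem sum_perm_pair {a b : α} (hab : a ≠ b) (f : α → α → ℂ) :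
    ∑ σ : Equiv.Perm α, f (σ a) (σ b) =
      (Fintype.card α - 2)! * ∑ p, ∑ q, if p ≠ q then f p q else 0 := by
  rw [← Finset.sum_fiberwise (s := Finset.univ) (g := fun σ : Equiv.Perm α => (σ a, σ b)),
    Fintype.sum_prod_type, Finset.mul_sum]
  refine Finset.sum_congr rfl fun p _ => ?_
  rw [Finset.mul_sum]
  refine Finset.sum_congr rfl fun q _ => ?_
  have h1 : ∀ σ ∈ Finset.univ.filter (fun σ : Equiv.Perm α => (σ a, σ b) = (p, q)),
      f (σ a) (σ b) = f p q := by
    intro σ hσ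
    have := (Finset.mem_filter.1 hσ).2
    rw [Prod.mk.injEq] at this
    rw [this.1, this.2]
  rw [Finset.sum_congr rfl h1, Finset.sum_const, nsmul_eq_mul]
  by_cases hpq : p = q
  · subst hpq
    have : Finset.univ.filter (fun σ : Equiv.Perm α => (σ a, σ b) = (p, p)) = ∅ := by
      ext σ
      simp only [Finset.mem_filter, Finset.mem_univ, true_and, Prod.mk.injEq, Finset.notMem_empty,
        iff_false, not_and]
      intro h1 h2
      exact hab (σ.injective (h1.trans h2.symm))
    rw [this]
    simp
  · rw [if_pos hpq, ← card_perm_pair hab hpq]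
    congr 3
    ext σ
    simp

end Counting

/-! ### The multiplicity of -1 for a transposition acting on β -/

section BetaNeg

open Finset
open scoped Nat

variable {d r : ℕ} {n : Fin d → ℕ} (hn : ∑ j, n j = r)
variable {W : Type*} [AddCommGroup W] [Module ℂ W] [FiniteDimensional ℂ W]
  (ρ : Representation ℂ (YoungGroup n) W)

theorem finiteDimensional_beta (hd : d ≠ 0) : FiniteDimensional ℂ
    (Representation.IndV (inertiaHom hn) (inertiaRep hn ρ)) := by
  have : NeZero d := ⟨hd⟩
  have : Finite (groupG d r) := by
    have : Finite (Wreath d r) := Finite.of_equiv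
      ((Fin r → rootsOfUnity d ℂ) × Equiv.Perm (Fin r)) SemidirectProduct.equivProd.symm
    exact Finite.of_surjective _ wreathHom_surjective
  infer_instance

/-- The multiplicity of `-1` for a transposition acting on `β`. -/
theorem two_mul_negDim_beta (hd : d ≠ 0) {i j : Fin r} (hij : i ≠ j) :
    2 * negDim (beta hn ρ) (permElt d (Equiv.swap i j)) * ∏ k, (n k)! =
      (r - 2)! * ∑ k, n k * ((r - n k) * Module.finrank ℂ W + (n k - 1) * (2 * factorNeg ρ k)) := by
  classical
  have := finiteDimensional_beta hn ρ hd
  have hcard : Fintype.card (YoungGroup n) = ∏ k, (n k)! := by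
    simp [Fintype.card_perm]
  have h1 := trace_eq_finrank_sub_negDim (beta hn ρ) (permElt_swap_mul_self (d := d) i j)
  have h2 := trace_beta hn ρ hd (Equiv.swap i j)
  have h3 := finrank_indV hn ρ hd
  have h4 : ∀ σ : Equiv.Perm (Fin r), (∑ y : YoungGroup n,
      if youngHom hn y = σ * Equiv.swap i j * σ⁻¹ then LinearMap.trace ℂ W (ρ y) else 0) =
      Module.finrank ℂ W -
        (pairWeight ρ ((blockEquiv hn).symm (σ i)) ((blockEquiv hn).symm (σ j)) : ℂ) := by
    intro σ
    rw [← Equiv.swap_apply_apply, ← sum_trace_swap hn ρ]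
    · simp
    · simpa using hij
  simp only [h4] at h2
  rw [Finset.sum_sub_distrib, Finset.sum_const, Finset.card_univ, nsmul_eq_mul,
    sum_perm_pair hij (fun p q => (pairWeight ρ ((blockEquiv hn).symm p)
      ((blockEquiv hn).symm q) : ℂ)), h1, mul_sub, h3] at h2
  -- Ordered pairs are counted by the block k of the first point: n_k points, each with r - n_k
  -- partners outside the block and n_k - 1 inside. The truncated n_k - 1 is harmless, since n_k
  -- multiplies it.
  have h5 : (∑ p : Fin r, ∑ q : Fin r, if p ≠ q then (pairWeight ρ ((blockEquiv hn).symm p)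
      ((blockEquiv hn).symm q) : ℂ) else 0) =
      ((∑ k, n k * ((r - n k) * Module.finrank ℂ W + (n k - 1) * (2 * factorNeg ρ k)) :
        ℕ) : ℂ) := by
    have h6 : (∑ p : Fin r, ∑ q : Fin r, if p ≠ q then (pairWeight ρ ((blockEquiv hn).symm p)
        ((blockEquiv hn).symm q) : ℂ) else 0) =
        ((∑ p : (Σ k, Fin (n k)), ∑ q : (Σ k, Fin (n k)),
          if p ≠ q then pairWeight ρ p q else 0 : ℕ) : ℂ) := by
      push_cast
      refine Fintype.sum_equiv (blockEquiv hn).symm _ _ fun p => ?_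
      refine Fintype.sum_equiv (blockEquiv hn).symm _ _ fun q => ?_
      simp
    rw [h6]
    congr 1
    rw [Fintype.sum_sigma]
    refine Finset.sum_congr rfl fun k _ => ?_
    have h7 : ∀ x : Fin (n k), (∑ q : (Σ k, Fin (n k)),
        if (⟨k, x⟩ : Σ k, Fin (n k)) ≠ q then pairWeight ρ ⟨k, x⟩ q else 0) =
        (r - n k) * Module.finrank ℂ W + (n k - 1) * (2 * factorNeg ρ k) := by
      intro x
      rw [Fintype.sum_sigma, ← Finset.add_sum_erase _ _ (Finset.mem_univ k), add_comm]
      congr 1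
      · have h8 : ∀ l ∈ univ.erase k, (∑ y : Fin (n l),
            if (⟨k, x⟩ : Σ k, Fin (n k)) ≠ ⟨l, y⟩ then pairWeight ρ ⟨k, x⟩ ⟨l, y⟩ else 0) =
            n l * Module.finrank ℂ W := by
          intro l hl
          have hlk : k ≠ l := (Finset.ne_of_mem_erase hl).symm
          simp [pairWeight, hlk]
        rw [Finset.sum_congr rfl h8, ← Finset.sum_mul, ← hn,
          ← Finset.add_sum_erase _ _ (Finset.mem_univ k), Nat.add_sub_cancel_left]
      · have h8 : ∀ y : Fin (n k), (if (⟨k, x⟩ : Σ k, Fin (n k)) ≠ ⟨k, y⟩ then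
            pairWeight ρ ⟨k, x⟩ ⟨k, y⟩ else 0) = if x = y then 0 else 2 * factorNeg ρ k := by
          intro y
          by_cases hxy : x = y <;> simp [pairWeight, hxy]
        simp only [h8]
        rw [← Finset.add_sum_erase _ _ (Finset.mem_univ x), if_pos rfl, zero_add,
          Finset.sum_congr rfl (fun y hy => if_neg (Finset.ne_of_mem_erase hy).symm),
          Finset.sum_const, Finset.card_erase_of_mem (Finset.mem_univ x), Finset.card_univ,
          Fintype.card_fin, smul_eq_mul]
    rw [Finset.sum_congr rfl (fun x _ => h7 x), Finset.sum_const, Finset.card_univ,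
      Fintype.card_fin, smul_eq_mul]
  rw [h5, Fintype.card_fin] at h2
  have h9 : ((2 * negDim (beta hn ρ) (permElt d (Equiv.swap i j)) * ∏ k, (n k)! : ℕ) : ℂ) =
      (((r - 2)! * ∑ k, n k * ((r - n k) * Module.finrank ℂ W +
        (n k - 1) * (2 * factorNeg ρ k)) : ℕ) : ℂ) := by
    rw [← hcard]
    push_cast at h2 ⊢
    linear_combination -h2
  exact_mod_cast h9

end BetaNeg

/-! ### Equivariant families of vectors -/

section Families

open Equiv Module

/-- The orbit map g • t ↦ ρ(g) v is well defined because the stabilizer of t fixes v. Its extension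
by zero is what makes families on tuples vanish when an index is repeated. -/
theorem exists_equivariant {G X V : Type*} [Group G] [MulAction G X] [AddCommGroup V] [Module ℂ V]
    (ρ : Representation ℂ G V) (t : X) (v : V) (h : ∀ g : G, g • t = t → ρ g v = v) :
    ∃ F : X → V, F t = v ∧ (∀ g x, ρ g (F x) = F (g • x)) ∧
      ∀ x, (∀ g : G, g • t ≠ x) → F x = 0 := by
  classical
  have key : ∀ g g' : G, g • t = g' • t → ρ g v = ρ g' v := by
    intro g g' hg
    have h1 := h (g'⁻¹ * g) (by rw [mul_smul, hg, inv_smul_smul])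
    have h2 := congrArg (ρ g') h1
    rwa [← Module.End.mul_apply, ← map_mul, mul_inv_cancel_left] at h2
  let F : X → V := fun x => if hx : ∃ g : G, g • t = x then ρ hx.choose v else 0
  have hF : ∀ g : G, F (g • t) = ρ g v := by
    intro g
    have hx : ∃ g' : G, g' • t = g • t := ⟨g, rfl⟩
    simp only [F, dif_pos hx]
    exact key _ _ hx.choose_spec
  refine ⟨F, by simpa using hF 1, fun g x => ?_, fun x hx => dif_neg fun ⟨g, hg⟩ => hx g hg⟩
  by_cases hx : ∃ g' : G, g' • t = x
  · obtain ⟨g', rfl⟩ := hx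
    rw [← mul_smul, hF, hF, map_mul, Module.End.mul_apply]
  · have h1 : ¬ ∃ g' : G, g' • t = g • x := by
      rintro ⟨g', hg'⟩
      exact hx ⟨g⁻¹ * g', by rw [mul_smul, hg', inv_smul_smul]⟩
    simp only [F, dif_neg hx, dif_neg h1, map_zero]

variable {α V : Type*} [AddCommGroup V] [Module ℂ V] {ρ : Representation ℂ (Perm α) V}

theorem exists_family_two {a b : α} (hab : a ≠ b) {v : V}
    (h : ∀ σ : Perm α, σ a = a → σ b = b → ρ σ v = v) :
    ∃ F : α → α → V, F a b = v ∧ (∀ σ i j, ρ σ (F i j) = F (σ i) (σ j)) ∧ ∀ i, F i i = 0 := by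
  obtain ⟨F, h1, h2, h3⟩ := exists_equivariant ρ (a, b) v fun g hg =>
    h g (congrArg Prod.fst hg) (congrArg Prod.snd hg)
  refine ⟨fun i j => F (i, j), h1, fun σ i j => h2 σ (i, j), fun i => h3 _ fun g hg => hab ?_⟩
  have e1 : g a = i := congrArg Prod.fst hg
  have e2 : g b = i := congrArg Prod.snd hg
  exact g.injective (e1.trans e2.symm)

theorem exists_family_three {a b c : α} (hab : a ≠ b) (hac : a ≠ c) (hbc : b ≠ c) {v : V}
    (h : ∀ σ : Perm α, σ a = a → σ b = b → σ c = c → ρ σ v = v) :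
    ∃ F : α → α → α → V, F a b c = v ∧ (∀ σ i j k, ρ σ (F i j k) = F (σ i) (σ j) (σ k)) ∧
      (∀ i k, F i i k = 0) ∧ (∀ i j, F i j i = 0) ∧ ∀ i j, F i j j = 0 := by
  obtain ⟨F, h1, h2, h3⟩ := exists_equivariant ρ (a, b, c) v fun g hg =>
    h g (congrArg Prod.fst hg) (congrArg (fun x => x.2.1) hg) (congrArg (fun x => x.2.2) hg)
  have h4 : ∀ (g : Perm α) i j k, g • (a, b, c) = (i, j, k) → g a = i ∧ g b = j ∧ g c = k :=
    fun g i j k hg =>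
      ⟨congrArg Prod.fst hg, congrArg (fun x => x.2.1) hg, congrArg (fun x => x.2.2) hg⟩
  refine ⟨fun i j k => F (i, j, k), h1, fun σ i j k => h2 σ (i, j, k),
    fun i k => h3 _ fun g hg => hab ?_, fun i k => h3 _ fun g hg => hac ?_,
    fun i k => h3 _ fun g hg => hbc ?_⟩ <;> obtain ⟨e1, e2, e3⟩ := h4 _ _ _ _ hg <;>
    apply g.injective <;> simp [e1, e2, e3]

theorem negDim_swap_eq [DecidableEq α] {a b c d : α} (hab : a ≠ b) (hcd : c ≠ d) :
    negDim ρ (swap a b) = negDim ρ (swap c d) := by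
  obtain ⟨σ, h1, h2⟩ := exists_perm_pair hab hcd
  rw [← negDim_conj ρ (swap a b) σ]
  congr 1
  rw [← Equiv.swap_apply_apply, h1, h2]

variable [Fintype α] [DecidableEq α]

/-- Transpositions of points satisfying `p` generate the group of permutations supported on those
points. -/
theorem fixed_of_swap {p : α → Prop} [DecidablePred p] {v : V}
    (h : ∀ x y, p x → p y → x ≠ y → ρ (swap x y) v = v) (σ : Perm α)
    (hσ : ∀ x, ¬ p x → σ x = x) : ρ σ v = v := by
  have h1 : ∀ x, σ x ≠ x → p x := fun x hx => by
    by_contra hp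
    exact hx (hσ x hp)
  have h2 : ∀ x, p (σ x) ↔ p x := fun x => by
    by_cases hx : σ x = x
    · rw [hx]
    · exact ⟨fun _ => h1 x hx, fun _ => h1 _ fun h => hx (σ.injective h)⟩
  have h3 : ∀ τ : Perm {x // p x}, ρ (Perm.ofSubtype τ) v = v := by
    intro τ
    induction τ using Perm.swap_induction_on with
    | one => simp
    | swap_mul f x y hxy ih =>
      rw [map_mul, map_mul, Module.End.mul_apply, ih, Perm.ofSubtype_swap_eq]
      exact h _ _ x.2 y.2 (fun h => hxy (Subtype.ext h))
  have h4 := h3 (σ.subtypePerm h2)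
  rwa [Perm.ofSubtype_subtypePerm h2 h1] at h4

theorem fixed_all_of_swap {v : V} (h : ∀ x y, x ≠ y → ρ (swap x y) v = v) (σ : Perm α) :
    ρ σ v = v :=
  fixed_of_swap (p := fun _ => True) (fun x y _ _ => h x y) σ (fun _ hx => absurd trivial hx)

theorem fixed_two_of_swap {a b : α} {v : V}
    (h : ∀ x y, x ≠ y → x ≠ a → x ≠ b → y ≠ a → y ≠ b → ρ (swap x y) v = v) (σ : Perm α)
    (ha : σ a = a) (hb : σ b = b) : ρ σ v = v :=
  fixed_of_swap (p := fun x => x ≠ a ∧ x ≠ b)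
    (fun x y hx hy hxy => h x y hxy hx.1 hx.2 hy.1 hy.2) σ (fun x hx => by
      by_cases hxa : x = a
      · rw [hxa, ha]
      · by_cases hxb : x = b
        · rw [hxb, hb]
        · exact absurd ⟨hxa, hxb⟩ hx)

/-! ### The twist by the sign character -/

/-- `ρ ⊗ ε`. -/
def twist (ρ : Representation ℂ (Perm α) V) : Representation ℂ (Perm α) V where
  toFun σ := ((Perm.sign σ : ℤ) : ℂ) • ρ σ
  map_one' := by simp
  map_mul' a b := by ext; simp [smul_smul, mul_comm]

theorem twist_apply (σ : Perm α) (v : V) :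
    twist ρ σ v = ((Perm.sign σ : ℤ) : ℂ) • ρ σ v := rfl

theorem twist_swap {a b : α} (hab : a ≠ b) (v : V) : twist ρ (swap a b) v = - ρ (swap a b) v := by
  simp [twist_apply, Perm.sign_swap hab]

theorem twist_twist : twist (twist ρ) = ρ := by
  ext σ v
  rw [twist_apply, twist_apply, smul_smul, ← Int.cast_mul, ← Units.val_mul, ← sq,
    Int.units_sq]
  simp

/-- Since ε is -1 on transpositions, tensoring with ε exchanges the two eigenspaces; bounds on
`posDim` of the twist thus become bounds on `negDim`. -/
theorem negDim_twist {a b : α} (hab : a ≠ b) :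
    negDim (twist ρ) (swap a b) = posDim ρ (swap a b) := by
  have : LinearMap.ker (twist ρ (swap a b) + 1) = LinearMap.ker (ρ (swap a b) - 1) := by
    ext v
    rw [mem_ker_add_one, mem_ker_sub_one, twist_swap hab, neg_inj]
  rw [negDim, this, posDim]

theorem posDim_twist {a b : α} (hab : a ≠ b) :
    posDim (twist ρ) (swap a b) = negDim ρ (swap a b) := by
  rw [← negDim_twist hab, twist_twist]

theorem twist_irreducible (hρ : ρ.IsIrreducible) : (twist ρ).IsIrreducible := by
  obtain ⟨v, hv⟩ := exists_ne_zero_of_irreducible hρ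
  refine isIrreducible_of_forall hv fun p hp h0 => ?_
  obtain ⟨w, hw, hw0⟩ := (Submodule.ne_bot_iff _).1 h0
  refine eq_top_of_irreducible hρ p (fun g x hx => ?_) hw hw0
  have h1 := Submodule.smul_mem p ((Perm.sign g : ℤ) : ℂ) (hp g x hx)
  have h2 : twist (twist ρ) g x = ρ g x := by rw [twist_twist]
  rwa [← twist_apply, h2] at h1

theorem posDim_swap_eq {a b c d : α} (hab : a ≠ b) (hcd : c ≠ d) :
    posDim ρ (swap a b) = posDim ρ (swap c d) := by
  rw [← negDim_twist hab, ← negDim_twist hcd, negDim_swap_eq hab hcd]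

/-! ### Families indexed by points -/

theorem sum_eq_of_eq_off (s : Finset α) {f : α → V} {E : V} (h : ∀ j ∉ s, f j = E) :
    ∑ j, f j = ∑ j ∈ s, f j + ((Fintype.card α : ℂ) - s.card) • E := by
  rw [← Finset.sum_add_sum_compl s, Finset.sum_congr rfl (fun j hj => h j (Finset.mem_compl.1 hj)),
    Finset.sum_const, Finset.card_compl, ← Nat.cast_smul_eq_nsmul ℂ,
    Nat.cast_sub (Finset.card_le_univ s)]

/-- If two vectors coincide, double transitivity makes all of them coincide, and the zero sum kills
them. -/
theorem family_one_ne {F : α → V} (hF : ∀ σ i, ρ σ (F i) = F (σ i)) (hs : ∑ i, F i = 0)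
    {a : α} (h0 : F a ≠ 0) {i j : α} (hij : i ≠ j) : F i ≠ F j := by
  intro h
  have h1 : ∀ k, F k = F a := by
    intro k
    by_cases hk : k = a
    · rw [hk]
    · obtain ⟨σ, h1, h2⟩ := exists_perm_pair hij hk
      rw [← h1, ← h2, ← hF, ← hF, h]
  rw [Finset.sum_congr rfl (fun k _ => h1 k), Finset.sum_const, ← Nat.cast_smul_eq_nsmul ℂ,
    smul_eq_zero] at hs
  rcases hs with hs | hs
  · have : Nonempty α := ⟨a⟩
    simp at hs
  · exact h0 hs

/-- Subtracting from a relation its image under (i j) leaves (x_i - x_j)(F_i - F_j) = 0. Up to a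
scalar, the zero sum is the only relation. -/
theorem family_one_const {F : α → V} (hF : ∀ σ i, ρ σ (F i) = F (σ i)) (hs : ∑ i, F i = 0)
    {a : α} (h0 : F a ≠ 0) {x : α → ℂ} (hx : ∑ i, x i • F i = 0) (i j : α) : x i = x j := by
  by_cases hij : i = j
  · rw [hij]
  have h1 : ∑ k, x k • F (swap i j k) = 0 := by
    have := congrArg (ρ (swap i j)) hx
    simpa [hF] using this
  have h2 : ∑ k, x k • (F k - F (swap i j k)) = 0 := by
    simp only [smul_sub, Finset.sum_sub_distrib, hx, h1, sub_zero]
  rw [sum_eq_of_eq_off {i, j} (E := 0), Finset.sum_pair hij, smul_zero, add_zero, swap_apply_left,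
    swap_apply_right] at h2
  · have h3 : (x i - x j) • (F i - F j) = 0 := by
      rw [← h2]; module
    rcases smul_eq_zero.1 h3 with h | h
    · exact sub_eq_zero.1 h
    · exact absurd (sub_eq_zero.1 h) (family_one_ne hF hs h0 hij)
  · intro k hk
    simp only [Finset.mem_insert, Finset.mem_singleton, not_or] at hk
    rw [swap_apply_of_ne_of_ne hk.1 hk.2, sub_self, smul_zero]

theorem family_one_card_le [FiniteDimensional ℂ V] {F : α → V} (hF : ∀ σ i, ρ σ (F i) = F (σ i))
    (hs : ∑ i, F i = 0) {a : α} (h0 : F a ≠ 0) : Fintype.card α ≤ finrank ℂ V + 1 := by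
  have h : LinearIndependent ℂ fun i : {i // i ≠ a} => F i := by
    rw [Fintype.linearIndependent_iff]
    intro g hg
    -- Extended by the coefficient 0 at a, the relation has all its coefficients equal, hence zero.
    let x : α → ℂ := fun i => if h : i ≠ a then g ⟨i, h⟩ else 0
    have hx : ∑ i, x i • F i = 0 := by
      rw [← Fintype.sum_subtype_add_sum_subtype (fun i => i ≠ a) (fun i => x i • F i), ← hg]
      have h1 : ∑ i : {i // ¬ i ≠ a}, x i • F i = 0 :=
        Finset.sum_eq_zero fun i _ => by simp [x, i.2]
      rw [h1, add_zero]
      exact Finset.sum_congr rfl fun i _ => by simp [x, i.2]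
    intro i
    have h1 := family_one_const hF hs h0 hx i a
    simpa [x, i.2] using h1
  have h2 := h.fintype_card_le_finrank
  rw [Fintype.card_subtype_compl, Fintype.card_subtype_eq] at h2
  omega

theorem trivial_of_fixed {n : ℕ} {ρ : Representation ℂ (Perm (Fin n)) V} (hρ : ρ.IsIrreducible)
    {v : V} (h0 : v ≠ 0) (h : ∀ σ, ρ σ v = v) :
    Nonempty (ρ.Equiv (Representation.trivial ℂ (Perm (Fin n)) ℂ)) := by
  have htop := span_eq_top_of_irreducible hρ {v}
    (fun g x hx => by rw [Set.mem_singleton_iff.1 hx, h]; exact Submodule.mem_span_singleton_self v)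
    (Set.mem_singleton v) h0
  refine nonempty_equiv_of_scalar hρ _ fun g x => ?_
  have hx : x ∈ Submodule.span ℂ {v} := by rw [htop]; trivial
  obtain ⟨c, rfl⟩ := Submodule.mem_span_singleton.1 hx
  simp [h]

theorem sign_of_swap {n : ℕ} {ρ : Representation ℂ (Perm (Fin n)) V} (hρ : ρ.IsIrreducible)
    {v : V} (h0 : v ≠ 0) (h : ∀ x y, x ≠ y → ρ (swap x y) v = -v) :
    Nonempty (ρ.Equiv (signRep n)) := by
  have h1 : ∀ σ, ρ σ v = ((Perm.sign σ : ℤ) : ℂ) • v := by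
    intro σ
    have h2 := fixed_all_of_swap (ρ := twist ρ) (v := v)
      (fun x y hxy => by rw [twist_swap hxy, h x y hxy, neg_neg]) σ
    rw [twist_apply] at h2
    have h3 := congrArg (fun w => ((Perm.sign σ : ℤ) : ℂ) • w) h2
    simp only [smul_smul] at h3
    rw [← Int.cast_mul, ← Units.val_mul, ← sq, Int.units_sq] at h3
    simpa using h3
  have htop := span_eq_top_of_irreducible hρ {v}
    (fun g x hx => by
      rw [Set.mem_singleton_iff.1 hx, h1]
      exact Submodule.smul_mem _ _ (Submodule.mem_span_singleton_self v))
    (Set.mem_singleton v) h0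
  refine nonempty_equiv_of_scalar hρ _ fun g x => ?_
  have hx : x ∈ Submodule.span ℂ {v} := by rw [htop]; trivial
  obtain ⟨c, rfl⟩ := Submodule.mem_span_singleton.1 hx
  rw [map_smul, h1]
  simp [signRep, smul_smul, mul_comm]

theorem sign_of_twist_trivial {n : ℕ} {ρ : Representation ℂ (Perm (Fin n)) V}
    (hρ : ρ.IsIrreducible)
    (h : Nonempty ((twist ρ).Equiv (Representation.trivial ℂ (Perm (Fin n)) ℂ))) :
    Nonempty (ρ.Equiv (signRep n)) := by
  obtain ⟨e⟩ := h
  obtain ⟨f, hf⟩ := exists_linearEquiv e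
  refine sign_of_swap hρ (v := f.symm 1) (by simp) fun x y hxy => ?_
  have h1 := twist_swap (ρ := ρ) hxy (f.symm 1)
  rw [← neg_neg (ρ (swap x y) (f.symm 1)), ← h1, neg_inj]
  apply f.injective
  rw [hf]
  simp

/-! ### The standard representation -/

theorem standardRep_apply_coe {n : ℕ} (σ : Perm (Fin n)) (v : (standardSub n).toSubmodule)
    (i : Fin n) : (standardRep n σ v : Fin n → ℂ) i = (v : Fin n → ℂ) (σ⁻¹ i) := rfl

theorem mem_standardSub {n : ℕ} {v : Fin n → ℂ} :
    v ∈ (standardSub n).toSubmodule ↔ ∑ i, v i = 0 := by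
  simp [standardSub, LinearMap.mem_ker]

/-- The vector `e_i - e_j`. -/
def stdDiff {n : ℕ} (i j : Fin n) : (standardSub n).toSubmodule :=
  ⟨Pi.single i 1 - Pi.single j 1, by rw [mem_standardSub]; simp⟩

theorem standardRep_stdDiff {n : ℕ} (σ : Perm (Fin n)) (i j : Fin n) :
    standardRep n σ (stdDiff i j) = stdDiff (σ i) (σ j) := by
  apply Subtype.ext
  funext k
  rw [standardRep_apply_coe]
  simp [stdDiff, Pi.single_apply, Equiv.symm_apply_eq]

theorem span_stdDiff {n : ℕ} (i₀ : Fin n) :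
    Submodule.span ℂ (Set.range fun i => stdDiff i i₀) = ⊤ := by
  rw [Submodule.eq_top_iff']
  intro v
  have h : v = ∑ i, (v : Fin n → ℂ) i • stdDiff i i₀ := by
    apply Subtype.ext
    funext k
    have h1 := mem_standardSub.1 v.2
    simp [stdDiff, Finset.sum_apply, mul_sub, Finset.sum_sub_distrib, Pi.single_apply, h1]
  rw [h]
  exact Submodule.sum_mem _ fun i _ => Submodule.smul_mem _ _ (Submodule.subset_span ⟨i, rfl⟩)

theorem stdDiff_ne_zero {n : ℕ} {i j : Fin n} (hij : i ≠ j) : stdDiff i j ≠ 0 := by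
  intro h
  have := congrFun (congrArg Subtype.val h) i
  simp [stdDiff, hij] at this

/-- If v_i ≠ v_j, then v - (i j) v is a nonzero multiple of e_i - e_j, whose orbit spans. -/
theorem standardRep_irreducible {n : ℕ} (hn : 2 ≤ n) : (standardRep n).IsIrreducible := by
  have h01 : (⟨0, by omega⟩ : Fin n) ≠ ⟨1, by omega⟩ := by simp
  refine isIrreducible_of_forall (stdDiff_ne_zero h01) fun p hp h0 => ?_
  obtain ⟨v, hv, hv0⟩ := (Submodule.ne_bot_iff _).1 h0
  obtain ⟨i, j, hij⟩ : ∃ i j, (v : Fin n → ℂ) i ≠ (v : Fin n → ℂ) j := by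
    by_contra! h
    apply hv0
    apply Subtype.ext
    funext k
    have h1 := mem_standardSub.1 v.2
    rw [Finset.sum_congr rfl (fun i _ => h i k)] at h1
    simp at h1
    rcases h1 with h1 | h1
    · omega
    · simpa using h1
  have hne : i ≠ j := fun h => hij (by rw [h])
  have h1 : v - standardRep n (swap i j) v =
      ((v : Fin n → ℂ) i - (v : Fin n → ℂ) j) • stdDiff i j := by
    apply Subtype.ext
    funext k
    simp only [Submodule.coe_sub, Pi.sub_apply, standardRep_apply_coe, swap_inv, stdDiff,
      Submodule.coe_smul, Pi.smul_apply, smul_eq_mul, Pi.single_apply]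
    by_cases hki : k = i
    · subst hki; simp [hne]
    · by_cases hkj : k = j
      · subst hkj; simp [hki]
      · simp [hki, hkj, swap_apply_of_ne_of_ne hki hkj]
  have h2 : stdDiff i j ∈ p := by
    have h3 : ((v : Fin n → ℂ) i - (v : Fin n → ℂ) j) • stdDiff i j ∈ p := by
      rw [← h1]; exact p.sub_mem hv (hp _ _ hv)
    exact (p.smul_mem_iff (sub_ne_zero.2 hij)).1 h3
  rw [eq_top_iff, ← span_stdDiff j, Submodule.span_le]
  rintro _ ⟨k, rfl⟩
  by_cases hk : k = j
  · subst hk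
    have : stdDiff k k = 0 := by apply Subtype.ext; simp [stdDiff]
    simp only [this]
    exact p.zero_mem
  · obtain ⟨σ, h3, h4⟩ := exists_perm_pair hne hk
    have := hp σ _ h2
    rwa [standardRep_stdDiff, h3, h4] at this

theorem finrank_standardSub {n : ℕ} (hn : n ≠ 0) :
    finrank ℂ (standardSub n).toSubmodule + 1 = n := by
  have : NeZero n := ⟨hn⟩
  have h := LinearMap.finrank_range_add_finrank_ker
    (∑ i, LinearMap.proj i : (Fin n → ℂ) →ₗ[ℂ] ℂ)
  have h2 : LinearMap.range (∑ i, LinearMap.proj i : (Fin n → ℂ) →ₗ[ℂ] ℂ) = ⊤ := by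
    rw [LinearMap.range_eq_top]
    intro c
    exact ⟨Pi.single 0 c, by simp [LinearMap.sum_apply]⟩
  rw [h2] at h
  simp only [finrank_top, finrank_self, finrank_fintype_fun_eq_card, Fintype.card_fin] at h
  rw [add_comm]
  exact h

theorem negDim_standardRep_le {n : ℕ} {a b : Fin n} (hab : a ≠ b) :
    negDim (standardRep n) (swap a b) ≤ 1 := by
  refine negDim_le_of_span (span_stdDiff a) (fun _ : Fin 1 => stdDiff b a) ?_
  rintro _ ⟨k, rfl⟩
  simp only [standardRep_stdDiff, swap_apply_left]
  have h : stdDiff k a - stdDiff (swap a b k) b =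
      (if k = a then 0 else if k = b then (2 : ℂ) else 1) • stdDiff b a := by
    apply Subtype.ext
    by_cases hka : k = a
    · simp [stdDiff, hka]
    · by_cases hkb : k = b
      · simp only [stdDiff, hkb, hab.symm, swap_apply_right, if_true, if_false,
          Submodule.coe_sub, Submodule.coe_smul]
        module
      · simp only [stdDiff, hka, hkb, swap_apply_of_ne_of_ne hka hkb, if_false,
          Submodule.coe_sub, Submodule.coe_smul]
        module
  rw [h]
  exact Submodule.smul_mem _ _ (Submodule.subset_span ⟨0, rfl⟩)

/-- The sum of the family is invariant; if it is nonzero, the representation is trivial. If it is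
zero, v ↦ ∑ v_i F_i intertwines the standard representation with V, and it does not kill e_a - e_b
by `family_one_ne`. -/
theorem trivial_or_standard {n : ℕ} (hn : 2 ≤ n) {ρ : Representation ℂ (Perm (Fin n)) V}
    (hρ : ρ.IsIrreducible) {F : Fin n → V} (hF : ∀ σ i, ρ σ (F i) = F (σ i)) {a : Fin n}
    (h0 : F a ≠ 0) : Nonempty (ρ.Equiv (Representation.trivial ℂ (Perm (Fin n)) ℂ)) ∨
      Nonempty (ρ.Equiv (standardRep n)) := by
  by_cases hs : ∑ i, F i = 0
  · right
    let f : (standardSub n).toSubmodule →ₗ[ℂ] V :=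
      (Fintype.linearCombination ℂ F).comp (standardSub n).toSubmodule.subtype
    have hf : ∀ v, f v = ∑ i, (v : Fin n → ℂ) i • F i := fun v => by
      simp [f, Fintype.linearCombination_apply]
    obtain ⟨e⟩ := nonempty_equiv_of_ne_zero (standardRep_irreducible hn) hρ f
      (fun σ v => by
        rw [hf, hf, map_sum]
        refine (Fintype.sum_equiv σ _ _ fun i => ?_).symm
        rw [map_smul, hF, standardRep_apply_coe]
        simp) (fun h => by
        obtain ⟨b, hb⟩ : ∃ b, a ≠ b := by
          have : Nontrivial (Fin n) := Fin.nontrivial_iff_two_le.2 hn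
          obtain ⟨b, hb⟩ := exists_ne a
          exact ⟨b, hb.symm⟩
        apply family_one_ne hF hs h0 hb
        have h1 := LinearMap.congr_fun h (stdDiff a b)
        rw [hf] at h1
        simpa [stdDiff, sub_smul, Finset.sum_sub_distrib, Pi.single_apply, ite_smul,
          sub_eq_zero] using h1)
    exact ⟨e.symm⟩
  · left
    refine trivial_of_fixed hρ hs fun σ => ?_
    rw [map_sum]
    exact Fintype.sum_equiv σ _ _ fun i => hF σ i

end Families

/-! ### Families indexed by pairs -/

section PairFamilies

open Equiv Module

variable {α V : Type*} [AddCommGroup V] [Module ℂ V] {ρ : Representation ℂ (Perm α) V}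

theorem exists_perm_tuple {k : ℕ} {f g : Fin k → α} (hf : Function.Injective f)
    (hg : Function.Injective g) : ∃ σ : Perm α, ∀ i, σ (f i) = g i := by
  have := Equiv.Perm.isMultiplyPretransitive α k
  obtain ⟨σ, hσ⟩ := MulAction.exists_smul_eq (Perm α) (⟨f, hf⟩ : Fin k ↪ α) ⟨g, hg⟩
  exact ⟨σ, fun i => DFunLike.congr_fun hσ i⟩

theorem exists_injective_fin [Fintype α] {k : ℕ} (h : k ≤ Fintype.card α) :
    ∃ g : Fin k → α, Function.Injective g := by
  obtain ⟨g⟩ := Function.Embedding.nonempty_of_card_le (α := Fin k) (β := α) (by simpa using h)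
  exact ⟨g, g.injective⟩

theorem injective_vec_four {a b c d : α} (hab : a ≠ b) (hac : a ≠ c) (had : a ≠ d) (hbc : b ≠ c)
    (hbd : b ≠ d) (hcd : c ≠ d) : Function.Injective ![a, b, c, d] := by
  intro i j h
  fin_cases i <;> fin_cases j <;> simp_all

theorem exists_pair_family [DecidableEq α] {e : ℂ} {a b : α} (hab : a ≠ b) {v : V}
    (h : ∀ σ : Perm α, σ a = a → σ b = b → ρ σ v = v) (he : ρ (swap a b) v = e • v) :
    ∃ F : α → α → V, F a b = v ∧ (∀ σ i j, ρ σ (F i j) = F (σ i) (σ j)) ∧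
      (∀ i j, F j i = e • F i j) ∧ ∀ i, F i i = 0 := by
  obtain ⟨F, h1, h2, h3⟩ := exists_family_two hab h
  refine ⟨F, h1, h2, fun i j => ?_, h3⟩
  by_cases hij : i = j
  · subst hij; rw [h3, smul_zero]
  · obtain ⟨σ, h4, h5⟩ := exists_perm_pair hab hij
    have h6 : F b a = e • F a b := by
      rw [h1, ← he, ← h1, h2, swap_apply_left, swap_apply_right]
    rw [← h4, ← h5, ← h2, ← h2, h6, map_smul]

variable [Fintype α]

theorem apply_row_sum {F : α → α → V} (hF : ∀ σ i j, ρ σ (F i j) = F (σ i) (σ j))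
    (σ : Perm α) (i : α) :
    ρ σ (∑ j, F i j) = ∑ j, F (σ i) j := by
  rw [map_sum]
  exact Fintype.sum_equiv σ _ _ fun j => hF σ i j

/-- An equivariant family of vectors indexed by pairs of distinct points, symmetric (`e = 1`) or
alternating (`e = -1`), whose rows have zero sum. -/
structure IsPairFamily (ρ : Representation ℂ (Perm α) V) (e : ℂ) (F : α → α → V) : Prop where
  apply : ∀ σ i j, ρ σ (F i j) = F (σ i) (σ j)
  symm : ∀ i j, F j i = e • F i j
  diag : ∀ i, F i i = 0
  sum : ∀ i, ∑ j, F i j = 0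

theorem IsPairFamily.span_eq_top {e : ℂ} {F : α → α → V} (hF : IsPairFamily ρ e F)
    (hρ : ρ.IsIrreducible) {p q : α} (h0 : F p q ≠ 0) :
    Submodule.span ℂ (Set.range fun x : α × α => F x.1 x.2) = ⊤ :=
  span_eq_top_of_irreducible hρ _ (fun σ v hv => by
    obtain ⟨x, rfl⟩ := hv
    exact Submodule.subset_span ⟨(σ x.1, σ x.2), (hF.apply σ x.1 x.2).symm⟩) ⟨(p, q), rfl⟩ h0

variable [DecidableEq α] {e : ℂ} {F : α → α → V}

/-- The row sums form a family indexed by points, so a nonzero row sum already forces the trivial or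
the standard representation. -/
theorem pair_family_cases {n : ℕ} (hn : 2 ≤ n) {ρ : Representation ℂ (Perm (Fin n)) V}
    (hρ : ρ.IsIrreducible) {a b : Fin n} (hab : a ≠ b) {v : V}
    (h : ∀ σ : Perm (Fin n), σ a = a → σ b = b → ρ σ v = v) (he : ρ (swap a b) v = e • v) :
    Nonempty (ρ.Equiv (Representation.trivial ℂ (Perm (Fin n)) ℂ)) ∨
      Nonempty (ρ.Equiv (standardRep n)) ∨ ∃ F, IsPairFamily ρ e F ∧ F a b = v := by
  obtain ⟨F, h1, h2, h3, h4⟩ := exists_pair_family hab h he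
  by_cases h5 : ∀ i, ∑ j, F i j = 0
  · exact Or.inr (Or.inr ⟨F, ⟨h2, h3, h4, h5⟩, h1⟩)
  · push Not at h5
    obtain ⟨i, hi⟩ := h5
    rcases trivial_or_standard hn hρ (F := fun i => ∑ j, F i j) (apply_row_sum h2) hi with h | h
    · exact Or.inl h
    · exact Or.inr (Or.inl h)

/-- Here v need not be an eigenvector of (a b): v + (a b) v is fixed by it, and if this sum vanishes
then v itself is negated. -/
theorem pair_family_cases' {n : ℕ} (hn : 2 ≤ n) {ρ : Representation ℂ (Perm (Fin n)) V}
    (hρ : ρ.IsIrreducible) {a b : Fin n} (hab : a ≠ b) {v : V} (h0 : v ≠ 0)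
    (h : ∀ σ : Perm (Fin n), σ a = a → σ b = b → ρ σ v = v) :
    Nonempty (ρ.Equiv (Representation.trivial ℂ (Perm (Fin n)) ℂ)) ∨
      Nonempty (ρ.Equiv (standardRep n)) ∨
      ∃ e F, (e = 1 ∨ e = -1) ∧ IsPairFamily ρ e F ∧ F a b ≠ 0 := by
  have hs : ∀ v, ρ (swap a b) (ρ (swap a b) v) = v :=
    fun v => apply_apply_of_mul_self (swap_mul_self a b) v
  have hfix : ∀ σ : Perm (Fin n), σ a = a → σ b = b →
      ρ σ (ρ (swap a b) v) = ρ (swap a b) v := by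
    intro σ ha hb
    have h1 : σ * swap a b = swap a b * σ := by
      rw [mul_swap_eq_swap_mul, ha, hb]
    rw [← Module.End.mul_apply, ← map_mul, h1, map_mul, Module.End.mul_apply, h σ ha hb]
  by_cases h1 : v + ρ (swap a b) v = 0
  · have h2 : ρ (swap a b) v = (-1 : ℂ) • v := by
      rw [neg_one_smul]; exact (neg_eq_of_add_eq_zero_right h1).symm
    rcases pair_family_cases hn hρ hab h h2 with h | h | ⟨F, hF, h3⟩
    · exact Or.inl h
    · exact Or.inr (Or.inl h)
    · exact Or.inr (Or.inr ⟨-1, F, Or.inr rfl, hF, h3 ▸ h0⟩)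
  · rcases pair_family_cases hn hρ hab (v := v + ρ (swap a b) v) (e := 1)
      (fun σ ha hb => by rw [map_add, h σ ha hb, hfix σ ha hb])
      (by rw [map_add, hs, one_smul, add_comm]) with h | h | ⟨F, hF, h3⟩
    · exact Or.inl h
    · exact Or.inr (Or.inl h)
    · exact Or.inr (Or.inr ⟨1, F, Or.inl rfl, hF, h3 ▸ h1⟩)

/-! ### Eigenspaces of a transposition on pair families -/

namespace IsPairFamily

/-- Let N be the number of points. If all rectangles vanish, F_{ad} - F_{cd} does not depend on d
outside {a, c}, and two zero row sums give (N-2)(F_{ab} - F_{cb}) + F_{ac} - F_{ca} = 0. A symmetric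
family then has constant columns off the diagonal. For an alternating one, three instances on one
triple combine to N(N-3) F_{ij} = 0. -/
theorem eq_zero_of_rect (hF : IsPairFamily ρ e F) (he : e = 1 ∨ e = -1)
    (hk : 4 ≤ Fintype.card α)
    (h : ∀ a b c d, a ≠ b → a ≠ c → a ≠ d → b ≠ c → b ≠ d → c ≠ d →
      F a b + F c d = F a d + F c b) (i j : α) : F i j = 0 := by
  have h1 : ∀ a b c, a ≠ b → a ≠ c → b ≠ c →
      ((Fintype.card α : ℂ) - 2) • (F a b - F c b) + F a c - F c a = 0 := by
    intro a b c hab hac hbc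
    have h2 : ∑ j, (F a j - F c j) = 0 := by
      rw [Finset.sum_sub_distrib, hF.sum, hF.sum, sub_zero]
    have h3 : ({a, b, c} : Finset α).card = 3 := by
      rw [Finset.card_insert_of_notMem (by simp [hab, hac]), Finset.card_pair hbc]
    rw [sum_eq_of_eq_off {a, b, c} (E := F a b - F c b), h3,
      Finset.sum_insert (by simp [hab, hac]), Finset.sum_pair hbc, hF.diag, hF.diag] at h2
    · rw [← h2]
      push_cast
      module
    · intro d hd
      simp only [Finset.mem_insert, Finset.mem_singleton, not_or] at hd
      have := h a b c d hab hac (Ne.symm hd.1) hbc (Ne.symm hd.2.1) (Ne.symm hd.2.2)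
      rw [sub_eq_sub_iff_add_eq_add, this, add_comm (F a d) (F c b), add_comm]
  have hK : (Fintype.card α : ℂ) - 2 ≠ 0 := by
    rw [sub_ne_zero]; norm_cast; omega
  have hK1 : (Fintype.card α : ℂ) - 1 ≠ 0 := by
    rw [sub_ne_zero]; norm_cast; omega
  have hK3 : (Fintype.card α : ℂ) - 3 ≠ 0 := by
    rw [sub_ne_zero]; norm_cast; omega
  have hK0 : (Fintype.card α : ℂ) ≠ 0 := by
    norm_cast; omega
  by_cases hij : i = j
  · rw [hij, hF.diag]
  rcases he with rfl | rfl
  · have h2 : ∀ c, c ≠ j → F c j = F i j := by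
      intro c hc
      by_cases hci : c = i
      · rw [hci]
      · have h3 := h1 c j i hc hci (Ne.symm hij)
        rw [hF.symm c i, one_smul, add_sub_cancel_right, smul_eq_zero] at h3
        exact sub_eq_zero.1 (h3.resolve_left hK)
    have h3 : ∑ c, F j c = 0 := hF.sum j
    rw [sum_eq_of_eq_off {j} (E := F i j) (fun c hc => by
      rw [hF.symm c j, one_smul]; exact h2 c (by simpa using hc))] at h3
    simp only [Finset.sum_singleton, hF.diag, zero_add, Finset.card_singleton, Nat.cast_one,
      smul_eq_zero] at h3
    exact h3.resolve_left hK1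
  · obtain ⟨c, hc⟩ : ∃ c, c ∉ ({i, j} : Finset α) := by
      by_contra! hc
      have h3 : (Finset.univ : Finset α) ⊆ {i, j} := fun x _ => hc x
      have h4 := (Finset.card_le_card h3).trans Finset.card_le_two
      rw [Finset.card_univ] at h4
      omega
    simp only [Finset.mem_insert, Finset.mem_singleton, not_or] at hc
    have e1 := h1 i c j (Ne.symm hc.1) hij hc.2
    have e2 := h1 c j i hc.2 hc.1 (Ne.symm hij)
    have e3 := h1 j i c (Ne.symm hij) (Ne.symm hc.2) (Ne.symm hc.1)
    simp only [hF.symm c j, hF.symm i c, hF.symm i j] at e1 e2 e3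
    have h2 : (((Fintype.card α : ℂ) - 3) * (Fintype.card α : ℂ)) • F i j = 0 := by
      linear_combination (norm := module) ((Fintype.card α : ℂ) - 3) • e1 -
        (((Fintype.card α : ℂ) - 2) / 2) • (e1 + e2 + e3)
    exact (smul_eq_zero.1 h2).resolve_left (mul_ne_zero hK3 hK0)

/-- By 4-transitivity one vanishing rectangle would make all of them vanish. Rectangles isolate
single coefficients in the independence proofs. -/
theorem rect_ne_zero (hF : IsPairFamily ρ e F) (he : e = 1 ∨ e = -1)
    (hk : 4 ≤ Fintype.card α) {p q : α} (h0 : F p q ≠ 0) {a b c d : α} (hab : a ≠ b) (hac : a ≠ c)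
    (had : a ≠ d) (hbc : b ≠ c) (hbd : b ≠ d) (hcd : c ≠ d) :
    F a b - F a d - F c b + F c d ≠ 0 := by
  intro h
  refine h0 (hF.eq_zero_of_rect he hk (fun a' b' c' d' hab' hac' had' hbc' hbd' hcd' => ?_) p q)
  obtain ⟨σ, hσ⟩ := exists_perm_tuple (injective_vec_four hab hac had hbc hbd hcd)
    (injective_vec_four hab' hac' had' hbc' hbd' hcd')
  have h1 : σ a = a' := hσ 0
  have h2 : σ b = b' := hσ 1
  have h3 : σ c = c' := hσ 2
  have h4 : σ d = d' := hσ 3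
  have h5 := congrArg (ρ σ) h
  simp only [map_add, map_sub, hF.apply, h1, h2, h3, h4, map_zero] at h5
  rw [← sub_eq_zero, ← h5]
  abel

theorem apply_swap (hF : IsPairFamily ρ e F) {k : ℕ} {g : Fin k → α} (hg : Function.Injective g)
    (p q i j : Fin k) :
    ρ (swap (g p) (g q)) (F (g i) (g j)) = F (g (swap p q i)) (g (swap p q j)) := by
  rw [hF.apply, hg.swap_apply, hg.swap_apply]

/-- Vectors F_{ij} whose indices avoid the transposed pair are fixed. Six points leave four indices,
enough for four independent such vectors. -/
theorem four_le_posDim [FiniteDimensional ℂ V] (hF : IsPairFamily ρ e F) (he : e = 1 ∨ e = -1)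
    (hk : 6 ≤ Fintype.card α) {p q : α} (h0 : F p q ≠ 0) {x y : α} (hxy : x ≠ y) :
    4 ≤ posDim ρ (swap x y) := by
  obtain ⟨g, hg⟩ := exists_injective_fin hk
  have hne : ∀ i j : Fin 6, i ≠ j → g i ≠ g j := fun i j h => hg.ne h
  rw [posDim_swap_eq hxy (hne 0 1 (by decide))]
  have key : ∀ a b c d : Fin 6, a ≠ b → a ≠ c → a ≠ d → b ≠ c → b ≠ d → c ≠ d →
      F (g a) (g b) - F (g a) (g d) - F (g c) (g b) + F (g c) (g d) ≠ 0 :=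
    fun a b c d hab hac had hbc hbd hcd => hF.rect_ne_zero he (by omega) h0 (hne _ _ hab)
      (hne _ _ hac) (hne _ _ had) (hne _ _ hbc) (hne _ _ hbd) (hne _ _ hcd)
  refine le_posDim_of_linearIndependent
    ![F (g 2) (g 3), F (g 2) (g 4), F (g 2) (g 5), F (g 3) (g 4)] ?_ ?_
  · rw [Fintype.linearIndependent_iff]
    intro x hx
    simp only [Fin.sum_univ_four, Matrix.cons_val_zero, Matrix.cons_val_one, Matrix.cons_val] at hx
    have h1 : ∀ k : Fin 6, _ := fun k => congrArg (ρ (swap (g 0) (g k))) hx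
    have h2 := congrArg (ρ (swap (g 1) (g 2))) hx
    have h3 := fun k : Fin 6 => congrArg (ρ (swap (g 0) (g k))) h2
    simp only [map_add, map_smul, map_zero, hF.apply_swap hg, swap_apply_def] at h1 h2 h3
    -- Applying (1 - (0 3))(1 - (1 2)) to the relation leaves x_0 times a rectangle. The next two
    -- coefficients use 4 and 5 in place of 3.
    have e0 : x 0 = 0 := by
      have h4 := h1 3
      have h5 := h3 3
      simp only [Fin.reduceEq, if_true, if_false] at h2 h4 h5
      refine (smul_eq_zero.1 ?_).resolve_right
        (key 2 3 1 0 (by decide) (by decide) (by decide) (by decide) (by decide) (by decide))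
      linear_combination (norm := module) hx - h2 - h4 + h5
    have e1 : x 1 = 0 := by
      have h4 := h1 4
      have h5 := h3 4
      simp only [Fin.reduceEq, if_true, if_false] at h2 h4 h5
      refine (smul_eq_zero.1 ?_).resolve_right
        (key 2 4 1 0 (by decide) (by decide) (by decide) (by decide) (by decide) (by decide))
      linear_combination (norm := module) hx - h2 - h4 + h5
    have e2 : x 2 = 0 := by
      have h4 := h1 5
      have h5 := h3 5
      simp only [Fin.reduceEq, if_true, if_false] at h2 h4 h5
      refine (smul_eq_zero.1 ?_).resolve_right
        (key 2 5 1 0 (by decide) (by decide) (by decide) (by decide) (by decide) (by decide))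
      linear_combination (norm := module) hx - h2 - h4 + h5
    have e3 : x 3 = 0 := by
      rw [e0, e1, e2, zero_smul, zero_smul, zero_smul, zero_add, zero_add, zero_add] at hx
      refine (smul_eq_zero.1 hx).resolve_right fun h => h0 ?_
      by_cases hpq : p = q
      · rw [hpq, hF.diag]
      · obtain ⟨σ, h6, h7⟩ := exists_perm_pair (hne 3 4 (by decide)) hpq
        rw [← h6, ← h7, ← hF.apply, h, map_zero]
    intro i
    fin_cases i <;> assumption
  · intro i
    fin_cases i <;> simp [hF.apply_swap hg, swap_apply_def]

/-- The vector `F a j - F b j`, which is negated by the transposition of `a` and `b`. -/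
theorem apply_swap_sub (hF : IsPairFamily ρ e F) {a b j : α} (ha : j ≠ a) (hb : j ≠ b) :
    ρ (swap a b) (F a j - F b j) = -(F a j - F b j) := by
  rw [map_sub, hF.apply, hF.apply, swap_apply_left, swap_apply_right, swap_apply_of_ne_of_ne ha hb,
    neg_sub]

theorem two_le_negDim [FiniteDimensional ℂ V] (hF : IsPairFamily ρ (-1) F)
    (hk : 4 ≤ Fintype.card α) {p q : α} (h0 : F p q ≠ 0) {x y : α} (hxy : x ≠ y) :
    2 ≤ negDim ρ (swap x y) := by
  obtain ⟨g, hg⟩ := exists_injective_fin hk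
  have hne : ∀ i j : Fin 4, i ≠ j → g i ≠ g j := fun i j h => hg.ne h
  rw [negDim_swap_eq hxy (hne 0 1 (by decide))]
  have key : F (g 0) (g 2) - F (g 0) (g 3) - F (g 1) (g 2) + F (g 1) (g 3) ≠ 0 :=
    hF.rect_ne_zero (Or.inr rfl) hk h0 (hne _ _ (by decide)) (hne _ _ (by decide))
      (hne _ _ (by decide)) (hne _ _ (by decide)) (hne _ _ (by decide)) (hne _ _ (by decide))
  refine le_negDim_of_linearIndependent ![F (g 0) (g 1), F (g 0) (g 2) - F (g 1) (g 2)] ?_ ?_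
  · rw [Fintype.linearIndependent_iff]
    intro x hx
    simp only [Fin.sum_univ_two, Matrix.cons_val_zero, Matrix.cons_val_one] at hx
    have h1 := congrArg (ρ (swap (g 2) (g 3))) hx
    simp only [map_add, map_sub, map_smul, map_zero, hF.apply_swap hg, swap_apply_def,
      Fin.reduceEq, if_true, if_false] at h1
    -- The operator 1 - (2 3) kills F_{01} and turns F_{02} - F_{12} into a rectangle.
    have e1 : x 1 = 0 := by
      refine (smul_eq_zero.1 ?_).resolve_right key
      linear_combination (norm := module) hx - h1
    have e0 : x 0 = 0 := by
      rw [e1, zero_smul, add_zero] at hx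
      refine (smul_eq_zero.1 hx).resolve_right fun h => h0 ?_
      by_cases hpq : p = q
      · rw [hpq, hF.diag]
      · obtain ⟨σ, h6, h7⟩ := exists_perm_pair (hne 0 1 (by decide)) hpq
        rw [← h6, ← h7, ← hF.apply, h, map_zero]
    intro i
    fin_cases i <;> assumption
  · intro i
    fin_cases i
    · simp only [Fin.zero_eta, Matrix.cons_val_zero, hF.apply, swap_apply_left, swap_apply_right]
      rw [hF.symm, neg_one_smul]
    · exact hF.apply_swap_sub (hne _ _ (by decide)) (hne _ _ (by decide))

/-- The vectors are F_{01} and F_{0j} - F_{1j} for j = 2, 3, 4. The index 5 is kept spare: 1 - (5 j)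
kills every term of a relation but the one with index j, which becomes a rectangle. -/
theorem four_le_negDim [FiniteDimensional ℂ V] (hF : IsPairFamily ρ (-1) F)
    (hk : 6 ≤ Fintype.card α) {p q : α} (h0 : F p q ≠ 0) {x y : α} (hxy : x ≠ y) :
    4 ≤ negDim ρ (swap x y) := by
  obtain ⟨g, hg⟩ := exists_injective_fin hk
  have hne : ∀ i j : Fin 6, i ≠ j → g i ≠ g j := fun i j h => hg.ne h
  rw [negDim_swap_eq hxy (hne 0 1 (by decide))]
  have key : ∀ a b c d : Fin 6, a ≠ b → a ≠ c → a ≠ d → b ≠ c → b ≠ d → c ≠ d →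
      F (g a) (g b) - F (g a) (g d) - F (g c) (g b) + F (g c) (g d) ≠ 0 :=
    fun a b c d hab hac had hbc hbd hcd => hF.rect_ne_zero (Or.inr rfl) (by omega) h0 (hne _ _ hab)
      (hne _ _ hac) (hne _ _ had) (hne _ _ hbc) (hne _ _ hbd) (hne _ _ hcd)
  refine le_negDim_of_linearIndependent ![F (g 0) (g 1), F (g 0) (g 2) - F (g 1) (g 2),
    F (g 0) (g 3) - F (g 1) (g 3), F (g 0) (g 4) - F (g 1) (g 4)] ?_ ?_
  · rw [Fintype.linearIndependent_iff]
    intro x hx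
    simp only [Fin.sum_univ_four, Matrix.cons_val_zero, Matrix.cons_val_one, Matrix.cons_val] at hx
    have h1 : ∀ k : Fin 6, _ := fun k => congrArg (ρ (swap (g 5) (g k))) hx
    simp only [map_add, map_sub, map_smul, map_zero, hF.apply_swap hg, swap_apply_def] at h1
    have e1 : x 1 = 0 := by
      have h2 := h1 2
      simp only [Fin.reduceEq, if_true, if_false] at h2
      refine (smul_eq_zero.1 ?_).resolve_right
        (key 0 2 1 5 (by decide) (by decide) (by decide) (by decide) (by decide) (by decide))
      linear_combination (norm := module) hx - h2
    have e2 : x 2 = 0 := by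
      have h2 := h1 3
      simp only [Fin.reduceEq, if_true, if_false] at h2
      refine (smul_eq_zero.1 ?_).resolve_right
        (key 0 3 1 5 (by decide) (by decide) (by decide) (by decide) (by decide) (by decide))
      linear_combination (norm := module) hx - h2
    have e3 : x 3 = 0 := by
      have h2 := h1 4
      simp only [Fin.reduceEq, if_true, if_false] at h2
      refine (smul_eq_zero.1 ?_).resolve_right
        (key 0 4 1 5 (by decide) (by decide) (by decide) (by decide) (by decide) (by decide))
      linear_combination (norm := module) hx - h2
    have e0 : x 0 = 0 := by
      rw [e1, e2, e3, zero_smul, zero_smul, zero_smul, add_zero, add_zero, add_zero] at hx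
      refine (smul_eq_zero.1 hx).resolve_right fun h => h0 ?_
      by_cases hpq : p = q
      · rw [hpq, hF.diag]
      · obtain ⟨σ, h6, h7⟩ := exists_perm_pair (hne 0 1 (by decide)) hpq
        rw [← h6, ← h7, ← hF.apply, h, map_zero]
    intro i
    fin_cases i <;> assumption
  · intro i
    fin_cases i
    · simp only [Fin.zero_eta, Matrix.cons_val_zero, hF.apply, swap_apply_left, swap_apply_right]
      rw [hF.symm, neg_one_smul]
    all_goals exact hF.apply_swap_sub (hne _ _ (by decide)) (hne _ _ (by decide))

/-- The vectors `F a j - F b j`, `j ∉ {a, b}`, span the image of `1 - ρ (swap a b)`. -/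
theorem sub_apply_swap_mem (hF : IsPairFamily ρ e F) (he : e = 1 ∨ e = -1) {a b : α} (hab : a ≠ b)
    (U : Submodule ℂ V) (hU : ∀ j, j ≠ a → j ≠ b → F a j - F b j ∈ U) (i j : α) :
    F i j - ρ (swap a b) (F i j) ∈ U := by
  have h1 : F a b - F b a ∈ U := by
    rcases he with rfl | rfl
    · rw [hF.symm a b, one_smul, sub_self]; exact U.zero_mem
    · have h2 : ∑ k, (F a k - F b k) = 0 := by
        rw [Finset.sum_sub_distrib, hF.sum, hF.sum, sub_zero]
      rw [← Finset.sum_add_sum_compl {a, b}, Finset.sum_pair hab, hF.diag, hF.diag] at h2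
      have h3 : ∑ k ∈ ({a, b} : Finset α)ᶜ, (F a k - F b k) ∈ U := by
        refine U.sum_mem fun k hk => ?_
        simp only [Finset.mem_compl, Finset.mem_insert, Finset.mem_singleton, not_or] at hk
        exact hU k hk.1 hk.2
      have h4 : F a b - F b a = -∑ k ∈ ({a, b} : Finset α)ᶜ, (F a k - F b k) := by
        linear_combination (norm := module) h2
      rw [h4]
      exact U.neg_mem h3
  have h2 : ∀ j, j ≠ a → j ≠ b → F j a - F j b ∈ U := fun j ha hb => by
    rw [hF.symm a j, hF.symm b j, ← smul_sub]
    exact U.smul_mem _ (hU j ha hb)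
  rw [hF.apply]
  by_cases hia : i = a
  · subst hia
    by_cases hja : j = i
    · subst hja; simp [hF.diag]
    · by_cases hjb : j = b
      · subst hjb; simpa using h1
      · rw [swap_apply_left, swap_apply_of_ne_of_ne hja hjb]; exact hU j hja hjb
  by_cases hib : i = b
  · subst hib
    by_cases hja : j = a
    · subst hja
      rw [swap_apply_left, swap_apply_right, ← neg_sub]
      exact U.neg_mem h1
    · by_cases hjb : j = i
      · subst hjb; simp [hF.diag]
      · rw [swap_apply_right, swap_apply_of_ne_of_ne hja hjb, ← neg_sub]
        exact U.neg_mem (hU j hja hjb)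
  rw [swap_apply_of_ne_of_ne hia hib]
  by_cases hja : j = a
  · subst hja; rw [swap_apply_left]; exact h2 i hia hib
  by_cases hjb : j = b
  · subst hjb; rw [swap_apply_right, ← neg_sub]; exact U.neg_mem (h2 i hia hib)
  rw [swap_apply_of_ne_of_ne hja hjb, sub_self]
  exact U.zero_mem

theorem negDim_le (hF : IsPairFamily ρ e F) (he : e = 1 ∨ e = -1) (hρ : ρ.IsIrreducible)
    {p q : α} (h0 : F p q ≠ 0) {a b : α} (hab : a ≠ b) :
    negDim ρ (swap a b) + 2 ≤ Fintype.card α := by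
  have h1 := negDim_le_of_span (hF.span_eq_top hρ h0) (g := swap a b)
    (fun j : {j // j ∈ ({a, b} : Finset α)ᶜ} => F a j - F b j) (by
      rintro _ ⟨⟨i, j⟩, rfl⟩
      refine hF.sub_apply_swap_mem he hab _ (fun j ha hb => ?_) i j
      exact Submodule.subset_span ⟨⟨j, by simp [ha, hb]⟩, rfl⟩)
  rw [Fintype.card_coe, Finset.card_compl, Finset.card_pair hab] at h1
  have h2 : ({a, b} : Finset α).card ≤ Fintype.card α := Finset.card_le_univ _
  rw [Finset.card_pair hab] at h2
  omega

/-- In the difference of the rows a and b of a symmetric family, F_{ab} and F_{ba} cancel. So the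
vectors F_{aj} - F_{bj}, j ∉ {a, b}, have zero sum and the one at c is superfluous; this improves
`negDim_le` by one. -/
theorem negDim_le_of_symm (hF : IsPairFamily ρ 1 F) (hρ : ρ.IsIrreducible)
    {p q : α} (h0 : F p q ≠ 0) {a b : α} (hab : a ≠ b) (hk : 3 ≤ Fintype.card α) :
    negDim ρ (swap a b) + 3 ≤ Fintype.card α := by
  obtain ⟨c, hc⟩ : ∃ c, c ∉ ({a, b} : Finset α) := by
    by_contra! hc
    have h3 : (Finset.univ : Finset α) ⊆ {a, b} := fun x _ => hc x
    have h4 := (Finset.card_le_card h3).trans Finset.card_le_two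
    rw [Finset.card_univ] at h4
    omega
  have hcard : ({c, a, b} : Finset α).card = 3 := by
    rw [Finset.card_insert_of_notMem hc, Finset.card_pair hab]
  have h1 := negDim_le_of_span (hF.span_eq_top hρ h0) (g := swap a b)
    (fun j : {j // j ∈ ({c, a, b} : Finset α)ᶜ} => F a j - F b j) (by
      rintro _ ⟨⟨i, j⟩, rfl⟩
      refine hF.sub_apply_swap_mem (Or.inl rfl) hab _ (fun j ha hb => ?_) i j
      by_cases hj : j = c
      · subst hj
        have h2 : ∑ k, (F a k - F b k) = 0 := by
          rw [Finset.sum_sub_distrib, hF.sum, hF.sum, sub_zero]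
        rw [← Finset.sum_add_sum_compl {j, a, b}, Finset.sum_insert hc, Finset.sum_pair hab,
          hF.diag, hF.diag, hF.symm a b, one_smul] at h2
        have h4 : F a j - F b j = -∑ k ∈ ({j, a, b} : Finset α)ᶜ, (F a k - F b k) := by
          linear_combination (norm := module) h2
        rw [h4]
        exact Submodule.neg_mem _ (Submodule.sum_mem _ fun k hk =>
          Submodule.subset_span ⟨⟨k, hk⟩, rfl⟩)
      · exact Submodule.subset_span ⟨⟨j, by simp [ha, hb, hj]⟩, rfl⟩)
  rw [Fintype.card_coe, Finset.card_compl, hcard] at h1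
  have h2 : ({c, a, b} : Finset α).card ≤ Fintype.card α := Finset.card_le_univ _
  rw [hcard] at h2
  omega

/-- The zero sums express F_{aj} + F_{bj}, and then F_{ab} + F_{ba}, through vectors whose indices
avoid a and b. So those vectors span the image of 1 + (a b). -/
theorem add_apply_swap_mem (hF : IsPairFamily ρ e F) {a b : α} (hab : a ≠ b)
    (U : Submodule ℂ V) (hU : ∀ i j, i ≠ a → i ≠ b → j ≠ a → j ≠ b → F i j ∈ U) (i j : α) :
    F i j + ρ (swap a b) (F i j) ∈ U := by
  have h1 : ∀ j, j ≠ a → j ≠ b → F a j + F b j ∈ U := by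
    intro j ha hb
    have h2 : ∑ k, F k j = 0 := by
      rw [Finset.sum_congr rfl (fun k _ => hF.symm j k), ← Finset.smul_sum, hF.sum, smul_zero]
    rw [← Finset.sum_add_sum_compl {a, b}, Finset.sum_pair hab] at h2
    rw [eq_neg_of_add_eq_zero_left h2]
    refine U.neg_mem (U.sum_mem fun k hk => ?_)
    simp only [Finset.mem_compl, Finset.mem_insert, Finset.mem_singleton, not_or] at hk
    exact hU k j hk.1 hk.2 ha hb
  have h2 : ∀ j, j ≠ a → j ≠ b → F j a + F j b ∈ U := fun j ha hb => by
    rw [hF.symm a j, hF.symm b j, ← smul_add]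
    exact U.smul_mem _ (h1 j ha hb)
  have h3 : F a b + F b a ∈ U := by
    have h2 : ∑ k, (F a k + F b k) = 0 := by
      rw [Finset.sum_add_distrib, hF.sum, hF.sum, add_zero]
    rw [← Finset.sum_add_sum_compl {a, b}, Finset.sum_pair hab, hF.diag, hF.diag, zero_add,
      add_zero, add_comm (F b a)] at h2
    rw [eq_neg_of_add_eq_zero_left h2]
    refine U.neg_mem (U.sum_mem fun k hk => ?_)
    simp only [Finset.mem_compl, Finset.mem_insert, Finset.mem_singleton, not_or] at hk
    exact h1 k hk.1 hk.2
  rw [hF.apply]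
  by_cases hia : i = a
  · subst hia
    by_cases hja : j = i
    · subst hja; simp [hF.diag]
    · by_cases hjb : j = b
      · subst hjb; simpa using h3
      · rw [swap_apply_left, swap_apply_of_ne_of_ne hja hjb]; exact h1 j hja hjb
  by_cases hib : i = b
  · subst hib
    by_cases hja : j = a
    · subst hja
      rw [swap_apply_left, swap_apply_right, add_comm]
      exact h3
    · by_cases hjb : j = i
      · subst hjb; simp [hF.diag]
      · rw [swap_apply_right, swap_apply_of_ne_of_ne hja hjb, add_comm]
        exact h1 j hja hjb
  rw [swap_apply_of_ne_of_ne hia hib]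
  by_cases hja : j = a
  · subst hja; rw [swap_apply_left]; exact h2 i hia hib
  by_cases hjb : j = b
  · subst hjb; rw [swap_apply_right, add_comm]; exact h2 i hia hib
  rw [swap_apply_of_ne_of_ne hja hjb]
  exact U.add_mem (hU i j hia hib hja hjb) (hU i j hia hib hja hjb)

theorem posDim_le_three {ρ : Representation ℂ (Perm (Fin 5)) V} {F : Fin 5 → Fin 5 → V}
    (hF : IsPairFamily ρ e F) (hρ : ρ.IsIrreducible) {p q : Fin 5} (h0 : F p q ≠ 0)
    {a b : Fin 5} (hab : a ≠ b) : posDim ρ (swap a b) ≤ 3 := by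
  rw [posDim_swap_eq hab (show (0 : Fin 5) ≠ 1 by decide)]
  have h1 := posDim_le_of_span (ρ := ρ) (hF.span_eq_top hρ h0) (g := swap 0 1)
    ![F 2 3, F 2 4, F 3 4] (by
      rintro _ ⟨⟨i, j⟩, rfl⟩
      refine hF.add_apply_swap_mem (show (0 : Fin 5) ≠ 1 by decide) _
        (fun i j hi hi' hj hj' => ?_) i j
      have h2 : ∀ k : Fin 3, ![F 2 3, F 2 4, F 3 4] k ∈
          Submodule.span ℂ (Set.range ![F 2 3, F 2 4, F 3 4]) :=
        fun k => Submodule.subset_span ⟨k, rfl⟩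
      have h3 : ∀ k : Fin 5, k ≠ 0 → k ≠ 1 → k = 2 ∨ k = 3 ∨ k = 4 := by decide
      rcases h3 i hi hi' with rfl | rfl | rfl <;> rcases h3 j hj hj' with rfl | rfl | rfl
      · rw [hF.diag]; exact Submodule.zero_mem _
      · exact h2 0
      · exact h2 1
      · rw [hF.symm 2 3]; exact Submodule.smul_mem _ _ (h2 0)
      · rw [hF.diag]; exact Submodule.zero_mem _
      · exact h2 2
      · rw [hF.symm 2 4]; exact Submodule.smul_mem _ _ (h2 1)
      · rw [hF.symm 3 4]; exact Submodule.smul_mem _ _ (h2 2)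
      · rw [hF.diag]; exact Submodule.zero_mem _)
  simpa using h1

end IsPairFamily

end PairFamilies

/-! ### Specht modules -/

section Specht

open Equiv Module

/-- A permutation preserving the fibres of f is a product of transpositions inside fibres:
multiplying σ by (x σx) shrinks the support and stays within the fibres. -/
theorem fixed_of_fiber_swap {α V X : Type*} [Fintype α] [DecidableEq α] [AddCommGroup V]
    [Module ℂ V] {ρ : Representation ℂ (Perm α) V} {f : α → X} {v : V}
    (h : ∀ x y, x ≠ y → f x = f y → ρ (swap x y) v = v) (σ : Perm α) (hσ : ∀ x, f (σ x) = f x) :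
    ρ σ v = v := by
  induction hn : σ.support.card using Nat.strong_induction_on generalizing σ with
  | _ n ih =>
    by_cases h1 : σ = 1
    · rw [h1]; simp
    · obtain ⟨x, hx⟩ : ∃ x, σ x ≠ x := by
        by_contra! h2
        exact h1 (Perm.ext h2)
      have h2 := Perm.card_support_swap_mul (f := σ) (x := x) hx
      have h3 := ih _ (hn ▸ h2) (swap x (σ x) * σ) (fun y => by
        rw [Perm.mul_apply]
        by_cases hy : σ y = x
        · rw [hy, swap_apply_left, hσ, ← hy, hσ]
        · by_cases hy2 : σ y = σ x
          · rw [hy2, swap_apply_right, σ.injective hy2]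
          · rw [swap_apply_of_ne_of_ne hy hy2, hσ]) rfl
      have h4 := h x (σ x) (Ne.symm hx) (hσ x).symm
      rw [map_mul, Module.End.mul_apply] at h3
      rw [← apply_apply_of_mul_self (ρ := ρ) (swap_mul_self x (σ x)) (ρ σ v), h3, h4]

theorem apply_swap_of_eq {α X : Type*} [DecidableEq α] {f : α → X} {x y : α} (h : f x = f y)
    (i : α) : f (swap x y i) = f i := by
  by_cases hx : i = x
  · rw [hx, swap_apply_left, h]
  · by_cases hy : i = y
    · rw [hy, swap_apply_right, h]
    · rw [swap_apply_of_ne_of_ne hx hy]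

theorem apply_inv_of_forall {α X : Type*} {f : α → X} {σ : Perm α} (h : ∀ i, f (σ i) = f i)
    (i : α) : f (σ⁻¹ i) = f i := by
  simpa using (h (σ⁻¹ i)).symm

variable {m : ℕ} {μ : YoungDiagram} (t : Tableau m μ)

/-- The row of `i` in `t`. -/
def rowOf (i : Fin m) : ℕ := (t i).1.1

/-- The column of `i` in `t`. -/
def colOf (i : Fin m) : ℕ := (t i).1.2

theorem eq_of_rowOf_colOf {i j : Fin m} (h1 : rowOf t i = rowOf t j) (h2 : colOf t i = colOf t j) :
    i = j := t.injective (Subtype.ext (Prod.ext h1 h2))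

/-- The permutations that preserve the columns of `t`. -/
abbrev ColGroup : Type := {q : Perm (Fin m) // ∀ i, (t (q i)).1.2 = (t i).1.2}

variable {V : Type*} [AddCommGroup V] [Module ℂ V] (ρ : Representation ℂ (Perm (Fin m)) V)

/-- The column antisymmetrizer of `t`. -/
def colAnti : V →ₗ[ℂ] V := ∑ q : ColGroup t, ((Perm.sign q.1 : ℤ) : ℂ) • ρ q.1

theorem colAnti_apply (v : V) :
    colAnti t ρ v = ∑ q : ColGroup t, ((Perm.sign q.1 : ℤ) : ℂ) • ρ q.1 v := by
  simp [colAnti]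

theorem polytabloid_eq : polytabloid t = colAnti t (tabloidRep m) (Finsupp.single (rowOf t) 1) := by
  rw [colAnti_apply]; rfl

theorem sign_mul_sign (σ : Perm (Fin m)) :
    ((Perm.sign σ : ℤ) : ℂ) * ((Perm.sign σ : ℤ) : ℂ) = 1 := by
  rw [← Int.cast_mul, ← Units.val_mul, ← sq, Int.units_sq]; simp

theorem colAnti_col (q : Perm (Fin m)) (hq : ∀ i, colOf t (q i) = colOf t i) (v : V) :
    colAnti t ρ (ρ q v) = ((Perm.sign q : ℤ) : ℂ) • colAnti t ρ v := by
  rw [colAnti_apply, colAnti_apply, Finset.smul_sum]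
  have hq' := apply_inv_of_forall hq
  let e : ColGroup t ≃ ColGroup t :=
    { toFun := fun p => ⟨p.1 * q, fun i => (p.2 (q i)).trans (hq i)⟩
      invFun := fun p => ⟨p.1 * q⁻¹, fun i => (p.2 (q⁻¹ i)).trans (hq' i)⟩
      left_inv := fun p => Subtype.ext (by simp)
      right_inv := fun p => Subtype.ext (by simp) }
  refine Fintype.sum_equiv e _ _ fun p => ?_
  change _ = ((Perm.sign q : ℤ) : ℂ) • ((Perm.sign (p.1 * q) : ℤ) : ℂ) • ρ (p.1 * q) v
  rw [smul_smul, map_mul, map_mul, Module.End.mul_apply, Units.val_mul, Int.cast_mul,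
    mul_left_comm, sign_mul_sign, mul_one]

theorem colAnti_swap {x y : Fin m} (hxy : x ≠ y) (h : colOf t x = colOf t y) (v : V) :
    colAnti t ρ (ρ (swap x y) v) = -colAnti t ρ v := by
  rw [colAnti_col t ρ (swap x y) (apply_swap_of_eq h), Perm.sign_swap hxy]
  simp

theorem swap_colAnti {x y : Fin m} (hxy : x ≠ y) (h : colOf t x = colOf t y) (v : V) :
    ρ (swap x y) (colAnti t ρ v) = -colAnti t ρ v := by
  rw [colAnti_apply, map_sum, ← Finset.sum_neg_distrib]
  have hq := apply_swap_of_eq h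
  let e : ColGroup t ≃ ColGroup t :=
    { toFun := fun p => ⟨swap x y * p.1, fun i => (hq (p.1 i)).trans (p.2 i)⟩
      invFun := fun p => ⟨swap x y * p.1, fun i => (hq (p.1 i)).trans (p.2 i)⟩
      left_inv := fun p => Subtype.ext (by simp [← mul_assoc])
      right_inv := fun p => Subtype.ext (by simp [← mul_assoc]) }
  refine Fintype.sum_equiv e _ _ fun p => ?_
  change _ = -(((Perm.sign (swap x y * p.1) : ℤ) : ℂ) • ρ (swap x y * p.1) v)
  rw [map_smul, map_mul, map_mul, Perm.sign_swap hxy, Module.End.mul_apply]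
  simp

variable {ρ} in
theorem colAnti_of_anti {v : V}
    (h : ∀ x y, x ≠ y → colOf t x = colOf t y → ρ (swap x y) v = -v) :
    colAnti t ρ v = (Fintype.card (ColGroup t) : ℂ) • v := by
  have h1 : ∀ q : ColGroup t, ((Perm.sign q.1 : ℤ) : ℂ) • ρ q.1 v = v := by
    intro q
    exact fixed_of_fiber_swap (ρ := twist ρ) (f := colOf t)
      (fun x y hxy hc => by rw [twist_swap hxy, h x y hxy hc, neg_neg]) q.1 q.2
  rw [colAnti_apply, Finset.sum_congr rfl (fun q _ => h1 q), Finset.sum_const, Finset.card_univ,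
    Nat.cast_smul_eq_nsmul]

theorem tabloidRep_single (σ : Perm (Fin m)) (f : Fin m → ℕ) (c : ℂ) :
    tabloidRep m σ (Finsupp.single f c) = Finsupp.single (f ∘ (σ⁻¹ : Perm (Fin m))) c := by
  simp [tabloidRep]

theorem tabloidRep_apply (σ : Perm (Fin m)) (x : (Fin m → ℕ) →₀ ℂ) (f : Fin m → ℕ) :
    tabloidRep m σ x f = x (f ∘ σ) := by
  have h : Function.Injective fun g : Fin m → ℕ => g ∘ (σ⁻¹ : Perm (Fin m)) :=
    (σ⁻¹ : Perm (Fin m)).surjective.injective_comp_right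
  have h2 := Finsupp.mapDomain_apply h x (f ∘ σ)
  rw [← h2]
  change Finsupp.mapDomain _ x f = _
  congr 1
  funext i
  simp

/-- A tabloid of the same shape which is injective on the columns of `t` is obtained from `t` by
a permutation that preserves the columns. -/
theorem exists_col_perm (σ : Perm (Fin m))
    (hf : ∀ x y, colOf t x = colOf t y → rowOf t (σ x) = rowOf t (σ y) → x = y) :
    ∃ q : Perm (Fin m), (∀ i, colOf t (q i) = colOf t i) ∧ ∀ i, rowOf t (q i) = rowOf t (σ i) := by
  classical
  have hlt : ∀ x, rowOf t x < μ.colLen (colOf t x) := fun x =>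
    YoungDiagram.mem_iff_lt_colLen.1 (t x).2
  have hcard : ∀ k, ∑ c ∈ Finset.univ.image (colOf t),
      (Finset.univ.filter fun x => rowOf t (σ x) < k ∧ colOf t x = c).card =
      ∑ c ∈ Finset.univ.image (colOf t),
      (Finset.univ.filter fun x => rowOf t x < k ∧ colOf t x = c).card := by
    intro k
    simp only [← Finset.filter_filter]
    rw [← Finset.card_eq_sum_card_fiberwise (fun x _ => by simp),
      ← Finset.card_eq_sum_card_fiberwise (fun x _ => by simp)]
    refine Finset.card_bij (fun x _ => σ x) (fun x hx => by simpa using hx)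
      (fun x _ y _ h => σ.injective h) (fun y hy => ⟨σ⁻¹ y, by simpa using hy, by simp⟩)
  -- In a column the new rows are distinct, so at most k of them are < k; up to the column length, t
  -- itself attains k. As the totals agree by `hcard`, equality will hold in every column.
  have hle : ∀ k c, (Finset.univ.filter fun x => rowOf t (σ x) < k ∧ colOf t x = c).card ≤
      (Finset.univ.filter fun x => rowOf t x < k ∧ colOf t x = c).card := by
    intro k c
    by_cases hk : k ≤ μ.colLen c
    · have h1 : (Finset.univ.filter fun x => rowOf t (σ x) < k ∧ colOf t x = c).card ≤
          (Finset.range k).card :=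
        Finset.card_le_card_of_injOn (fun x => rowOf t (σ x)) (fun x hx => by
          simp at hx ⊢; exact hx.1) (fun x hx y hy h => by
          simp at hx hy; exact hf x y (hx.2.trans hy.2.symm) h)
      have h2 : (Finset.range k).card ≤
          (Finset.univ.filter fun x => rowOf t x < k ∧ colOf t x = c).card := by
        have hmem : ∀ i : {i // i ∈ Finset.range k}, ((i : ℕ), c) ∈ μ.cells := fun i =>
          YoungDiagram.mem_iff_lt_colLen.2 (lt_of_lt_of_le (Finset.mem_range.1 i.2) hk)
        rw [← Finset.card_attach]
        refine Finset.card_le_card_of_injOn (fun i => t.symm ⟨((i : ℕ), c), hmem i⟩)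
          (fun i _ => ?_) (fun i _ j _ h => ?_)
        · have := Finset.mem_range.1 i.2
          exact Finset.mem_coe.2 (Finset.mem_filter.2 ⟨Finset.mem_univ _,
            by simpa [rowOf] using this,
            by simp [colOf]⟩)
        · have := congrArg Subtype.val (t.symm.injective h)
          exact Subtype.ext (congrArg Prod.fst this)
      exact h1.trans h2
    · refine Finset.card_le_card fun x hx => ?_
      simp only [Finset.mem_filter, Finset.mem_univ, true_and] at hx ⊢
      refine ⟨?_, hx.2⟩
      have := hlt x
      rw [hx.2] at this
      omega
  -- Equality with k the length of the column says that every new row in that column is a row of the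
  -- diagram.
  have hmem : ∀ x, (rowOf t (σ x), colOf t x) ∈ μ.cells := by
    intro x
    have h1 := (Finset.sum_eq_sum_iff_of_le (fun c _ => hle (μ.colLen (colOf t x)) c)).1
      (hcard (μ.colLen (colOf t x))) (colOf t x) (by simp)
    have h2 : (Finset.univ.filter fun y => rowOf t y < μ.colLen (colOf t x) ∧
        colOf t y = colOf t x) = Finset.univ.filter fun y => colOf t y = colOf t x := by
      ext y
      simp only [Finset.mem_filter, Finset.mem_univ, true_and, and_iff_right_iff_imp]
      intro hy
      rw [← hy]
      exact hlt y
    rw [h2] at h1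
    have h3 := Finset.eq_of_subset_of_card_le (s := Finset.univ.filter fun y =>
      rowOf t (σ y) < μ.colLen (colOf t x) ∧ colOf t y = colOf t x)
      (t := Finset.univ.filter fun y => colOf t y = colOf t x) (fun y hy => by
        simp at hy ⊢; exact hy.2) h1.ge
    have h4 : x ∈ Finset.univ.filter fun y => colOf t y = colOf t x := by simp
    rw [← h3] at h4
    simp only [Finset.mem_filter, Finset.mem_univ, true_and, and_true] at h4
    exact YoungDiagram.mem_iff_lt_colLen.2 h4
  let q : Fin m → Fin m := fun x => t.symm ⟨(rowOf t (σ x), colOf t x), hmem x⟩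
  have hrow : ∀ x, rowOf t (q x) = rowOf t (σ x) := fun x => by simp [q, rowOf]
  have hcol : ∀ x, colOf t (q x) = colOf t x := fun x => by simp [q, colOf]
  have hinj : Function.Injective q := fun x y hxy => by
    refine hf x y ?_ ?_
    · rw [← hcol x, hxy, hcol]
    · rw [← hrow x, hxy, hrow]
  exact ⟨Equiv.ofBijective q (Finite.injective_iff_bijective.1 hinj), hcol, hrow⟩

/-- If two entries of a column of t share a row of the tabloid, their transposition fixes the
tabloid and negates its antisymmetrization, which is thus zero. Otherwise the tabloid comes from
that of t by a column permutation, and antisymmetrizing gives ± the polytabloid. -/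
theorem colAnti_tabloid_mem (σ : Perm (Fin m)) :
    colAnti t (tabloidRep m) (tabloidRep m σ (Finsupp.single (rowOf t) 1)) ∈
      Submodule.span ℂ {polytabloid t} := by
  by_cases h : ∀ x y, colOf t x = colOf t y → rowOf t (σ⁻¹ x) = rowOf t (σ⁻¹ y) → x = y
  · obtain ⟨q, hq1, hq2⟩ := exists_col_perm t σ⁻¹ h
    have h1 : tabloidRep m σ (Finsupp.single (rowOf t) 1) =
        tabloidRep m q⁻¹ (Finsupp.single (rowOf t) 1) := by
      rw [tabloidRep_single, tabloidRep_single]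
      congr 1
      funext i
      simp only [Function.comp_apply, inv_inv, hq2]
    rw [h1, colAnti_col t _ q⁻¹ (apply_inv_of_forall hq1), ← polytabloid_eq]
    exact Submodule.smul_mem _ _ (Submodule.mem_span_singleton_self _)
  · push Not at h
    obtain ⟨x, y, h1, h2, h3⟩ := h
    have h4 := colAnti_swap t (tabloidRep m) h3 h1
      (tabloidRep m σ (Finsupp.single (rowOf t) 1))
    have h5 : tabloidRep m (swap x y) (tabloidRep m σ (Finsupp.single (rowOf t) 1)) =
        tabloidRep m σ (Finsupp.single (rowOf t) 1) := by
      rw [tabloidRep_single, tabloidRep_single]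
      congr 1
      funext i
      simp only [Function.comp_apply, swap_inv]
      by_cases hx : i = x
      · rw [hx, swap_apply_left, h2]
      · by_cases hy : i = y
        · rw [hy, swap_apply_right, h2]
        · rw [swap_apply_of_ne_of_ne hx hy]
    rw [h5] at h4
    have h6 := self_eq_neg.1 h4
    rw [h6]
    exact Submodule.zero_mem _

/-- Only the identity preserves both the rows and the columns of t. -/
theorem polytabloid_apply_rowOf : polytabloid t (rowOf t) = 1 := by
  rw [polytabloid_eq, colAnti_apply, Finsupp.finsetSum_apply,
    Finset.sum_eq_single (⟨1, fun _ => rfl⟩ : ColGroup t)]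
  · simp
  · intro q _ hq
    rw [Finsupp.smul_apply, tabloidRep_apply, Finsupp.single_apply, if_neg, smul_zero]
    intro h
    apply hq
    apply Subtype.ext
    ext i
    have h1 := congrFun h i
    exact congrArg Fin.val (eq_of_rowOf_colOf t (h1.symm) (q.2 i))
  · simp

theorem polytabloid_ne_zero : polytabloid t ≠ 0 := fun h => by
  have := polytabloid_apply_rowOf t
  rw [h] at this
  simp at this

theorem polytabloid_mem : polytabloid t ∈ (spechtSub m μ).toSubmodule :=
  Submodule.subset_span ⟨t, rfl⟩

theorem tableau_eq_trans (t' : Tableau m μ) :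
    polytabloid t' = tabloidRep m ((t.trans t'.symm : Perm (Fin m))) (polytabloid t) := by
  rw [tabloidRep_polytabloid]
  congr 1
  refine Equiv.ext fun i => ?_
  rw [Equiv.trans_apply]
  change t' i = t (t.symm (t' i))
  rw [Equiv.apply_symm_apply]

theorem colAnti_specht_mem {x : (Fin m → ℕ) →₀ ℂ} (hx : x ∈ (spechtSub m μ).toSubmodule) :
    colAnti t (tabloidRep m) x ∈ Submodule.span ℂ {polytabloid t} := by
  have : (spechtSub m μ).toSubmodule ≤
      (Submodule.span ℂ {polytabloid t}).comap (colAnti t (tabloidRep m)) := by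
    refine Submodule.span_le.2 ?_
    rintro _ ⟨t', rfl⟩
    simp only [Submodule.comap_coe, Set.mem_preimage, SetLike.mem_coe]
    rw [tableau_eq_trans t t', polytabloid_eq t, colAnti_apply t _ (Finsupp.single _ _), map_sum,
      map_sum, ← colAnti_apply, ← polytabloid_eq]
    refine Submodule.sum_mem _ fun q _ => ?_
    have h := colAnti_tabloid_mem t ((t.trans t'.symm : Perm (Fin m)) * q.1)
    rw [map_mul, Module.End.mul_apply] at h
    rw [map_smul, map_smul]
    exact Submodule.smul_mem _ _ h
  exact this hx

/-- The column antisymmetrizer is self-adjoint for the bilinear form in which the basis vectors are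
orthonormal, since inversion preserves the column group and the sign. -/
theorem linearCombination_polytabloid (x : (Fin m → ℕ) →₀ ℂ) :
    Finsupp.linearCombination ℂ (x : (Fin m → ℕ) → ℂ) (polytabloid t) =
      colAnti t (tabloidRep m) x (rowOf t) := by
  rw [polytabloid_eq, colAnti_apply, colAnti_apply, map_sum, Finsupp.finsetSum_apply]
  let e : ColGroup t ≃ ColGroup t :=
    { toFun := fun p => ⟨p.1⁻¹, apply_inv_of_forall (f := fun i => (t i).1.2) p.2⟩
      invFun := fun p => ⟨p.1⁻¹, apply_inv_of_forall (f := fun i => (t i).1.2) p.2⟩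
      left_inv := fun p => Subtype.ext (by simp)
      right_inv := fun p => Subtype.ext (by simp) }
  refine Fintype.sum_equiv e _ _ fun p => ?_
  rw [map_smul, tabloidRep_single, Finsupp.linearCombination_single, Finsupp.smul_apply,
    tabloidRep_apply]
  simp [e]

/-- Otherwise x would be orthogonal to the whole Specht module. Polytabloids have real coefficients,
so the module contains the conjugate of x, and ∑ |x_f|² = 0. -/
theorem exists_colAnti_ne_zero {x : (Fin m → ℕ) →₀ ℂ} (hx : x ∈ (spechtSub m μ).toSubmodule)
    (h0 : x ≠ 0) : ∃ t : Tableau m μ, colAnti t (tabloidRep m) x ≠ 0 := by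
  by_contra! h
  have h1 : (spechtSub m μ).toSubmodule ≤
      LinearMap.ker (Finsupp.linearCombination ℂ (x : (Fin m → ℕ) → ℂ)) := by
    refine Submodule.span_le.2 ?_
    rintro _ ⟨t, rfl⟩
    simp only [SetLike.mem_coe, LinearMap.mem_ker]
    rw [linearCombination_polytabloid, h]
    rfl
  let c : ((Fin m → ℕ) →₀ ℂ) →+ ((Fin m → ℕ) →₀ ℂ) :=
    Finsupp.mapRange.addMonoidHom (starRingEnd ℂ).toAddMonoidHom
  have hc : ∀ y f, c y f = starRingEnd ℂ (y f) := fun y f => rfl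
  have h2 : ∀ y ∈ (spechtSub m μ).toSubmodule, c y ∈ (spechtSub m μ).toSubmodule := by
    intro y hy
    induction hy using Submodule.span_induction with
    | mem y hy =>
      obtain ⟨t, rfl⟩ := hy
      have h3 : c (polytabloid t) = polytabloid t := by
        ext f
        rw [hc, polytabloid_eq, colAnti_apply, Finsupp.finsetSum_apply, map_sum]
        refine Finset.sum_congr rfl fun q _ => ?_
        rw [Finsupp.smul_apply, tabloidRep_apply, Finsupp.single_apply]
        split_ifs <;> simp
      simp only [h3]
      exact polytabloid_mem t
    | zero => rw [map_zero]; exact Submodule.zero_mem _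
    | add y z _ _ hy hz => rw [map_add]; exact Submodule.add_mem _ hy hz
    | smul a y _ hy =>
      have h3 : c (a • y) = starRingEnd ℂ a • c y := by
        ext f
        rw [hc, Finsupp.smul_apply, Finsupp.smul_apply, hc, smul_eq_mul, map_mul, smul_eq_mul]
      rw [h3]
      exact Submodule.smul_mem _ _ hy
  have h3 := h1 (h2 x hx)
  rw [LinearMap.mem_ker, Finsupp.linearCombination_apply, Finsupp.sum_of_support_subset
    (s := x.support) _ (fun f hf => by
      rw [Finsupp.mem_support_iff] at hf ⊢
      intro h4
      rw [hc, h4, map_zero] at hf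
      exact hf rfl) _ (by simp)] at h3
  have h4 : ∑ f ∈ x.support, ((Complex.normSq (x f) : ℝ) : ℂ) = 0 := by
    rw [← h3]
    refine Finset.sum_congr rfl fun f _ => ?_
    rw [hc, smul_eq_mul, mul_comm, Complex.mul_conj]
  rw [← Complex.ofReal_sum, Complex.ofReal_eq_zero,
    Finset.sum_eq_zero_iff_of_nonneg (fun f _ => Complex.normSq_nonneg _)] at h4
  apply h0
  ext f
  by_cases hf : f ∈ x.support
  · simpa using h4 f hf
  · simpa using hf

theorem colAnti_mem {p : Submodule ℂ V} (hp : ∀ g, ∀ x ∈ p, ρ g x ∈ p) {x : V} (hx : x ∈ p) :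
    colAnti t ρ x ∈ p := by
  rw [colAnti_apply]
  exact p.sum_mem fun q _ => p.smul_mem _ (hp _ _ hx)

theorem spechtRep_apply_coe (σ : Perm (Fin m)) (x : (spechtSub m μ).toSubmodule) :
    (spechtRep m μ σ x : (Fin m → ℕ) →₀ ℂ) = tabloidRep m σ x := rfl

-- James' submodule argument: some column antisymmetrizer sends a nonzero vector of an invariant
-- subspace to a nonzero multiple of a polytabloid, and one polytabloid generates the module.
include t in
theorem spechtRep_irreducible :
    Representation.IsIrreducible (k := ℂ) (V := (spechtSub m μ).toSubmodule) (spechtRep m μ) := by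
  refine isIrreducible_of_forall (v := ⟨polytabloid t, polytabloid_mem t⟩)
    (fun h => polytabloid_ne_zero t (congrArg Subtype.val h)) fun p hp h0 => ?_
  obtain ⟨x, hx, hx0⟩ := (Submodule.ne_bot_iff _).1 h0
  have hp' : ∀ g, ∀ y ∈ p.map (spechtSub m μ).toSubmodule.subtype,
      tabloidRep m g y ∈ p.map (spechtSub m μ).toSubmodule.subtype := by
    rintro g _ ⟨y, hy, rfl⟩
    exact ⟨_, hp g y hy, rfl⟩
  obtain ⟨t', h1⟩ := exists_colAnti_ne_zero x.2 (fun h => hx0 (Subtype.ext h))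
  have h2 : colAnti t' (tabloidRep m) x ∈ p.map (spechtSub m μ).toSubmodule.subtype :=
    colAnti_mem t' _ hp' ⟨x, hx, rfl⟩
  obtain ⟨c, hc⟩ := Submodule.mem_span_singleton.1 (colAnti_specht_mem t' x.2)
  have hc0 : c ≠ 0 := fun h => h1 (by rw [← hc, h, zero_smul])
  rw [← hc, Submodule.smul_mem_iff _ hc0] at h2
  have h3 : (spechtSub m μ).toSubmodule ≤ p.map (spechtSub m μ).toSubmodule.subtype := by
    refine Submodule.span_le.2 ?_
    rintro _ ⟨t'', rfl⟩
    change polytabloid t'' ∈ _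
    rw [tableau_eq_trans t' t'']
    exact hp' _ _ h2
  rw [Submodule.eq_top_iff']
  intro y
  obtain ⟨z, hz, hzy⟩ := h3 y.2
  rwa [← (Subtype.ext hzy : z = y)]

/-- An irreducible representation with a vector fixed by the row group of `t` and a vector on which
the column group of `t` acts by the sign is the Specht module. -/
theorem nonempty_equiv_specht {ρ : Representation ℂ (Perm (Fin m)) V} (hρ : ρ.IsIrreducible)
    {w v : V} (hw0 : w ≠ 0) (hw : ∀ x y, x ≠ y → rowOf t x = rowOf t y → ρ (swap x y) w = w)
    (hv0 : v ≠ 0) (hv : ∀ x y, x ≠ y → colOf t x = colOf t y → ρ (swap x y) v = -v) :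
    Nonempty (ρ.Equiv (spechtRep m μ)) := by
  let : MulAction (Perm (Fin m)) (Fin m → ℕ) := arrowAction
  have hact : ∀ (σ : Perm (Fin m)) (f : Fin m → ℕ), σ • f = f ∘ (σ⁻¹ : Perm (Fin m)) :=
    fun σ f => rfl
  obtain ⟨F, h1, h2, -⟩ := exists_equivariant ρ (rowOf t) w fun σ hσ =>
    fixed_of_fiber_swap hw σ (fun x => by
      have := congrFun hσ (σ x)
      rw [hact] at this
      simpa using this.symm)
  let ψ : ((Fin m → ℕ) →₀ ℂ) →ₗ[ℂ] V := Finsupp.linearCombination ℂ F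
  have hψ : ∀ σ x, ψ (tabloidRep m σ x) = ρ σ (ψ x) := by
    intro σ x
    induction x using Finsupp.induction_linear with
    | zero => simp
    | add x y hx hy => simp only [map_add, hx, hy]
    | single f c =>
      rw [tabloidRep_single, Finsupp.linearCombination_single, Finsupp.linearCombination_single,
        map_smul, h2, hact]
  have hψa : ∀ x, ψ (colAnti t (tabloidRep m) x) = colAnti t ρ (ψ x) := by
    intro x
    simp only [colAnti_apply, map_sum, map_smul, hψ]
  have hψw : ψ (Finsupp.single (rowOf t) 1) = w := by
    rw [Finsupp.linearCombination_single, one_smul, h1]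
  -- If ψ killed the polytabloid, the column antisymmetrizer would kill every translate of w, hence
  -- V. But it multiplies v by the order of the column group.
  have h3 : ψ (polytabloid t) ≠ 0 := by
    intro h0
    have htop : Submodule.span ℂ (Set.range fun σ => ρ σ w) = ⊤ :=
      span_eq_top_of_irreducible hρ _ (fun g x hx => by
        obtain ⟨σ, rfl⟩ := hx
        exact Submodule.subset_span ⟨g * σ, by simp⟩) ⟨1, by simp⟩ hw0
    have hker : ⊤ ≤ LinearMap.ker (colAnti t ρ) := by
      rw [← htop, Submodule.span_le]
      rintro _ ⟨σ, rfl⟩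
      simp only [SetLike.mem_coe, LinearMap.mem_ker]
      rw [← hψw, ← hψ, ← hψa]
      obtain ⟨c, hc⟩ := Submodule.mem_span_singleton.1 (colAnti_tabloid_mem t σ)
      rw [← hc, map_smul, h0, smul_zero]
    have h4 : colAnti t ρ v = 0 := hker trivial
    rw [colAnti_of_anti t hv, smul_eq_zero] at h4
    rcases h4 with h4 | h4
    · have : Nonempty (ColGroup t) := ⟨⟨1, fun _ => rfl⟩⟩
      simp at h4
    · exact hv0 h4
  obtain ⟨e⟩ := nonempty_equiv_of_ne_zero (spechtRep_irreducible t) hρ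
    (ψ.comp (spechtSub m μ).toSubmodule.subtype) (fun σ x => hψ σ x)
    (fun h => h3 (LinearMap.congr_fun h
      (⟨polytabloid t, polytabloid_mem t⟩ : (spechtSub m μ).toSubmodule)))
  exact ⟨e.symm⟩

/-- The sum of the translates of the polytabloid under the row group; it is nonzero because its
coefficient at the tabloid of t is the order of that group. -/
theorem exists_row_fixed : ∃ w : (spechtSub m μ).toSubmodule, w ≠ 0 ∧
    ∀ σ, (∀ x, rowOf t (σ x) = rowOf t x) → spechtRep m μ σ w = w := by
  classical
  let R := {σ : Perm (Fin m) // ∀ x, rowOf t (σ x) = rowOf t x}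
  let w : (spechtSub m μ).toSubmodule :=
    ∑ p : R, spechtRep m μ p.1 ⟨polytabloid t, polytabloid_mem t⟩
  have hw : (w : (Fin m → ℕ) →₀ ℂ) (rowOf t) = Fintype.card R := by
    simp only [w, Submodule.coe_sum, Finsupp.finsetSum_apply, spechtRep_apply_coe,
      tabloidRep_apply]
    rw [Finset.sum_congr rfl (fun (p : R) _ => by
      rw [show rowOf t ∘ p.1 = rowOf t from funext p.2, polytabloid_apply_rowOf])]
    simp
  refine ⟨w, fun h => ?_, fun σ hσ => ?_⟩
  · rw [h] at hw
    have : Nonempty R := ⟨⟨1, fun _ => rfl⟩⟩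
    have h2 := Fintype.card_ne_zero (α := R)
    apply h2
    have h3 : (Fintype.card R : ℂ) = 0 := hw.symm
    exact_mod_cast h3
  · have hσ' := apply_inv_of_forall hσ
    let e : R ≃ R :=
      { toFun := fun p => ⟨σ * p.1, fun i => (hσ _).trans (p.2 i)⟩
        invFun := fun p => ⟨σ⁻¹ * p.1, fun i => (hσ' _).trans (p.2 i)⟩
        left_inv := fun p => Subtype.ext (by simp)
        right_inv := fun p => Subtype.ext (by simp) }
    rw [map_sum]
    refine Fintype.sum_equiv e _ _ fun p => ?_
    rw [← Module.End.mul_apply, ← map_mul]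
    rfl

theorem spechtRep_swap_polytabloid {x y : Fin m} (hxy : x ≠ y) (h : colOf t x = colOf t y) :
    spechtRep m μ (swap x y) ⟨polytabloid t, polytabloid_mem t⟩ =
      -⟨polytabloid t, polytabloid_mem t⟩ := by
  apply Subtype.ext
  rw [spechtRep_apply_coe, Submodule.coe_neg]
  change tabloidRep m (swap x y) (polytabloid t) = -polytabloid t
  rw [polytabloid_eq, swap_colAnti t _ hxy h]

/-- The tableau with given cells. -/
def tableauOf (c : Fin m → ℕ × ℕ) (hc : Function.Injective c) (hmem : ∀ i, c i ∈ μ.cells)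
    (hcard : μ.cells.card = m) : Tableau m μ :=
  Equiv.ofBijective (fun i => (⟨c i, hmem i⟩ : μ.cells)) (by
    rw [Fintype.bijective_iff_injective_and_card]
    refine ⟨fun i j h => hc (congrArg Subtype.val h), by simp [hcard]⟩)

/-- A tableau of shape `(2,2)` with rows `{0,1}`, `{2,3}` and columns `{0,2}`, `{1,3}`. -/
def tableau22 : Tableau 4 shape22 :=
  tableauOf ![(0, 0), (0, 1), (1, 0), (1, 1)] (by decide) (by decide) (by decide)

/-- A tableau of shape `(4,2)` with columns `{2,0}`, `{3,1}`, `{4}`, `{5}`. -/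
def tableau42 : Tableau 6 shape42 :=
  tableauOf ![(1, 0), (1, 1), (0, 0), (0, 1), (0, 2), (0, 3)] (by decide) (by decide) (by decide)

/-- A tableau of shape `(3,3)` with rows `{0,1,2}`, `{3,4,5}`. -/
def tableau33 : Tableau 6 shape33 :=
  tableauOf ![(0, 0), (0, 1), (0, 2), (1, 0), (1, 1), (1, 2)] (by decide) (by decide) (by decide)

/-- A tableau of shape `(2,2,2)` with columns `{0,1,2}`, `{3,4,5}`. -/
def tableau222 : Tableau 6 shape222 :=
  tableauOf ![(0, 0), (1, 0), (2, 0), (0, 1), (1, 1), (2, 1)] (by decide) (by decide) (by decide)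

end Specht

/-! ### Representations where the transpositions are reflections -/

section Reflections

open Equiv Module

variable {α V : Type*} [AddCommGroup V] [Module ℂ V]

theorem eq_zero_of_eq_neg {v : V} (h : v = -v) : v = 0 := by
  have h1 : (2 : ℂ) • v = 0 := by
    linear_combination (norm := module) h
  exact (smul_eq_zero.1 h1).resolve_left two_ne_zero

theorem negDim_trivial {G : Type*} [Group G] (g : G) :
    negDim (Representation.trivial ℂ G ℂ) g = 0 := by
  have : LinearMap.ker (Representation.trivial ℂ G ℂ g + 1) = ⊥ := by
    rw [Submodule.eq_bot_iff]
    intro x hx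
    rw [mem_ker_add_one] at hx
    exact eq_zero_of_eq_neg hx
  rw [negDim, this, finrank_bot]

theorem negDim_le_finrank [FiniteDimensional ℂ V] {G : Type*} [Group G] (ρ : Representation ℂ G V)
    (g : G) : negDim ρ g ≤ finrank ℂ V := Submodule.finrank_le _

theorem fixed_of_negDim_eq_zero [FiniteDimensional ℂ V] {G : Type*} [Group G]
    {ρ : Representation ℂ G V} {g : G} (hg : g * g = 1)
    (h : negDim ρ g = 0) (v : V) : ρ g v = v := by
  have h1 : v - ρ g v ∈ LinearMap.ker (ρ g + 1) := by
    rw [mem_ker_add_one, map_sub, apply_apply_of_mul_self hg, neg_sub]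
  rw [negDim, Submodule.finrank_eq_zero] at h
  rw [h, Submodule.mem_bot] at h1
  exact (sub_eq_zero.1 h1).symm

theorem IsPairFamily.ne_zero [Fintype α] {ρ : Representation ℂ (Perm α) V} {e : ℂ}
    {F : α → α → V} (hF : IsPairFamily ρ e F) {p q : α} (h0 : F p q ≠ 0) {i j : α} (hij : i ≠ j) :
    F i j ≠ 0 := by
  classical
  intro h
  apply h0
  by_cases hpq : p = q
  · rw [hpq, hF.diag]
  · obtain ⟨σ, h1, h2⟩ := exists_perm_pair hij hpq
    rw [← h1, ← h2, ← hF.apply, h, map_zero]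

/-- F_{01} is row-invariant, and the rectangle on 0, 1, 2, 3 alternates along the columns {0, 2} and
{1, 3}. The same two vectors serve for (4,2). -/
theorem specht22_of_symm {ρ : Representation ℂ (Perm (Fin 4)) V} (hρ : ρ.IsIrreducible)
    {F : Fin 4 → Fin 4 → V} (hF : IsPairFamily ρ 1 F) {p q : Fin 4} (h0 : F p q ≠ 0) :
    Nonempty (ρ.Equiv (spechtRep 4 shape22)) := by
  have hs : ∀ i j, F j i = F i j := fun i j => by rw [hF.symm i j, one_smul]
  refine nonempty_equiv_specht tableau22 hρ (w := F 0 1)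
    (hF.ne_zero h0 (by decide)) (fun x y hxy h => ?_)
    (v := F 0 1 - F 0 3 - F 2 1 + F 2 3)
    (hF.rect_ne_zero (Or.inl rfl) (by simp) h0 (by decide) (by decide) (by decide) (by decide)
      (by decide) (by decide)) (fun x y hxy h => ?_)
  · have h1 : ∀ x y : Fin 4, x ≠ y → rowOf tableau22 x = rowOf tableau22 y →
        (x = 0 ∧ y = 1) ∨ (x = 1 ∧ y = 0) ∨ (x = 2 ∧ y = 3) ∨ (x = 3 ∧ y = 2) := by decide
    rcases h1 x y hxy h with ⟨rfl, rfl⟩ | ⟨rfl, rfl⟩ | ⟨rfl, rfl⟩ | ⟨rfl, rfl⟩ <;>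
      simp [hF.apply, swap_apply_def, hs 0 1]
  · have h1 : ∀ x y : Fin 4, x ≠ y → colOf tableau22 x = colOf tableau22 y →
        (x = 0 ∧ y = 2) ∨ (x = 2 ∧ y = 0) ∨ (x = 1 ∧ y = 3) ∨ (x = 3 ∧ y = 1) := by decide
    rcases h1 x y hxy h with ⟨rfl, rfl⟩ | ⟨rfl, rfl⟩ | ⟨rfl, rfl⟩ | ⟨rfl, rfl⟩ <;>
      simp [hF.apply, swap_apply_def] <;> abel

theorem specht42_of_symm {ρ : Representation ℂ (Perm (Fin 6)) V} (hρ : ρ.IsIrreducible)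
    {F : Fin 6 → Fin 6 → V} (hF : IsPairFamily ρ 1 F) {p q : Fin 6} (h0 : F p q ≠ 0) :
    Nonempty (ρ.Equiv (spechtRep 6 shape42)) := by
  have hs : ∀ i j, F j i = F i j := fun i j => by rw [hF.symm i j, one_smul]
  refine nonempty_equiv_specht tableau42 hρ (w := F 0 1)
    (hF.ne_zero h0 (by decide)) (fun x y hxy h => ?_)
    (v := F 0 1 - F 0 3 - F 2 1 + F 2 3)
    (hF.rect_ne_zero (Or.inl rfl) (by simp) h0 (by decide) (by decide) (by decide) (by decide)
      (by decide) (by decide)) (fun x y hxy h => ?_)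
  · have h1 : ∀ x y : Fin 6, rowOf tableau42 x = rowOf tableau42 y →
        (swap x y 0 = 0 ∧ swap x y 1 = 1) ∨ (swap x y 0 = 1 ∧ swap x y 1 = 0) := by decide
    rcases h1 x y h with ⟨h2, h3⟩ | ⟨h2, h3⟩
    · rw [hF.apply, h2, h3]
    · rw [hF.apply, h2, h3, hs]
  · have h1 : ∀ x y : Fin 6, x ≠ y → colOf tableau42 x = colOf tableau42 y →
        (x = 0 ∧ y = 2) ∨ (x = 2 ∧ y = 0) ∨ (x = 1 ∧ y = 3) ∨ (x = 3 ∧ y = 1) := by decide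
    rcases h1 x y hxy h with ⟨rfl, rfl⟩ | ⟨rfl, rfl⟩ | ⟨rfl, rfl⟩ | ⟨rfl, rfl⟩ <;>
      simp [hF.apply, swap_apply_def] <;> abel

theorem exists_row_fixed_two {m : ℕ} {μ : YoungDiagram} (t : Tableau m μ) {a b : Fin m}
    (h : rowOf t a = rowOf t b)
    (hrow : ∀ x y, x ≠ a → x ≠ b → y ≠ a → y ≠ b → rowOf t x = rowOf t y) :
    ∃ w : (spechtSub m μ).toSubmodule, w ≠ 0 ∧
      (∀ σ : Perm (Fin m), σ a = a → σ b = b → spechtRep m μ σ w = w) ∧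
      spechtRep m μ (swap a b) w = (1 : ℂ) • w := by
  obtain ⟨w, h0, hw⟩ := exists_row_fixed t
  refine ⟨w, h0, fun σ ha hb => ?_, ?_⟩
  · refine fixed_two_of_swap (V := (spechtSub m μ).toSubmodule) (ρ := spechtRep m μ)
      (fun x y _ hxa hxb hya hyb => ?_) σ ha hb
    exact hw _ (apply_swap_of_eq (hrow x y hxa hxb hya hyb))
  · rw [one_smul]
    exact hw _ (apply_swap_of_eq h)

/-- When the points other than a and b share a row, a row-invariant vector is fixed by the
stabilizer of the pair, and a symmetric pair family gives m - 3. The trivial and standard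
alternatives are not excluded but bounded, the latter through 1 ≤ k. -/
theorem negDim_specht_le_of_row {m k : ℕ} (hm : 3 ≤ m) (hk : m ≤ k + 3) (hk1 : 1 ≤ k)
    {μ : YoungDiagram} (t : Tableau m μ)
    {a b : Fin m} (hab : a ≠ b) (h : rowOf t a = rowOf t b)
    (hrow : ∀ x y, x ≠ a → x ≠ b → y ≠ a → y ≠ b → rowOf t x = rowOf t y) {x y : Fin m}
    (hxy : x ≠ y) : negDim (V := (spechtSub m μ).toSubmodule) (spechtRep m μ) (swap x y) ≤ k := by
  obtain ⟨w, h0, h1, h2⟩ := exists_row_fixed_two t h hrow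
  rcases pair_family_cases (by omega) (spechtRep_irreducible t) hab h1 h2 with
    ⟨⟨e⟩⟩ | ⟨⟨e⟩⟩ | ⟨F, hF, h3⟩
  · rw [negDim_equiv e, negDim_trivial]; omega
  · rw [negDim_equiv e]; exact (negDim_standardRep_le hxy).trans hk1
  · have := hF.negDim_le_of_symm (spechtRep_irreducible t) (p := a) (q := b) (by rw [h3]; exact h0)
      hxy (by simpa using hm)
    rw [Fintype.card_fin] at this
    omega

theorem negDim_specht22_le {x y : Fin 4} (hxy : x ≠ y) :
    negDim (V := (spechtSub 4 shape22).toSubmodule) (spechtRep 4 shape22) (swap x y) ≤ 1 :=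
  negDim_specht_le_of_row (by decide) (by decide) le_rfl tableau22 (show (0 : Fin 4) ≠ 1 by decide)
    (by decide) (by decide) hxy

theorem negDim_specht42_le {x y : Fin 6} (hxy : x ≠ y) :
    negDim (V := (spechtSub 6 shape42).toSubmodule) (spechtRep 6 shape42) (swap x y) ≤ 3 :=
  negDim_specht_le_of_row (by decide) (by decide) (by decide) tableau42
    (show (0 : Fin 6) ≠ 1 by decide) (by decide) (by decide) hxy

variable [DecidableEq α] {ρ : Representation ℂ (Perm α) V}

theorem apply_swap_conj (σ : Perm α) (x y : α) (v : V) :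
    ρ (swap (σ x) (σ y)) (ρ σ v) = ρ σ (ρ (swap x y) v) := by
  rw [← Module.End.mul_apply, ← map_mul, ← Module.End.mul_apply, ← map_mul,
    Equiv.swap_apply_apply]
  simp

theorem neg_of_forall_neg {a b : α} (hab : a ≠ b) (h : ∀ v, ρ (swap a b) v = -v) {c d : α}
    (hcd : c ≠ d) (v : V) : ρ (swap c d) v = -v := by
  obtain ⟨σ, h2, h3⟩ := exists_perm_pair hcd hab
  have h4 := h (ρ σ v)
  rw [← h2, ← h3, apply_swap_conj, ← map_neg] at h4
  have h5 := congrArg (ρ σ⁻¹) h4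
  simp only [← Module.End.mul_apply, ← map_mul] at h5
  simpa using h5

/-- If a pair of disjoint transpositions has the same `-1`-eigenspaces, so has any other one. -/
theorem neg_of_disjoint {a b x y : α} (hi : Function.Injective ![a, b, x, y])
    (h : ∀ v, ρ (swap a b) v = -v → ρ (swap x y) v = -v) {c d e f : α}
    (hi' : Function.Injective ![c, d, e, f]) {v : V} (hv : ρ (swap c d) v = -v) :
    ρ (swap e f) v = -v := by
  obtain ⟨σ, hσ⟩ := exists_perm_tuple hi' hi
  have h0 : σ c = a := hσ 0
  have h1 : σ d = b := hσ 1
  have h2 : σ e = x := hσ 2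
  have h3 : σ f = y := hσ 3
  have h4 := h (ρ σ v) (by rw [← h0, ← h1, apply_swap_conj, hv, map_neg])
  rw [← h2, ← h3, apply_swap_conj, ← map_neg] at h4
  have h5 := congrArg (ρ σ⁻¹) h4
  simp only [← Module.End.mul_apply, ← map_mul] at h5
  simpa using h5

/-- Two transpositions sharing a point move at most three points, so five points leave room for a
third one disjoint from both; the sign passes along disjoint pairs. -/
theorem neg_all_of_disjoint [Fintype α] (hk : 5 ≤ Fintype.card α) {a b x y : α}
    (hi : Function.Injective ![a, b, x, y])
    (h : ∀ v, ρ (swap a b) v = -v → ρ (swap x y) v = -v) {v : V} (hv : ρ (swap a b) v = -v)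
    {c d : α} (hcd : c ≠ d) : ρ (swap c d) v = -v := by
  have hab : a ≠ b := fun h => by simpa using hi.ne (show (0 : Fin 4) ≠ 1 by decide) h
  have hdisj : ∀ c d e f : α, c ≠ d → e ≠ f → e ∉ ({c, d} : Finset α) → f ∉ ({c, d} : Finset α) →
      ρ (swap c d) v = -v → ρ (swap e f) v = -v := by
    intro c d e f hcd hef he hf
    simp only [Finset.mem_insert, Finset.mem_singleton, not_or] at he hf
    exact neg_of_disjoint hi h (injective_vec_four hcd (Ne.symm he.1) (Ne.symm hf.1)
      (Ne.symm he.2) (Ne.symm hf.2) hef)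
  by_cases h1 : c ∉ ({a, b} : Finset α) ∧ d ∉ ({a, b} : Finset α)
  · exact hdisj a b c d hab hcd h1.1 h1.2 hv
  · have h2 : (({a, b} : Finset α) ∪ {c, d}).card ≤ 3 := by
      have h3 := Finset.card_union_add_card_inter ({a, b} : Finset α) {c, d}
      have h4 : 0 < (({a, b} : Finset α) ∩ {c, d}).card := by
        rw [Finset.card_pos]
        by_cases hc : c ∈ ({a, b} : Finset α)
        · exact ⟨c, Finset.mem_inter.2 ⟨hc, by simp⟩⟩
        · exact ⟨d, Finset.mem_inter.2 ⟨by tauto, by simp⟩⟩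
      rw [Finset.card_pair hab, Finset.card_pair hcd] at h3
      omega
    have h3 : 1 < (({a, b} : Finset α) ∪ {c, d})ᶜ.card := by
      rw [Finset.card_compl]; omega
    obtain ⟨e, he, f, hf, hef⟩ := Finset.one_lt_card.1 h3
    simp only [Finset.mem_compl, Finset.mem_union, not_or] at he hf
    have h4 := hdisj a b e f hab hef he.1 hf.1 hv
    have he2 := he.2
    have hf2 := hf.2
    simp only [Finset.mem_insert, Finset.mem_singleton, not_or] at he2 hf2
    refine hdisj e f c d hef hcd ?_ ?_ h4 <;>
      simp [Ne.symm he2.1, Ne.symm he2.2, Ne.symm hf2.1, Ne.symm hf2.2]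

/-- Permutations of the other points commute with (a b) and preserve its -1-line, where each
transposition acts by ±1. If all act by 1, the line is fixed; otherwise a disjoint transposition
negates it. -/
theorem neg_line_cases [Fintype α] [FiniteDimensional ℂ V] {a b : α} (hab : a ≠ b)
    (h : negDim ρ (swap a b) = 1) :
    ∃ q : V, q ≠ 0 ∧ ρ (swap a b) q = -q ∧
      ((∀ σ : Perm α, σ a = a → σ b = b → ρ σ q = q) ∨
        ∃ x y, Function.Injective ![a, b, x, y] ∧
          ∀ v, ρ (swap a b) v = -v → ρ (swap x y) v = -v) := by
  obtain ⟨⟨q, hq⟩, h0, hspan⟩ := finrank_eq_one_iff'.1 h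
  have hspan' : ∀ v, ρ (swap a b) v = -v → ∃ c : ℂ, v = c • q := fun v hv => by
    obtain ⟨c, hc⟩ := hspan ⟨v, mem_ker_add_one.2 hv⟩
    exact ⟨c, (congrArg Subtype.val hc).symm⟩
  have hq0 : q ≠ 0 := fun h => h0 (Subtype.ext h)
  rw [mem_ker_add_one] at hq
  refine ⟨q, hq0, hq, ?_⟩
  by_contra! hcon
  obtain ⟨⟨σ, ha, hb, hσ⟩, hcon⟩ := hcon
  refine hσ (fixed_two_of_swap (fun x y hxy hxa hxb hya hyb => ?_) σ ha hb)
  have hcomm : ∀ v, ρ (swap a b) (ρ (swap x y) v) = ρ (swap x y) (ρ (swap a b) v) := by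
    intro v
    have := apply_swap_conj (ρ := ρ) (swap x y) a b v
    rwa [swap_apply_of_ne_of_ne hxa.symm hya.symm, swap_apply_of_ne_of_ne hxb.symm hyb.symm] at this
  obtain ⟨c, hc⟩ := hspan' (ρ (swap x y) q) (by rw [hcomm, hq, map_neg])
  have h2 : q = (c * c) • q := by
    have := apply_apply_of_mul_self (ρ := ρ) (swap_mul_self x y) q
    rw [hc, map_smul, hc, smul_smul] at this
    exact this.symm
  have h3 : (c * c - 1) • q = 0 := by rw [sub_smul, ← h2, one_smul, sub_self]
  have h4 : (c - 1) * (c + 1) = 0 := by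
    linear_combination (smul_eq_zero.1 h3).resolve_right hq0
  rcases mul_eq_zero.1 h4 with h5 | h5
  · rw [hc, sub_eq_zero.1 h5, one_smul]
  · exfalso
    obtain ⟨v, hv, hv2⟩ := hcon x y
      (injective_vec_four hab hxa.symm hya.symm hxb.symm hyb.symm hxy)
    apply hv2
    obtain ⟨c', rfl⟩ := hspan' v hv
    rw [map_smul, hc, eq_neg_of_add_eq_zero_left h5]
    module

/-- The irreducible representations of the symmetric group where the transpositions act trivially
or as reflections. -/
theorem cases_of_negDim_le_one [FiniteDimensional ℂ V] {n : ℕ} (hn : 3 ≤ n)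
    {ρ : Representation ℂ (Perm (Fin n)) V} (hρ : ρ.IsIrreducible) {a b : Fin n} (hab : a ≠ b)
    (h : negDim ρ (swap a b) ≤ 1) :
    Nonempty (ρ.Equiv (Representation.trivial ℂ (Perm (Fin n)) ℂ)) ∨
      Nonempty (ρ.Equiv (signRep n)) ∨ Nonempty (ρ.Equiv (standardRep n)) ∨
      (n = 4 ∧ Nonempty (ρ.Equiv (spechtRep n shape22))) := by
  obtain ⟨v0, hv0⟩ := exists_ne_zero_of_irreducible hρ
  rcases Nat.le_one_iff_eq_zero_or_eq_one.1 h with h | h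
  · exact Or.inl (trivial_of_fixed hρ hv0 (fixed_all_of_swap fun x y hxy =>
      fixed_of_negDim_eq_zero (swap_mul_self x y) (by rw [← h, negDim_swap_eq hxy hab]) v0))
  obtain ⟨q, hq0, hq, h1 | ⟨x, y, hi, h1⟩⟩ := neg_line_cases hab h
  · rcases pair_family_cases (e := -1) (by omega) hρ hab h1 (by rw [hq, neg_one_smul]) with
      h2 | h2 | ⟨F, hF, h2⟩
    · exact Or.inl h2
    · exact Or.inr (Or.inr (Or.inl h2))
    · by_cases hn4 : 4 ≤ n
      · have := hF.two_le_negDim (by simpa using hn4) (p := a) (q := b) (by rw [h2]; exact hq0) hab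
        omega
      -- For three points, zero row sums and alternation give F_{01} = F_{12} = F_{20}, a vector
      -- negated by every transposition.
      · obtain rfl : n = 3 := by omega
        have h3 : F 0 1 ≠ 0 := hF.ne_zero (p := a) (q := b) (by rw [h2]; exact hq0) (by decide)
        have h4 := hF.sum 0
        have h5 := hF.sum 1
        have h6 := hF.symm 0 1
        have h7 := hF.symm 0 2
        have h8 := hF.symm 1 2
        rw [Fin.sum_univ_three, hF.diag] at h4 h5
        refine Or.inr (Or.inl (sign_of_swap hρ h3 fun x y hxy => ?_))
        have e1 : ρ (swap 0 1) (F 0 1) = - F 0 1 := by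
          simp only [hF.apply, swap_apply_left, swap_apply_right]
          rw [h6, neg_one_smul]
        have e2 : ρ (swap 0 2) (F 0 1) = - F 0 1 := by
          have : F 2 1 = -F 0 1 := by
            linear_combination (norm := module) h8 - h5 + h6
          simpa [hF.apply, swap_apply_def] using this
        have e3 : ρ (swap 1 2) (F 0 1) = - F 0 1 := by
          have : F 0 2 = -F 0 1 := by
            linear_combination (norm := module) h4
          simpa [hF.apply, swap_apply_def] using this
        fin_cases x <;> fin_cases y <;> first | exact absurd rfl hxy | assumption | skip
        all_goals rw [swap_comm]; assumption
  · by_cases hn5 : 5 ≤ n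
    · exact Or.inr (Or.inl (sign_of_swap hρ hq0 fun c d hcd =>
        neg_all_of_disjoint (by simpa using hn5) hi h1 hq hcd))
    · have hn4 : n = 4 := by
        have := Fintype.card_le_of_injective _ hi
        simp at this
        omega
      subst hn4
      by_cases hall : ∀ v, ρ (swap a b) v = -v
      · exact Or.inr (Or.inl (sign_of_swap hρ hq0 fun c d hcd => neg_of_forall_neg hab hall hcd q))
      · push Not at hall
        obtain ⟨v, hv⟩ := hall
        have hw0 : v + ρ (swap a b) v ≠ 0 := fun h => hv (neg_eq_of_add_eq_zero_right h).symm
        have hw : ρ (swap a b) (v + ρ (swap a b) v) = (1 : ℂ) • (v + ρ (swap a b) v) := by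
          rw [map_add, apply_apply_of_mul_self (swap_mul_self a b), add_comm, one_smul]
        set w := v + ρ (swap a b) v
        have hfix : ∀ x y, x ≠ y → x ≠ a → x ≠ b → y ≠ a → y ≠ b → ρ (swap x y) w = w := by
          intro x y hxy hxa hxb hya hyb
          have hcomm : ρ (swap a b) (ρ (swap x y) w) = ρ (swap x y) (ρ (swap a b) w) := by
            have := apply_swap_conj (ρ := ρ) (swap x y) a b w
            rwa [swap_apply_of_ne_of_ne hxa.symm hya.symm,
              swap_apply_of_ne_of_ne hxb.symm hyb.symm] at this
          -- This vector is negated by (x y), hence by the disjoint (a b), which also fixes it; so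
          -- it vanishes.
          have h2 : ρ (swap a b) (w - ρ (swap x y) w) = -(w - ρ (swap x y) w) :=
            neg_of_disjoint hi h1 (injective_vec_four hxy hxa hxb hya hyb hab) (by
              rw [map_sub, apply_apply_of_mul_self (swap_mul_self x y), neg_sub])
          rw [map_sub, hcomm, hw, one_smul] at h2
          exact (sub_eq_zero.1 (eq_zero_of_eq_neg h2)).symm
        rcases pair_family_cases (e := 1) (by omega) hρ hab (fixed_two_of_swap hfix) hw with
          h2 | h2 | ⟨F, hF, h2⟩
        · exact Or.inl h2
        · exact Or.inr (Or.inr (Or.inl h2))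
        · exact Or.inr (Or.inr (Or.inr ⟨rfl, specht22_of_symm hρ hF (p := a) (q := b)
            (by rw [h2]; exact hw0)⟩))

/-! ### Representations of small dimension -/

/-- A -1-line fixed by the other points would give an alternating pair family. If its row sums
vanish, -1 has multiplicity at least 2. If not, they form a nonzero point family with zero total
sum, which needs dimension at least 4. -/
theorem exists_character_of_negDim_le_one [Fintype α] [FiniteDimensional ℂ V]
    (hk : 5 ≤ Fintype.card α) (hV : finrank ℂ V ≤ 3) {v : V} (h0 : v ≠ 0) {a b : α} (hab : a ≠ b)
    (h : negDim ρ (swap a b) ≤ 1) :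
    (∃ v : V, v ≠ 0 ∧ ∀ x y, x ≠ y → ρ (swap x y) v = v) ∨
      ∃ v : V, v ≠ 0 ∧ ∀ x y, x ≠ y → ρ (swap x y) v = -v := by
  rcases Nat.le_one_iff_eq_zero_or_eq_one.1 h with h | h
  · exact Or.inl ⟨v, h0, fun x y hxy =>
      fixed_of_negDim_eq_zero (swap_mul_self x y) (by rw [← h, negDim_swap_eq hxy hab]) v⟩
  obtain ⟨q, hq0, hq, h1 | ⟨x, y, hi, h1⟩⟩ := neg_line_cases hab h
  · exfalso
    obtain ⟨F, e1, e2, e3, e4⟩ := exists_pair_family (e := -1) hab h1 (by rw [hq, neg_one_smul])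
    by_cases h5 : ∀ i, ∑ j, F i j = 0
    · have := IsPairFamily.two_le_negDim ⟨e2, e3, e4, h5⟩ (by omega) (p := a) (q := b)
        (by rw [e1]; exact hq0) hab
      omega
    · push Not at h5
      obtain ⟨i, hi⟩ := h5
      have h6 : ∑ i, ∑ j, F i j = 0 := by
        refine eq_zero_of_eq_neg ?_
        rw [← Finset.sum_neg_distrib, Finset.sum_comm]
        refine Finset.sum_congr rfl fun i _ => ?_
        rw [← Finset.sum_neg_distrib]
        refine Finset.sum_congr rfl fun j _ => ?_
        rw [e3 i j, neg_one_smul]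
      have := family_one_card_le (F := fun i => ∑ j, F i j) (apply_row_sum e2) h6 hi
      omega
  · exact Or.inr ⟨q, hq0, fun c d hcd => neg_all_of_disjoint hk hi h1 hq hcd⟩

/-- In dimension at most 3, one of the two eigenspaces of a transposition has dimension at most 1,
and the twist exchanges them. -/
theorem exists_character [Fintype α] [FiniteDimensional ℂ V]
    (hk : 5 ≤ Fintype.card α) (hV : finrank ℂ V ≤ 3) {v : V} (h0 : v ≠ 0) :
    (∃ v : V, v ≠ 0 ∧ ∀ x y, x ≠ y → ρ (swap x y) v = v) ∨
      ∃ v : V, v ≠ 0 ∧ ∀ x y, x ≠ y → ρ (swap x y) v = -v := by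
  obtain ⟨a, b, hab⟩ := Fintype.one_lt_card_iff.1 (show 1 < Fintype.card α by omega)
  by_cases h : negDim ρ (swap a b) ≤ 1
  · exact exists_character_of_negDim_le_one hk hV h0 hab h
  · have h1 := finrank_eq_posDim_add_negDim ρ (swap_mul_self a b)
    have h2 := exists_character_of_negDim_le_one (ρ := twist ρ) hk hV h0 hab
      (by rw [negDim_twist hab]; omega)
    rcases h2 with ⟨v, hv, h3⟩ | ⟨v, hv, h3⟩
    · refine Or.inr ⟨v, hv, fun x y hxy => ?_⟩
      have := h3 x y hxy
      rw [twist_swap hxy] at this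
      exact (neg_eq_iff_eq_neg.1 this)
    · refine Or.inl ⟨v, hv, fun x y hxy => ?_⟩
      have := h3 x y hxy
      rwa [twist_swap hxy, neg_inj] at this

/-- The action on the `-1`-eigenspace of a transposition of the permutations of the other points. -/
def negSub (ρ : Representation ℂ (Perm α) V) (a b : α) :
    Subrepresentation (ρ.comp (Perm.ofSubtype : Perm {x // x ≠ a ∧ x ≠ b} →* Perm α)) where
  toSubmodule := LinearMap.ker (ρ (swap a b) + 1)
  apply_mem_toSubmodule τ v hv := by
    rw [mem_ker_add_one] at hv ⊢
    have h := apply_swap_conj (ρ := ρ) (Perm.ofSubtype τ) a b v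
    rw [Perm.ofSubtype_apply_of_not_mem τ (by simp), Perm.ofSubtype_apply_of_not_mem τ (by simp),
      hv, map_neg] at h
    exact h

/-- The symmetric group of the other points, at least five in number, acts on the -1-eigenspace of
(a b), whose dimension is at most 3, so `exists_character` applies there. -/
theorem exists_neg_character [Fintype α] [FiniteDimensional ℂ V] (hk : 7 ≤ Fintype.card α)
    {a b : α} (hab : a ≠ b) (h : negDim ρ (swap a b) ≤ 3) (h0 : negDim ρ (swap a b) ≠ 0) :
    ∃ v : V, v ≠ 0 ∧ ρ (swap a b) v = -v ∧
      ((∀ x y, x ≠ y → x ≠ a → x ≠ b → y ≠ a → y ≠ b → ρ (swap x y) v = v) ∨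
        ∀ x y, x ≠ y → x ≠ a → x ≠ b → y ≠ a → y ≠ b → ρ (swap x y) v = -v) := by
  have hcard : 5 ≤ Fintype.card {x // x ≠ a ∧ x ≠ b} := by
    have h1 : Fintype.card {x // x ≠ a ∧ x ≠ b} = ({a, b} : Finset α)ᶜ.card := by
      rw [Fintype.card_subtype]
      congr 1
      ext x
      simp
    rw [h1, Finset.card_compl, Finset.card_pair hab]
    omega
  have hne : LinearMap.ker (ρ (swap a b) + 1) ≠ ⊥ := fun h1 => h0 (by rw [negDim, h1, finrank_bot])
  obtain ⟨v, hv, hv0⟩ := (Submodule.ne_bot_iff _).1 hne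
  have key : ∀ (τ : Perm {x // x ≠ a ∧ x ≠ b}) (v : (negSub ρ a b).toSubmodule),
      ((negSub ρ a b).toRepresentation τ v : V) = ρ (Perm.ofSubtype τ) v := fun _ _ => rfl
  have h1 := exists_character (ρ := (negSub ρ a b).toRepresentation) hcard h
    (v := ⟨v, hv⟩) (fun h => hv0 (congrArg Subtype.val h))
  rcases h1 with ⟨w, hw, h2⟩ | ⟨w, hw, h2⟩
  · refine ⟨w, fun h => hw (Subtype.ext h), mem_ker_add_one.1 w.2, Or.inl ?_⟩
    intro x y hxy hxa hxb hya hyb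
    have := congrArg Subtype.val (h2 ⟨x, hxa, hxb⟩ ⟨y, hya, hyb⟩ (by simpa using hxy))
    rwa [key, Perm.ofSubtype_swap_eq] at this
  · refine ⟨w, fun h => hw (Subtype.ext h), mem_ker_add_one.1 w.2, Or.inr ?_⟩
    intro x y hxy hxa hxb hya hyb
    have := congrArg Subtype.val (h2 ⟨x, hxa, hxb⟩ ⟨y, hya, hyb⟩ (by simpa using hxy))
    rwa [key, Perm.ofSubtype_swap_eq] at this

theorem finrank_eq_of_equiv_standard {n : ℕ} (hn : n ≠ 0) {ρ : Representation ℂ (Perm (Fin n)) V}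
    (e : ρ.Equiv (standardRep n)) : finrank ℂ V + 1 = n := by
  rw [e.toLinearEquiv.finrank_eq, finrank_standardSub hn]

theorem le_posDim_of_equiv_standard [FiniteDimensional ℂ V] {n : ℕ} (hn : n ≠ 0)
    {ρ : Representation ℂ (Perm (Fin n)) V}
    (e : ρ.Equiv (standardRep n)) {a b : Fin n} (hab : a ≠ b) : n ≤ posDim ρ (swap a b) + 2 := by
  have h1 := finrank_eq_of_equiv_standard hn e
  have h2 := finrank_eq_posDim_add_negDim ρ (swap_mul_self a b)
  have h3 := negDim_equiv e (swap a b)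
  have h4 := negDim_standardRep_le hab
  omega

/-- On the vector of `exists_neg_character`, the other points act trivially or by the sign. In the
first case an alternating pair family would give multiplicity at least 4. In the second, the twist
would be standard or carry a symmetric pair family, and its +1-eigenspace, the -1-eigenspace of ρ,
would be too large. -/
theorem cases_of_negDim_le_three_of_seven_le [FiniteDimensional ℂ V] {n : ℕ} (hn : 7 ≤ n)
    {ρ : Representation ℂ (Perm (Fin n)) V} (hρ : ρ.IsIrreducible) {a b : Fin n} (hab : a ≠ b)
    (h : negDim ρ (swap a b) ≤ 3) :
    Nonempty (ρ.Equiv (Representation.trivial ℂ (Perm (Fin n)) ℂ)) ∨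
      Nonempty (ρ.Equiv (signRep n)) ∨ Nonempty (ρ.Equiv (standardRep n)) := by
  by_cases h0 : negDim ρ (swap a b) = 0
  · rcases cases_of_negDim_le_one (by omega) hρ hab (by omega) with h | h | h | ⟨h, -⟩
    · exact Or.inl h
    · exact Or.inr (Or.inl h)
    · exact Or.inr (Or.inr h)
    · omega
  obtain ⟨v, hv0, hv, h1 | h1⟩ := exists_neg_character (by simpa using hn) hab h h0
  · rcases pair_family_cases (e := -1) (by omega) hρ hab (fixed_two_of_swap h1)
      (by rw [hv, neg_one_smul]) with h2 | h2 | ⟨F, hF, h2⟩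
    · exact Or.inl h2
    · exact Or.inr (Or.inr h2)
    · have := hF.four_le_negDim (by simp; omega) (p := a) (q := b) (by rw [h2]; exact hv0) hab
      omega
  · rcases pair_family_cases (e := 1) (by omega) (twist_irreducible hρ) hab
      (fixed_two_of_swap (ρ := twist ρ) (v := v) fun x y hxy hxa hxb hya hyb => by
        rw [twist_swap hxy, h1 x y hxy hxa hxb hya hyb, neg_neg])
      (by rw [twist_swap hab, hv, neg_neg, one_smul]) with h2 | ⟨⟨e⟩⟩ | ⟨F, hF, h2⟩
    · exact Or.inr (Or.inl (sign_of_twist_trivial hρ h2))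
    · have := le_posDim_of_equiv_standard (by omega) e hab
      rw [posDim_twist hab] at this
      omega
    · have := hF.four_le_posDim (Or.inl rfl) (by simp; omega) (p := a) (q := b)
        (by rw [h2]; exact hv0) hab
      rw [posDim_twist hab] at this
      omega

end Reflections

/-! ### Fixed vectors of three-cycles -/

section ThreeCycles

open Equiv Module

variable {V : Type*} [AddCommGroup V] [Module ℂ V]

/-- Otherwise 1 + c + c² = 0 for every 3-cycle c. Inside A_4 this forces the double transpositions
to act trivially; with a fifth point two of them multiply to a 3-cycle, which would then act
trivially as well. -/
theorem exists_fixed_threeCycle {ρ : Representation ℂ (Perm (Fin 5)) V} {v : V} (hv : v ≠ 0) :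
    ∃ u : V, u ≠ 0 ∧ ρ (swap 2 3) (ρ (swap 3 4) u) = u := by
  by_contra! h
  have hmul : ∀ (g g' : Perm (Fin 5)) (v : V), ρ (g * g') v = ρ g (ρ g' v) := fun g g' v => by
    rw [map_mul, Module.End.mul_apply]
  have hinj : ∀ (g : Perm (Fin 5)) (v : V), ρ g v = 0 → v = 0 := fun g v hgv => by
    have : ρ (g⁻¹ * g) v = 0 := by rw [hmul, hgv, map_zero]
    simpa using this
  have h0 : ∀ x y z : Fin 5, x ≠ y → x ≠ z → y ≠ z →
      ∀ v : V, ρ (swap x y * swap y z) v = v → v = 0 := by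
    intro x y z hxy hxz hyz v hv
    obtain ⟨σ, hσ⟩ := exists_perm_tuple (f := ![x, y, z]) (g := ![(2 : Fin 5), 3, 4])
      (by intro i j hij; fin_cases i <;> fin_cases j <;> simp_all) (by decide)
    have h1 : σ x = 2 := hσ 0
    have h2 : σ y = 3 := hσ 1
    have h3 : σ z = 4 := hσ 2
    by_contra hv0
    refine h (ρ σ v) (fun h => hv0 (hinj σ v h)) ?_
    rw [← h1, ← h2, ← h3, apply_swap_conj, apply_swap_conj, ← hmul (swap x y), hv]
  have hbraid : ∀ x y z : Fin 5, x ≠ y → x ≠ z → y ≠ z →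
      swap x y * swap y z * (swap x y * swap y z) = swap z y * swap y x := by decide
  have hbraid' : ∀ x y z : Fin 5, x ≠ y → x ≠ z → y ≠ z →
      swap x y * swap y z * (swap z y * swap y x) = 1 := by decide
  have h3 : ∀ x y z : Fin 5, x ≠ y → x ≠ z → y ≠ z →
      ∀ v : V, v + ρ (swap x y * swap y z) v + ρ (swap z y * swap y x) v = 0 := by
    intro x y z hxy hxz hyz v
    refine h0 x y z hxy hxz hyz _ ?_
    rw [map_add, map_add, ← hmul, ← hmul, hbraid x y z hxy hxz hyz, hbraid' x y z hxy hxz hyz,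
      map_one, Module.End.one_apply]
    abel
  have hN : ∀ v : V, ρ (swap 0 1 * swap 2 3) v = v := by
    intro v
    have e1 := h3 0 1 2 (by decide) (by decide) (by decide) v
    have e2 := h3 0 2 3 (by decide) (by decide) (by decide) v
    have e3 := h3 1 3 2 (by decide) (by decide) (by decide) v
    have e4 := h3 0 3 1 (by decide) (by decide) (by decide) v
    have f2 := h3 0 1 2 (by decide) (by decide) (by decide) (ρ (swap 0 1 * swap 2 3) v)
    have f3 := h3 0 1 2 (by decide) (by decide) (by decide) (ρ (swap 0 2 * swap 1 3) v)
    have f4 := h3 0 1 2 (by decide) (by decide) (by decide) (ρ (swap 0 3 * swap 1 2) v)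
    rw [← hmul, ← hmul] at f2 f3 f4
    rw [show swap (0 : Fin 5) 1 * swap 1 2 * (swap 0 1 * swap 2 3) = swap 0 2 * swap 2 3 by decide,
      show swap (2 : Fin 5) 1 * swap 1 0 * (swap 0 1 * swap 2 3) = swap 2 3 * swap 3 1 by decide]
      at f2
    rw [show swap (0 : Fin 5) 1 * swap 1 2 * (swap 0 2 * swap 1 3) = swap 1 3 * swap 3 2 by decide,
      show swap (2 : Fin 5) 1 * swap 1 0 * (swap 0 2 * swap 1 3) = swap 1 3 * swap 3 0 by decide]
      at f3
    rw [show swap (0 : Fin 5) 1 * swap 1 2 * (swap 0 3 * swap 1 2) = swap 0 3 * swap 3 1 by decide,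
      show swap (2 : Fin 5) 1 * swap 1 0 * (swap 0 3 * swap 1 2) = swap 3 2 * swap 2 0 by decide]
      at f4
    -- The six 3-cycles of A_4 outside ⟨(0 1 2)⟩ occur once in e2 + e3 + e4, along with 3v, and once
    -- in f2 + f3 + f4, along with the images of v under the three double transpositions.
    have hs : (4 : ℂ) • v = v + ρ (swap 0 1 * swap 2 3) v + ρ (swap 0 2 * swap 1 3) v +
        ρ (swap 0 3 * swap 1 2) v := by
      linear_combination (norm := module) e2 + e3 + e4 - f2 - f3 - f4
    have hs2 := congrArg (ρ (swap 0 1 * swap 2 3)) hs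
    rw [map_add, map_add, map_add, map_smul, ← hmul, ← hmul, ← hmul,
      show swap (0 : Fin 5) 1 * swap 2 3 * (swap 0 1 * swap 2 3) = 1 by decide,
      show swap (0 : Fin 5) 1 * swap 2 3 * (swap 0 2 * swap 1 3) = swap 0 3 * swap 1 2 by decide,
      show swap (0 : Fin 5) 1 * swap 2 3 * (swap 0 3 * swap 1 2) = swap 0 2 * swap 1 3 by decide,
      map_one, Module.End.one_apply] at hs2
    have h5 : (4 : ℂ) • (ρ (swap 0 1 * swap 2 3) v - v) = 0 := by
      linear_combination (norm := module) hs2 - hs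
    exact sub_eq_zero.1 ((smul_eq_zero.1 h5).resolve_left (by norm_num))
  have hN2 : ∀ v : V, ρ (swap 0 1 * swap 2 4) v = v := by
    intro v
    rw [show swap (0 : Fin 5) 1 * swap 2 4 = swap 3 4 * ((swap 0 1 * swap 2 3) * swap 3 4) by
      decide, hmul, hmul, hN, ← hmul, swap_mul_self, map_one, Module.End.one_apply]
  refine hv (h0 3 2 4 (by decide) (by decide) (by decide) v ?_)
  rw [show swap (3 : Fin 5) 2 * swap 2 4 = (swap 0 1 * swap 2 3) * (swap 0 1 * swap 2 4) by decide,
    hmul, hN2, hN]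

/-- On a vector u fixed by the 3-cycle, (2 3) and (3 4) agree. So u + (3 4) u is invariant under the
permutations of {2, 3, 4}, and if it vanishes they act on u by the sign. -/
theorem exists_character_three {ρ : Representation ℂ (Perm (Fin 5)) V} {v : V} (hv : v ≠ 0) :
    ∃ u : V, u ≠ 0 ∧ ∃ e : ℂ, (e = 1 ∨ e = -1) ∧ ρ (swap 2 3) u = e • u ∧
      ρ (swap 2 4) u = e • u ∧ ρ (swap 3 4) u = e • u := by
  obtain ⟨u, hu, h⟩ := exists_fixed_threeCycle hv
  have h1 : ρ (swap 3 4) u = ρ (swap 2 3) u := by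
    rw [← apply_apply_of_mul_self (ρ := ρ) (swap_mul_self 2 3) (ρ (swap 3 4) u), h]
  have h24 : ∀ v : V, ρ (swap 2 4) v = ρ (swap 3 4) (ρ (swap 2 3) (ρ (swap 3 4) v)) := fun v => by
    rw [show swap (2 : Fin 5) 4 = swap 3 4 * (swap 2 3 * swap 3 4) by decide, map_mul, map_mul]
    rfl
  by_cases h2 : u + ρ (swap 3 4) u = 0
  · have h3 : ρ (swap 3 4) u = (-1 : ℂ) • u := by
      rw [neg_one_smul]; exact (neg_eq_of_add_eq_zero_right h2).symm
    have h4 : ρ (swap 2 3) u = (-1 : ℂ) • u := by rw [← h1, h3]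
    refine ⟨u, hu, -1, Or.inr rfl, h4, ?_, h3⟩
    rw [h24, h3, map_smul, h4, map_smul, map_smul, h3]
    module
  · have h3 : ρ (swap 3 4) (u + ρ (swap 3 4) u) = u + ρ (swap 3 4) u := by
      rw [map_add, apply_apply_of_mul_self (swap_mul_self 3 4), add_comm]
    have h4 : ρ (swap 2 3) (u + ρ (swap 3 4) u) = u + ρ (swap 3 4) u := by
      rw [map_add, h, ← h1, add_comm]
    refine ⟨_, h2, 1, Or.inl rfl, ?_, ?_, ?_⟩ <;> rw [one_smul]
    · exact h4
    · rw [h24, h3, h4, h3]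
    · exact h3

theorem viaEmbeddingHom_swap {α β : Type*} [DecidableEq α] [DecidableEq β] (f : α ↪ β) (x y : α) :
    Perm.viaEmbeddingHom f (swap x y) = swap (f x) (f y) := by
  ext z
  rw [Perm.viaEmbeddingHom_apply]
  by_cases hz : z ∈ Set.range f
  · obtain ⟨w, rfl⟩ := hz
    rw [Perm.viaEmbedding_apply, f.injective.swap_apply]
  · rw [Perm.viaEmbedding_apply_of_notMem _ _ _ hz, swap_apply_of_ne_of_ne]
    · exact fun h => hz ⟨x, h.symm⟩
    · exact fun h => hz ⟨y, h.symm⟩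

theorem exists_character_three_of_five {α : Type*} [DecidableEq α]
    {ρ : Representation ℂ (Perm α) V} {v : V} (hv : v ≠ 0) {g : Fin 5 → α}
    (hg : Function.Injective g) :
    ∃ u : V, u ≠ 0 ∧ ∃ e : ℂ, (e = 1 ∨ e = -1) ∧ ρ (swap (g 2) (g 3)) u = e • u ∧
      ρ (swap (g 2) (g 4)) u = e • u ∧ ρ (swap (g 3) (g 4)) u = e • u := by
  obtain ⟨u, hu, e, he, h⟩ := exists_character_three
    (ρ := (ρ.comp (Perm.viaEmbeddingHom ⟨g, hg⟩) : Representation ℂ (Perm (Fin 5)) V)) hv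
  have h1 : ∀ x y, (ρ.comp (Perm.viaEmbeddingHom ⟨g, hg⟩) : Representation ℂ (Perm (Fin 5)) V)
      (swap x y) = ρ (swap (g x) (g y)) := fun x y => by
    rw [MonoidHom.comp_apply, viaEmbeddingHom_swap]
    rfl
  rw [h1, h1, h1] at h
  exact ⟨u, hu, e, he, h⟩

end ThreeCycles

/-! ### Symmetric groups of degree at most five -/

section AtMostFive

open Equiv Module

variable {V : Type*} [AddCommGroup V] [Module ℂ V]

theorem negDim_le_of_fixed_pair {n : ℕ} (hn : 3 ≤ n) (hn5 : n ≤ 5)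
    {ρ : Representation ℂ (Perm (Fin n)) V} (hρ : ρ.IsIrreducible) {a b : Fin n} (hab : a ≠ b)
    {v : V} (h0 : v ≠ 0)
    (h : ∀ x y, x ≠ y → x ≠ a → x ≠ b → y ≠ a → y ≠ b → ρ (swap x y) v = v) :
    negDim ρ (swap a b) ≤ 3 := by
  rcases pair_family_cases' (by omega) hρ hab h0 (fixed_two_of_swap h) with
    ⟨⟨e⟩⟩ | ⟨⟨e⟩⟩ | ⟨e, F, he, hF, h1⟩
  · rw [negDim_equiv e, negDim_trivial]; omega
  · rw [negDim_equiv e]; exact (negDim_standardRep_le hab).trans (by decide)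
  · have := hF.negDim_le he hρ h1 hab
    rw [Fintype.card_fin] at this
    omega

theorem one_le_negDim_standardRep {n : ℕ} {a b : Fin n} (hab : a ≠ b) :
    1 ≤ negDim (standardRep n) (swap a b) := by
  refine le_negDim_of_linearIndependent (fun _ : Fin 1 => stdDiff a b)
    (linearIndependent_unique_iff.2 (stdDiff_ne_zero hab)) fun _ => ?_
  rw [standardRep_stdDiff, swap_apply_left, swap_apply_right]
  apply Subtype.ext
  simp [stdDiff]

theorem finrank_eq_one_of_equiv {G : Type*} [Group G] {ρ : Representation ℂ G V}
    {ρ' : Representation ℂ G ℂ} (e : ρ.Equiv ρ') : finrank ℂ V = 1 := by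
  rw [e.toLinearEquiv.finrank_eq, finrank_self]

/-- A vector fixed by the permutations of the points other than a and b gives the bound. For n = 3
any vector works; for n = 4 there is one unless the representation is the sign. For n = 5 a 3-cycle
gives a character of S_3, and if it is the sign the twist is bounded through `posDim`. -/
theorem negDim_le_three_of_le_five [FiniteDimensional ℂ V] {n : ℕ} (hn : 3 ≤ n) (hn5 : n ≤ 5)
    {ρ : Representation ℂ (Perm (Fin n)) V} (hρ : ρ.IsIrreducible) {a b : Fin n} (hab : a ≠ b) :
    negDim ρ (swap a b) ≤ 3 := by
  obtain ⟨v, hv⟩ := exists_ne_zero_of_irreducible hρ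
  obtain rfl | rfl | rfl : n = 3 ∨ n = 4 ∨ n = 5 := by omega
  · refine negDim_le_of_fixed_pair le_rfl (by decide) hρ hab hv fun x y h1 h2 h3 h4 h5 => ?_
    omega
  · rw [negDim_swap_eq hab (show (0 : Fin 4) ≠ 1 by decide)]
    by_cases h : ∃ w, w ≠ 0 ∧ ρ (swap 2 3) w = w
    · obtain ⟨w, h0, hw⟩ := h
      refine negDim_le_of_fixed_pair (by decide) (by decide) hρ (by decide) h0
        fun x y h1 h2 h3 h4 h5 => ?_
      have : (x = 2 ∧ y = 3) ∨ (x = 3 ∧ y = 2) := by omega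
      rcases this with ⟨rfl, rfl⟩ | ⟨rfl, rfl⟩
      · exact hw
      · rw [swap_comm]; exact hw
    · have h1 : ∀ w, ρ (swap 2 3) w = -w := by
        intro w
        by_contra hw
        refine h ⟨w + ρ (swap 2 3) w, fun h => hw (neg_eq_of_add_eq_zero_right h).symm, ?_⟩
        rw [map_add, apply_apply_of_mul_self (swap_mul_self 2 3), add_comm]
      obtain ⟨e⟩ := sign_of_swap hρ hv fun x y hxy =>
        neg_of_forall_neg (show (2 : Fin 4) ≠ 3 by decide) h1 hxy v
      have := negDim_le_finrank ρ (swap 0 1)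
      rw [finrank_eq_one_of_equiv e] at this
      omega
  · rw [negDim_swap_eq hab (show (0 : Fin 5) ≠ 1 by decide)]
    have hcase : ∀ x y : Fin 5, x ≠ y → x ≠ 0 → x ≠ 1 → y ≠ 0 → y ≠ 1 →
        swap x y = swap 2 3 ∨ swap x y = swap 2 4 ∨ swap x y = swap 3 4 := by
      intro x y hxy hx0 hx1 hy0 hy1
      have : (x = 2 ∧ y = 3) ∨ (x = 3 ∧ y = 2) ∨ (x = 2 ∧ y = 4) ∨ (x = 4 ∧ y = 2) ∨
        (x = 3 ∧ y = 4) ∨ (x = 4 ∧ y = 3) := by omega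
      rcases this with ⟨rfl, rfl⟩ | ⟨rfl, rfl⟩ | ⟨rfl, rfl⟩ | ⟨rfl, rfl⟩ | ⟨rfl, rfl⟩ | ⟨rfl, rfl⟩ <;>
        simp [swap_comm]
    obtain ⟨u, hu, e, rfl | rfl, h1, h2, h3⟩ := exists_character_three_of_five hv
      (Function.injective_id (α := Fin 5)) (ρ := ρ)
    · refine negDim_le_of_fixed_pair (by decide) le_rfl hρ (by decide) hu
        fun x y hxy hx0 hx1 hy0 hy1 => ?_
      rw [one_smul] at h1 h2 h3
      rcases hcase x y hxy hx0 hx1 hy0 hy1 with h | h | h <;> rw [h] <;> assumption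
    · rw [← posDim_twist (show (0 : Fin 5) ≠ 1 by decide)]
      rcases pair_family_cases' (by decide) (twist_irreducible hρ) (show (0 : Fin 5) ≠ 1 by decide)
        hu (fixed_two_of_swap (ρ := twist ρ) fun x y hxy hx0 hx1 hy0 hy1 => by
          rw [neg_one_smul] at h1 h2 h3
          rw [twist_swap hxy, neg_eq_iff_eq_neg]
          rcases hcase x y hxy hx0 hx1 hy0 hy1 with h | h | h <;> rw [h] <;> assumption) with
        ⟨⟨e⟩⟩ | ⟨⟨e⟩⟩ | ⟨e, F, he, hF, h4⟩
      · have := finrank_eq_posDim_add_negDim (twist ρ) (swap_mul_self 0 1)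
        rw [finrank_eq_one_of_equiv e] at this
        omega
      · have h4 := finrank_eq_posDim_add_negDim (twist ρ) (swap_mul_self 0 1)
        have h5 := finrank_eq_of_equiv_standard (by decide) e
        rw [negDim_equiv e] at h4
        have := one_le_negDim_standardRep (show (0 : Fin 5) ≠ 1 by decide)
        omega
      · exact hF.posDim_le_three (twist_irreducible hρ) h4 (by decide)

end AtMostFive

/-! ### Families indexed by triples, in degree six -/

section TripleFamilies

open Equiv Module

variable {V : Type*} [AddCommGroup V] [Module ℂ V] {ρ : Representation ℂ (Perm (Fin 6)) V}

/-- No nonzero vector is fixed by the stabilizer of two points. -/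
def NoFixedPair (ρ : Representation ℂ (Perm (Fin 6)) V) : Prop :=
  ∀ a b, a ≠ b → ∀ v, (∀ σ : Perm (Fin 6), σ a = a → σ b = b → ρ σ v = v) → v = 0

/-- An equivariant family of vectors indexed by triples of distinct points, whose partial sums
vanish. -/
structure IsTripleFamily (ρ : Representation ℂ (Perm (Fin 6)) V)
    (F : Fin 6 → Fin 6 → Fin 6 → V) : Prop where
  apply : ∀ σ i j k, ρ σ (F i j k) = F (σ i) (σ j) (σ k)
  diag₁ : ∀ i k, F i i k = 0
  diag₂ : ∀ i j, F i j i = 0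
  diag₃ : ∀ i j, F i j j = 0
  sum₁ : ∀ j k, ∑ i, F i j k = 0
  sum₂ : ∀ i k, ∑ j, F i j k = 0
  sum₃ : ∀ i j, ∑ k, F i j k = 0

/-- A sum over one index is fixed by the stabilizer of the other two, so it vanishes. -/
theorem NoFixedPair.isTripleFamily (h : NoFixedPair ρ) {F : Fin 6 → Fin 6 → Fin 6 → V}
    (hF : ∀ σ i j k, ρ σ (F i j k) = F (σ i) (σ j) (σ k)) (h1 : ∀ i k, F i i k = 0)
    (h2 : ∀ i j, F i j i = 0) (h3 : ∀ i j, F i j j = 0) : IsTripleFamily ρ F where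
  apply := hF
  diag₁ := h1
  diag₂ := h2
  diag₃ := h3
  sum₁ j k := by
    by_cases hjk : j = k
    · exact Finset.sum_eq_zero fun i _ => by rw [hjk, h3]
    · refine h j k hjk _ fun σ hj hk => ?_
      rw [map_sum]
      exact Fintype.sum_equiv σ _ _ fun i => by rw [hF, hj, hk]
  sum₂ i k := by
    by_cases hik : i = k
    · exact Finset.sum_eq_zero fun j _ => by rw [hik, h2]
    · refine h i k hik _ fun σ hi hk => ?_
      rw [map_sum]
      exact Fintype.sum_equiv σ _ _ fun j => by rw [hF, hi, hk]
  sum₃ i j := by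
    by_cases hij : i = j
    · exact Finset.sum_eq_zero fun k _ => by rw [hij, h1]
    · refine h i j hij _ fun σ hi hj => ?_
      rw [map_sum]
      exact Fintype.sum_equiv σ _ _ fun k => by rw [hF, hi, hj]

namespace IsTripleFamily

variable {F : Fin 6 → Fin 6 → Fin 6 → V}

theorem exists_perm_three {i j k i' j' k' : Fin 6} (hij : i ≠ j) (hik : i ≠ k) (hjk : j ≠ k)
    (hij' : i' ≠ j') (hik' : i' ≠ k') (hjk' : j' ≠ k') :
    ∃ σ : Perm (Fin 6), σ i = i' ∧ σ j = j' ∧ σ k = k' := by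
  obtain ⟨σ, hσ⟩ := exists_perm_tuple (f := ![i, j, k]) (g := ![i', j', k'])
    (by intro a b hab; fin_cases a <;> fin_cases b <;> simp_all)
    (by intro a b hab; fin_cases a <;> fin_cases b <;> simp_all)
  exact ⟨σ, hσ 0, hσ 1, hσ 2⟩

theorem ne_zero (hF : IsTripleFamily ρ F) {p q r : Fin 6} (h0 : F p q r ≠ 0) {i j k : Fin 6}
    (hij : i ≠ j) (hik : i ≠ k) (hjk : j ≠ k) : F i j k ≠ 0 := by
  intro h
  apply h0
  by_cases hpq : p = q
  · rw [hpq, hF.diag₁]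
  by_cases hpr : p = r
  · rw [hpr, hF.diag₂]
  by_cases hqr : q = r
  · rw [hqr, hF.diag₃]
  obtain ⟨σ, h1, h2, h3⟩ := exists_perm_three hij hik hjk hpq hpr hqr
  rw [← h1, ← h2, ← h3, ← hF.apply, h, map_zero]

/-- The alternating sum over the faces of {0, 1, 2, 3} changes sign under transpositions of these
points, so it vanishes by the hypothesis on the twist. Adding the versions with 4 and 5 in place of
3, the partial sums leave 6 F_{012} = 0. -/
theorem eq_zero_of_alternating (hF : IsTripleFamily ρ F) (h : NoFixedPair (twist ρ))
    (h1 : ∀ i j k, F j i k = -F i j k) (h2 : ∀ i j k, F i k j = -F i j k) : F 0 1 2 = 0 := by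
  have r1 : ∀ i j k, i < j → F j i k = -F i j k := fun i j k _ => h1 i j k
  have r2 : ∀ i j k, j < k → F i k j = -F i j k := fun i j k _ => h2 i j k
  have hd : F 1 2 3 - F 0 2 3 + F 0 1 3 - F 0 1 2 = 0 := by
    refine h 4 5 (by decide) _ (fixed_two_of_swap fun x y hxy hx4 hx5 hy4 hy5 => ?_)
    rw [twist_swap hxy, neg_eq_iff_eq_neg]
    wlog hlt : x < y generalizing x y
    · rw [swap_comm]
      exact this y x hxy.symm hy4 hy5 hx4 hx5 (lt_of_le_of_ne (not_lt.1 hlt) hxy.symm)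
    have hcase : ∀ x y : Fin 6, x ≠ 4 → x ≠ 5 → y ≠ 4 → y ≠ 5 → x < y →
        (x, y) ∈ ({(0, 1), (0, 2), (0, 3), (1, 2), (1, 3), (2, 3)} : Finset (Fin 6 × Fin 6)) := by
      decide
    have hxy' := hcase x y hx4 hx5 hy4 hy5 hlt
    simp only [Finset.mem_insert, Finset.mem_singleton, Prod.mk.injEq] at hxy'
    clear hcase hlt hxy hx4 hx5 hy4 hy5
    rcases hxy' with ⟨rfl, rfl⟩ | ⟨rfl, rfl⟩ | ⟨rfl, rfl⟩ | ⟨rfl, rfl⟩ | ⟨rfl, rfl⟩ | ⟨rfl, rfl⟩ <;>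
    · simp only [map_add, map_sub, hF.apply, swap_apply_def, Fin.reduceEq, if_true, if_false]
      simp [r1, r2]
      try abel
  have hd4 := congrArg (ρ (swap 3 4)) hd
  have hd5 := congrArg (ρ (swap 3 5)) hd
  simp only [map_add, map_sub, map_zero, hF.apply, swap_apply_def, Fin.reduceEq, if_true,
    if_false] at hd4 hd5
  have s1 := hF.sum₃ 1 2
  have s2 := hF.sum₃ 0 2
  have s3 := hF.sum₃ 0 1
  simp only [Fin.sum_univ_six, hF.diag₂, hF.diag₃] at s1 s2 s3
  have e1 := h2 0 1 2
  have e2 : F 1 2 0 = F 0 1 2 := by rw [h2, h1, neg_neg]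
  have h6 : (6 : ℂ) • F 0 1 2 = 0 := by
    linear_combination (norm := module) s1 - s2 + s3 - hd - hd4 - hd5 - e2 + e1
  exact (smul_eq_zero.1 h6).resolve_left (by norm_num)

/-! #### Symmetric families -/

/-- Let X and Y be the sums of F over the triples with exactly two, respectively one, of their
points in {0, 1, 2}. Pairs inside {0, 1, 2} give 3 F_{012} + X = 0, pairs inside {3, 4, 5} give 3
F_{345} + Y = 0, and mixed pairs give 2X + 2Y = 0. -/
theorem compl_of_symm (hF : IsTripleFamily ρ F) (h1 : ∀ i j k, F j i k = F i j k)
    (h2 : ∀ i j k, F i k j = F i j k) {g : Fin 6 → Fin 6} (hg : Function.Injective g) :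
    F (g 0) (g 1) (g 2) = -F (g 3) (g 4) (g 5) := by
  have key : F 0 1 2 = -F 3 4 5 := by
    have r1 : ∀ i j k, i < j → F j i k = F i j k := fun i j k _ => h1 i j k
    have r2 : ∀ i j k, j < k → F i k j = F i j k := fun i j k _ => h2 i j k
    have s := fun i j => hF.sum₃ i j
    simp only [Fin.sum_univ_six] at s
    have a1 := s 0 1
    have a2 := s 0 2
    have a3 := s 1 2
    have b1 := s 3 4
    have b2 := s 3 5
    have b3 := s 4 5
    have c1 := s 0 3
    have c2 := s 0 4
    have c3 := s 0 5
    have c4 := s 1 3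
    have c5 := s 1 4
    have c6 := s 1 5
    have c7 := s 2 3
    have c8 := s 2 4
    have c9 := s 2 5
    simp [r1, r2, hF.diag₁, hF.diag₃] at a1 a2 a3 b1 b2 b3 c1 c2 c3 c4 c5 c6 c7 c8 c9
    linear_combination (norm := module) (1 / 3 : ℂ) • (a1 + a2 + a3 + b1 + b2 + b3) -
      (1 / 6 : ℂ) • (c1 + c2 + c3 + c4 + c5 + c6 + c7 + c8 + c9)
  obtain ⟨σ, hσ⟩ : ∃ σ : Perm (Fin 6), ∀ i, σ i = g i :=
    exists_perm_tuple (Function.injective_id (α := Fin 6)) hg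
  have h3 := congrArg (ρ σ) key
  rw [map_neg, hF.apply, hF.apply] at h3
  simpa only [hσ] using h3

/-- The antisymmetrization of `F 0 1 2` with respect to `{0, 3}`, `{1, 4}` and `{2, 5}`. -/
def cube (F : Fin 6 → Fin 6 → Fin 6 → V) : V :=
  F 0 1 2 - F 3 1 2 - F 0 4 2 - F 0 1 5 + F 3 4 2 + F 3 1 5 + F 0 4 5 - F 3 4 5

/-- Complementation reduces a vanishing cube to F_{012} = F_{312} + F_{042} + F_{015}. Adding this
for the three cyclic matchings of {0, 1, 2} with {3, 4, 5}, the partial sums give 6 F_{012} = 0. -/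
theorem cube_ne_zero (hF : IsTripleFamily ρ F) (h1 : ∀ i j k, F j i k = F i j k)
    (h2 : ∀ i j k, F i k j = F i j k) (h0 : F 0 1 2 ≠ 0) : cube F ≠ 0 := by
  intro h
  have c1 := hF.compl_of_symm h1 h2 (g := ![3, 4, 2, 0, 1, 5]) (by decide)
  have c2 := hF.compl_of_symm h1 h2 (g := ![3, 1, 5, 0, 4, 2]) (by decide)
  have c3 := hF.compl_of_symm h1 h2 (g := ![0, 4, 5, 3, 1, 2]) (by decide)
  have c4 := hF.compl_of_symm h1 h2 (g := ![3, 4, 5, 0, 1, 2]) (by decide)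
  simp only [Matrix.cons_val] at c1 c2 c3 c4
  rw [cube, c1, c2, c3, c4] at h
  have h3 : F 0 1 2 = F 3 1 2 + F 0 4 2 + F 0 1 5 := by
    have : (2 : ℂ) • (F 0 1 2 - (F 3 1 2 + F 0 4 2 + F 0 1 5)) = 0 := by
      rw [← h]; module
    exact sub_eq_zero.1 ((smul_eq_zero.1 this).resolve_left two_ne_zero)
  have h4 : ∀ g : Fin 6 → Fin 6, Function.Injective g → F (g 0) (g 1) (g 2) =
      F (g 3) (g 1) (g 2) + F (g 0) (g 4) (g 2) + F (g 0) (g 1) (g 5) := by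
    intro g hg
    obtain ⟨σ, hσ⟩ : ∃ σ : Perm (Fin 6), ∀ i, σ i = g i :=
    exists_perm_tuple (Function.injective_id (α := Fin 6)) hg
    have h5 := congrArg (ρ σ) h3
    simp only [map_add, hF.apply] at h5
    simpa only [hσ] using h5
  have d1 := h4 ![0, 1, 2, 4, 5, 3] (by decide)
  have d2 := h4 ![0, 1, 2, 5, 3, 4] (by decide)
  simp only [Matrix.cons_val] at d1 d2
  have s1 := hF.sum₁ 1 2
  have s2 := hF.sum₂ 0 2
  have s3 := hF.sum₃ 0 1
  simp only [Fin.sum_univ_six, hF.diag₁, hF.diag₂, hF.diag₃] at s1 s2 s3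
  have h6 : (6 : ℂ) • F 0 1 2 = 0 := by
    linear_combination (norm := module) h3 + d1 + d2 + s1 + s2 + s3
  exact h0 ((smul_eq_zero.1 h6).resolve_left (by norm_num))

theorem swap_cube (hF : IsTripleFamily ρ F) {x y : Fin 6} (hy : y = ![3, 4, 5, 0, 1, 2] x) :
    ρ (swap x y) (cube F) = -cube F := by
  subst hy
  fin_cases x <;>
  · simp only [cube, map_add, map_sub, hF.apply]
    simp [swap_apply_def]
    abel

theorem swap_of_symm (hF : IsTripleFamily ρ F) (h1 : ∀ i j k, F j i k = F i j k)
    (h2 : ∀ i j k, F i k j = F i j k) {x y : Fin 6} (h : x.val / 3 = y.val / 3) :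
    ρ (swap x y) (F 0 1 2) = F 0 1 2 := by
  have key : ∀ x y : Fin 6, x.val / 3 = y.val / 3 → (swap x y 0, swap x y 1, swap x y 2) ∈
      ({(0, 1, 2), (1, 0, 2), (2, 1, 0), (0, 2, 1)} : Finset (Fin 6 × Fin 6 × Fin 6)) := by decide
  have h3 := key x y h
  simp only [Finset.mem_insert, Finset.mem_singleton, Prod.mk.injEq] at h3
  rw [hF.apply]
  rcases h3 with ⟨e1, e2, e3⟩ | ⟨e1, e2, e3⟩ | ⟨e1, e2, e3⟩ | ⟨e1, e2, e3⟩ <;> rw [e1, e2, e3]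
  · rw [h1]
  · rw [h1, h2, h1]
  · rw [h2]

theorem specht33_of_symm (hρ : ρ.IsIrreducible) (hF : IsTripleFamily ρ F)
    (h1 : ∀ i j k, F j i k = F i j k) (h2 : ∀ i j k, F i k j = F i j k) (h0 : F 0 1 2 ≠ 0) :
    Nonempty (ρ.Equiv (spechtRep 6 shape33)) := by
  have hrow : ∀ x y, rowOf tableau33 x = rowOf tableau33 y → x.val / 3 = y.val / 3 := by decide
  have hcol : ∀ x y, x ≠ y → colOf tableau33 x = colOf tableau33 y →
      y = ![3, 4, 5, 0, 1, 2] x := by decide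
  exact nonempty_equiv_specht tableau33 hρ h0
    (fun x y _ h => hF.swap_of_symm h1 h2 (hrow x y h)) (hF.cube_ne_zero h1 h2 h0)
    (fun x y hxy h => hF.swap_cube (hcol x y hxy h))

theorem specht222_of_symm (hρ : ρ.IsIrreducible) (hF : IsTripleFamily (twist ρ) F)
    (h1 : ∀ i j k, F j i k = F i j k) (h2 : ∀ i j k, F i k j = F i j k) (h0 : F 0 1 2 ≠ 0) :
    Nonempty (ρ.Equiv (spechtRep 6 shape222)) := by
  have hrow : ∀ x y, x ≠ y → rowOf tableau222 x = rowOf tableau222 y →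
      y = ![3, 4, 5, 0, 1, 2] x := by decide
  have hcol : ∀ x y, colOf tableau222 x = colOf tableau222 y → x.val / 3 = y.val / 3 := by decide
  refine nonempty_equiv_specht tableau222 hρ (hF.cube_ne_zero h1 h2 h0)
    (fun x y hxy h => ?_) h0 (fun x y hxy h => ?_)
  · have := hF.swap_cube (hrow x y hxy h)
    rwa [twist_swap hxy, neg_inj] at this
  · have := hF.swap_of_symm h1 h2 (hcol x y h)
    rwa [twist_swap hxy, neg_eq_iff_eq_neg] at this

/-! #### Mixed families -/

theorem ne_of_ne_zero (hF : IsTripleFamily ρ F) (h0 : F 0 1 2 ≠ 0) :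
    ∀ k l, k ≠ 0 → k ≠ 1 → l ≠ 0 → l ≠ 1 → k ≠ l → F 0 1 k ≠ F 0 1 l := by
  intro k l hk hk' hl hl' hkl h
  have h2 : ∀ m n, m ≠ 0 → m ≠ 1 → n ≠ 0 → n ≠ 1 → m ≠ n → F 0 1 m = F 0 1 n := by
    intro m n hm hm' hn hn' hmn
    obtain ⟨σ, hσ⟩ := exists_perm_tuple
      (injective_vec_four (show (0 : Fin 6) ≠ 1 by decide) hk.symm hl.symm hk'.symm hl'.symm hkl)
      (injective_vec_four (show (0 : Fin 6) ≠ 1 by decide) hm.symm hn.symm hm'.symm hn'.symm hmn)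
    have e0 : σ 0 = 0 := hσ 0
    have e1 : σ 1 = 1 := hσ 1
    have e2 : σ k = m := hσ 2
    have e3 : σ l = n := hσ 3
    have := congrArg (ρ σ) h
    rwa [hF.apply, hF.apply, e0, e1, e2, e3] at this
  have s := hF.sum₃ 0 1
  rw [Fin.sum_univ_six, hF.diag₂, hF.diag₃,
    h2 3 2 (by decide) (by decide) (by decide) (by decide) (by decide),
    h2 4 2 (by decide) (by decide) (by decide) (by decide) (by decide),
    h2 5 2 (by decide) (by decide) (by decide) (by decide) (by decide)] at s
  have h4 : (4 : ℂ) • F 0 1 2 = 0 := by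
    linear_combination (norm := module) s
  exact h0 ((smul_eq_zero.1 h4).resolve_left (by norm_num))

/-- F_{012}, F_{013}, F_{014} are independent and negated by (0 1), so they fill its -1-eigenspace.
The vector F_{023} - F_{123} lies there too, and its invariance under (4 5) removes F_{014}. -/
theorem exists_coeff_of_mixed [FiniteDimensional ℂ V] (hF : IsTripleFamily ρ F)
    (h1 : ∀ i j k, F j i k = -F i j k) (h0 : F 0 1 2 ≠ 0) (hm : negDim ρ (swap 0 1) ≤ 3) :
    ∃ b c : ℂ, F 0 2 3 - F 1 2 3 = b • F 0 1 2 + c • F 0 1 3 := by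
  have hne := hF.ne_of_ne_zero h0
  have hli : LinearIndependent ℂ ![F 0 1 2, F 0 1 3, F 0 1 4] := by
    rw [Fintype.linearIndependent_iff]
    intro x hx
    simp only [Fin.sum_univ_three, Matrix.cons_val_zero, Matrix.cons_val_one, Matrix.cons_val]
      at hx
    have t : ∀ k, _ := fun k => congrArg (ρ (swap k 5)) hx
    have t2 := t 2
    have t3 := t 3
    have t4 := t 4
    simp only [map_add, map_smul, map_zero, hF.apply, swap_apply_def, Fin.reduceEq, if_true,
      if_false] at t2 t3 t4
    have e0 : x 0 = 0 := by
      refine (smul_eq_zero.1 ?_).resolve_right (sub_ne_zero.2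
        (hne 2 5 (by decide) (by decide) (by decide) (by decide) (by decide)))
      linear_combination (norm := module) hx - t2
    have e1 : x 1 = 0 := by
      refine (smul_eq_zero.1 ?_).resolve_right (sub_ne_zero.2
        (hne 3 5 (by decide) (by decide) (by decide) (by decide) (by decide)))
      linear_combination (norm := module) hx - t3
    have e2 : x 2 = 0 := by
      refine (smul_eq_zero.1 ?_).resolve_right (sub_ne_zero.2
        (hne 4 5 (by decide) (by decide) (by decide) (by decide) (by decide)))
      linear_combination (norm := module) hx - t4
    intro i
    fin_cases i <;> assumption
  have hle : Submodule.span ℂ (Set.range ![F 0 1 2, F 0 1 3, F 0 1 4]) ≤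
      LinearMap.ker (ρ (swap 0 1) + 1) := by
    rw [Submodule.span_le]
    rintro _ ⟨i, rfl⟩
    rw [SetLike.mem_coe, mem_ker_add_one]
    fin_cases i <;> simp [hF.apply, swap_apply_def, h1 0 1]
  have heq := Submodule.eq_of_le_of_finrank_le hle (by
    rw [finrank_span_eq_card hli, Fintype.card_fin]
    exact hm)
  have hw : F 0 2 3 - F 1 2 3 ∈ LinearMap.ker (ρ (swap 0 1) + 1) := by
    rw [mem_ker_add_one]
    simp [hF.apply, swap_apply_def]
  rw [← heq, Submodule.mem_span_range_iff_exists_fun] at hw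
  obtain ⟨c, hc⟩ := hw
  simp only [Fin.sum_univ_three, Matrix.cons_val_zero, Matrix.cons_val_one, Matrix.cons_val] at hc
  have t := congrArg (ρ (swap 4 5)) hc
  simp only [map_add, map_sub, map_smul, hF.apply, swap_apply_def, Fin.reduceEq, if_true,
    if_false] at t
  have e2 : c 2 = 0 := by
    refine (smul_eq_zero.1 ?_).resolve_right (sub_ne_zero.2
      (hne 4 5 (by decide) (by decide) (by decide) (by decide) (by decide)))
    linear_combination (norm := module) hc - t
  exact ⟨c 0, c 1, by rw [← hc, e2, zero_smul, add_zero]⟩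

theorem negDim_of_mixed [FiniteDimensional ℂ V] (hF : IsTripleFamily ρ F)
    (h1 : ∀ i j k, F j i k = -F i j k) (h2 : ∀ i j k, F i j k + F j k i + F k i j = 0)
    (h0 : F 0 1 2 ≠ 0) : 4 ≤ negDim ρ (swap 0 1) := by
  by_contra! hm
  obtain ⟨b, c, hbc⟩ := hF.exists_coeff_of_mixed h1 h0 (by omega)
  have E : ∀ i j k l, Function.Injective ![i, j, k, l] →
      F i k l - F j k l = b • F i j k + c • F i j l := by
    intro i j k l hi
    obtain ⟨σ, hσ⟩ := exists_perm_tuple (f := ![(0 : Fin 6), 1, 2, 3]) (by decide) hi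
    have e0 : σ 0 = i := hσ 0
    have e1 : σ 1 = j := hσ 1
    have e2 : σ 2 = k := hσ 2
    have e3 : σ 3 = l := hσ 3
    have := congrArg (ρ σ) hbc
    simpa only [map_sub, map_add, map_smul, hF.apply, e0, e1, e2, e3] using this
  have s1 := hF.sum₃ 0 1
  have s2 := hF.sum₃ 0 2
  have s3 := hF.sum₃ 1 2
  have s4 := hF.sum₂ 0 2
  have s5 := hF.sum₂ 1 2
  simp only [Fin.sum_univ_six, hF.diag₁, hF.diag₂, hF.diag₃] at s1 s2 s3 s4 s5
  -- Summing E over the free index k = 3, 4, 5, in the last place here and in the third place for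
  -- e2, the partial sums leave a multiple of F_{012}. The two equations determine b and c.
  have e1 : 3 * b - c + 1 = 0 := by
    refine (smul_eq_zero.1 (?_ : (3 * b - c + 1) • F 0 1 2 = 0)).resolve_right h0
    linear_combination (norm := module) -(E 0 1 2 3 (by decide)) - E 0 1 2 4 (by decide) -
      E 0 1 2 5 (by decide) + s2 - s3 - c • s1 + h2 0 1 2 - h1 0 2 1
  have e2 : -b + 3 * c + 2 = 0 := by
    refine (smul_eq_zero.1 (?_ : (-b + 3 * c + 2) • F 0 1 2 = 0)).resolve_right h0
    linear_combination (norm := module) -(E 0 1 3 2 (by decide)) - E 0 1 4 2 (by decide) -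
      E 0 1 5 2 (by decide) + s4 - s5 - b • s1 + h1 0 1 2
  have hb : b = -5 / 8 := by linear_combination (3 / 8 : ℂ) * e1 + (1 / 8 : ℂ) * e2
  have hc : c = -7 / 8 := by linear_combination (1 / 8 : ℂ) * e1 + (3 / 8 : ℂ) * e2
  -- In the cyclic sum of E over 0, 1, 2 the b-terms cancel by `h2`. Then F_{013} is proportional to
  -- F_{012}, and applying (2 3) makes the square of the ratio 1, which the values of b and c
  -- contradict.
  have hT : F 0 1 3 + F 1 2 3 + F 2 0 3 = 0 := by
    have : (2 + c) • (F 0 1 3 + F 1 2 3 + F 2 0 3) = 0 := by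
      linear_combination (norm := module) -(E 0 1 2 3 (by decide)) - E 1 2 0 3 (by decide) -
        E 2 0 1 3 (by decide) - b • h2 0 1 2 + h1 2 0 3 + h1 0 1 3 + h1 1 2 3
    refine (smul_eq_zero.1 this).resolve_left ?_
    rw [hc]; norm_num
  have h3 : (1 - c) • F 0 1 3 = b • F 0 1 2 := by
    linear_combination (norm := module) E 0 1 2 3 (by decide) + hT - h1 2 0 3
  have h4 := congrArg (ρ (swap 2 3)) h3
  simp only [map_smul, hF.apply, swap_apply_def, Fin.reduceEq, if_true, if_false] at h4
  have h5 : ((1 - c) * (1 - c) - b * b) • F 0 1 2 = 0 := by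
    linear_combination (norm := module) (1 - c) • h4 + b • h3
  refine h0 ((smul_eq_zero.1 h5).resolve_left ?_)
  rw [hb, hc]; norm_num

/-- Transport the cyclic relation to 0, 1, k with last index 2 and add over k = 3, 4, 5: by the
partial sums each of the two variable terms contributes one more F_{012}, so that 5 F_{012} = 0. -/
theorem eq_zero_of_mixed (hF : IsTripleFamily ρ F) (h1 : ∀ i j k, F j i k = -F i j k)
    (hT : F 3 4 0 + F 4 5 0 + F 5 3 0 = 0) : F 0 1 2 = 0 := by
  have E : ∀ i j k l, Function.Injective ![i, j, k, l] → F i j l + F j k l + F k i l = 0 := by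
    intro i j k l hi
    obtain ⟨σ, hσ⟩ := exists_perm_tuple (f := ![(3 : Fin 6), 4, 5, 0]) (by decide) hi
    have e0 : σ 3 = i := hσ 0
    have e1 : σ 4 = j := hσ 1
    have e2 : σ 5 = k := hσ 2
    have e3 : σ 0 = l := hσ 3
    have := congrArg (ρ σ) hT
    simpa only [map_add, map_zero, hF.apply, e0, e1, e2, e3] using this
  have s4 := hF.sum₂ 0 2
  have s5 := hF.sum₂ 1 2
  simp only [Fin.sum_univ_six, hF.diag₁, hF.diag₃] at s4 s5
  have h5 : (5 : ℂ) • F 0 1 2 = 0 := by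
    linear_combination (norm := module) E 0 1 3 2 (by decide) + E 0 1 4 2 (by decide) +
      E 0 1 5 2 (by decide) + s4 - s5 + h1 0 1 2 - h1 0 3 2 - h1 0 4 2 - h1 0 5 2
  exact (smul_eq_zero.1 h5).resolve_left (by norm_num)

end IsTripleFamily

/-- Decomposition under permutation of the indices. A nonzero symmetrization is the first case, and
the antisymmetrization vanishes by `eq_zero_of_alternating`. If both vanish, so do the cyclic sums.
Then one of two antisymmetrizations in a pair of indices is nonzero, since otherwise F would be
symmetric with 3F = 0. -/
theorem triple_family_cases (hp : NoFixedPair ρ) (hm : NoFixedPair (twist ρ)) {u : V} (hu : u ≠ 0)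
    (h : ∀ σ : Perm (Fin 6), σ 0 = 0 → σ 1 = 1 → σ 2 = 2 → ρ σ u = u) :
    (∃ F, IsTripleFamily ρ F ∧ F 0 1 2 ≠ 0 ∧ (∀ i j k, F j i k = F i j k) ∧
      ∀ i j k, F i k j = F i j k) ∨
    ∃ F, IsTripleFamily ρ F ∧ F 0 1 2 ≠ 0 ∧ (∀ i j k, F j i k = -F i j k) ∧
      ∀ i j k, F i j k + F j k i + F k i j = 0 := by
  obtain ⟨F, h0, hF, d1, d2, d3⟩ := exists_family_three (show (0 : Fin 6) ≠ 1 by decide)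
    (show (0 : Fin 6) ≠ 2 by decide) (show (1 : Fin 6) ≠ 2 by decide) h
  have hFt := hp.isTripleFamily hF d1 d2 d3
  by_cases hS : ∀ i j k, F i j k + F j k i + F k i j + (F j i k + F i k j + F k j i) = 0
  swap
  · push Not at hS
    obtain ⟨i, j, k, hS⟩ := hS
    have hG := hp.isTripleFamily (F := fun i j k => F i j k + F j k i + F k i j +
      (F j i k + F i k j + F k j i)) (fun σ i j k => by simp only [map_add, hF])
      (fun i k => by simp [d1, d2, d3]) (fun i k => by simp [d1, d2, d3])
      (fun i k => by simp [d1, d2, d3])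
    refine Or.inl ⟨_, hG, hG.ne_zero hS (by decide) (by decide) (by decide), fun i j k => ?_,
      fun i j k => ?_⟩ <;> abel
  have hA : ∀ i j k, F i j k + F j k i + F k i j - (F j i k + F i k j + F k j i) = 0 := by
    have hG := hp.isTripleFamily (F := fun i j k => F i j k + F j k i + F k i j -
      (F j i k + F i k j + F k j i)) (fun σ i j k => by simp only [map_add, map_sub, hF])
      (fun i k => by simp [d1, d2, d3]) (fun i k => by simp [d1, d2, d3])
      (fun i k => by simp [d1, d2, d3])
    have h3 := hG.eq_zero_of_alternating hm (fun i j k => by abel)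
      (fun i j k => by abel)
    intro i j k
    by_contra h4
    exact hG.ne_zero (p := i) (q := j) (r := k) h4 (by decide) (by decide) (by decide) h3
  have hcyc : ∀ i j k, F i j k + F j k i + F k i j = 0 := by
    intro i j k
    have : (2 : ℂ) • (F i j k + F j k i + F k i j) = 0 := by
      linear_combination (norm := module) hS i j k + hA i j k
    exact (smul_eq_zero.1 this).resolve_left two_ne_zero
  right
  by_cases h1 : ∀ i j k, F i j k - F j i k = 0
  swap
  · push Not at h1
    obtain ⟨i, j, k, h1⟩ := h1
    have hG := hp.isTripleFamily (F := fun i j k => F i j k - F j i k)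
      (fun σ i j k => by simp only [map_sub, hF])
      (fun i k => by simp [d1]) (fun i k => by simp [d2, d3])
      (fun i k => by simp [d2, d3])
    refine ⟨_, hG, hG.ne_zero h1 (by decide) (by decide) (by decide), fun i j k => ?_,
      fun i j k => ?_⟩
    · abel
    · linear_combination (norm := module) hcyc i j k - hcyc j i k
  have hG := hp.isTripleFamily (F := fun i j k => F i k j - F j k i)
    (fun σ i j k => by simp only [map_sub, hF])
    (fun i k => by simp [d2]) (fun i k => by simp [d1, d3])
    (fun i k => by simp [d1, d3])
  refine ⟨_, hG, fun h2 => ?_, fun i j k => ?_, fun i j k => ?_⟩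
  · have h3 : ∀ i j k, F i k j - F j k i = 0 := fun i j k => by
      by_contra h4
      exact hG.ne_zero (p := i) (q := j) (r := k) h4 (by decide) (by decide) (by decide) h2
    have h4 : (3 : ℂ) • F 0 1 2 = 0 := by
      linear_combination (norm := module) hcyc 0 1 2 - (2 : ℂ) • (h1 1 2 0 + h3 2 0 1) -
        h1 2 0 1 - h3 0 1 2
    exact hu (h0 ▸ (smul_eq_zero.1 h4).resolve_left three_ne_zero)
  · abel
  · linear_combination (norm := module) hcyc i k j - hcyc j k i

end TripleFamilies

/-! ### Representations of the symmetric group of degree six -/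

section DegreeSix

open Equiv Module

variable {V : Type*} [AddCommGroup V] [Module ℂ V] {ρ : Representation ℂ (Perm (Fin 6)) V}

theorem fixed_three_of_swap {u : V} (h34 : ρ (swap 3 4) u = u) (h35 : ρ (swap 3 5) u = u)
    (h45 : ρ (swap 4 5) u = u) (σ : Perm (Fin 6)) (h0 : σ 0 = 0) (h1 : σ 1 = 1) (h2 : σ 2 = 2) :
    ρ σ u = u := by
  have key : ∀ x y : Fin 6, 3 ≤ x → 3 ≤ y → x ≠ y →
      swap x y = swap 3 4 ∨ swap x y = swap 3 5 ∨ swap x y = swap 4 5 := by decide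
  refine fixed_of_swap (p := fun x => 3 ≤ x) (fun x y hx hy hxy => ?_) σ fun x hx => ?_
  · rcases key x y hx hy hxy with h | h | h <;> rw [h] <;> assumption
  · obtain rfl | rfl | rfl : x = 0 ∨ x = 1 ∨ x = 2 := by omega
    all_goals assumption

/-- Vectors fixed by the stabilizer of two points, in ρ or in its twist, are treated by pair
families. Without them, a 3-cycle provides a triple family for ρ or its twist. The symmetric ones
are (3,3) and (2,2,2), and the mixed ones are excluded. -/
theorem cases_of_negDim_le_three_of_six [FiniteDimensional ℂ V] (hρ : ρ.IsIrreducible)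
    {a b : Fin 6} (hab : a ≠ b) (h : negDim ρ (swap a b) ≤ 3) :
    Nonempty (ρ.Equiv (Representation.trivial ℂ (Perm (Fin 6)) ℂ)) ∨
      Nonempty (ρ.Equiv (signRep 6)) ∨ Nonempty (ρ.Equiv (standardRep 6)) ∨
      Nonempty (ρ.Equiv (spechtRep 6 shape33)) ∨ Nonempty (ρ.Equiv (spechtRep 6 shape222)) ∨
      Nonempty (ρ.Equiv (spechtRep 6 shape42)) := by
  by_cases hp : NoFixedPair ρ
  swap
  · rw [NoFixedPair] at hp
    push Not at hp
    obtain ⟨x, y, hxy, v, hv, h0⟩ := hp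
    rcases pair_family_cases' (by decide) hρ hxy h0 hv with h1 | h1 | ⟨e, F, rfl | rfl, hF, h1⟩
    · exact Or.inl h1
    · exact Or.inr (Or.inr (Or.inl h1))
    · exact Or.inr (Or.inr (Or.inr (Or.inr (Or.inr (specht42_of_symm hρ hF h1)))))
    · have := hF.four_le_negDim (by simp) h1 hab
      omega
  by_cases hm : NoFixedPair (twist ρ)
  swap
  · rw [NoFixedPair] at hm
    push Not at hm
    obtain ⟨x, y, hxy, v, hv, h0⟩ := hm
    rcases pair_family_cases' (by decide) (twist_irreducible hρ) hxy h0 hv with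
      h1 | ⟨⟨h1⟩⟩ | ⟨e, F, he, hF, h1⟩
    · exact Or.inr (Or.inl (sign_of_twist_trivial hρ h1))
    · have := le_posDim_of_equiv_standard (by decide) h1 hab
      rw [posDim_twist hab] at this
      omega
    · have := hF.four_le_posDim he (by simp) h1 hab
      rw [posDim_twist hab] at this
      omega
  have hm' : NoFixedPair (twist (twist ρ)) := by rwa [twist_twist]
  by_cases hu : ∃ u : V, u ≠ 0 ∧ ∀ σ : Perm (Fin 6), σ 0 = 0 → σ 1 = 1 → σ 2 = 2 → ρ σ u = u
  · obtain ⟨u, hu, h1⟩ := hu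
    rcases triple_family_cases hp hm hu h1 with ⟨F, hF, h0, h1, h2⟩ | ⟨F, hF, h0, h1, h2⟩
    · exact Or.inr (Or.inr (Or.inr (Or.inl (hF.specht33_of_symm hρ h1 h2 h0))))
    · have := hF.negDim_of_mixed h1 h2 h0
      rw [negDim_swap_eq hab (show (0 : Fin 6) ≠ 1 by decide)] at h
      omega
  obtain ⟨v, hv⟩ := exists_ne_zero_of_irreducible hρ
  obtain ⟨u, hu0, e, rfl | rfl, h34, h35, h45⟩ := exists_character_three_of_five (ρ := ρ) hv
    (g := ![0, 1, 3, 4, 5]) (by decide)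
  · simp only [one_smul] at h34 h35 h45
    exact absurd ⟨u, hu0, fixed_three_of_swap h34 h35 h45⟩ hu
  simp only [neg_smul, one_smul] at h34 h35 h45
  have hfix := fixed_three_of_swap (ρ := twist ρ) (u := u)
    (by rw [twist_swap (by decide), neg_eq_iff_eq_neg]; exact h34)
    (by rw [twist_swap (by decide), neg_eq_iff_eq_neg]; exact h35)
    (by rw [twist_swap (by decide), neg_eq_iff_eq_neg]; exact h45)
  rcases triple_family_cases hm hm' hu0 hfix with ⟨F, hF, h0, h1, h2⟩ | ⟨F, hF, h0, h1, h2⟩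
  · exact Or.inr (Or.inr (Or.inr (Or.inr (Or.inl
      (IsTripleFamily.specht222_of_symm hρ hF h1 h2 h0)))))
  -- In the twist, this cyclic sum is negated by the transpositions of {3, 4, 5}. If nonzero it
  -- would be a vector fixed by them in ρ, which `hu` excludes.
  refine absurd (hF.eq_zero_of_mixed h1 ?_) h0
  by_contra hT
  refine hu ⟨_, hT, fixed_three_of_swap ?_ ?_ ?_⟩
  all_goals
    rw [← neg_inj, ← twist_swap (by decide)]
    simp only [map_add, hF.apply, swap_apply_def, Fin.reduceEq, if_true, if_false]
    linear_combination (norm := module) h1 3 4 0 + h1 4 5 0 + h1 5 3 0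

theorem forall_of_symm {P : Fin 6 → Fin 6 → Fin 6 → Prop} (h1 : ∀ i j k, P i j k → P j i k)
    (h2 : ∀ i j k, P i j k → P i k j) (hd : ∀ i k, P i i k) (h01 : ∀ k, P 0 1 k)
    (hP : ∀ i j k, j ≠ 0 → j ≠ 1 → k ≠ 0 → k ≠ 1 → P i j k) (i j k : Fin 6) : P i j k := by
  have h3 : ∀ i : Fin 6, i = 0 ∨ i = 1 ∨ i ≠ 0 ∧ i ≠ 1 := by decide
  rcases h3 j with rfl | rfl | ⟨hj, hj'⟩
  · rcases h3 i with rfl | rfl | ⟨hi, hi'⟩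
    · exact hd _ _
    · exact h1 _ _ _ (h01 _)
    · rcases h3 k with rfl | rfl | ⟨hk, hk'⟩
      · exact h1 _ _ _ (h2 _ _ _ (hd _ _))
      · exact h1 _ _ _ (h2 _ _ _ (h01 _))
      · exact h1 _ _ _ (hP _ _ _ hi hi' hk hk')
  · rcases h3 i with rfl | rfl | ⟨hi, hi'⟩
    · exact h01 _
    · exact hd _ _
    · rcases h3 k with rfl | rfl | ⟨hk, hk'⟩
      · exact h1 _ _ _ (h2 _ _ _ (h1 _ _ _ (h01 _)))
      · exact h1 _ _ _ (h2 _ _ _ (hd _ _))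
      · exact h1 _ _ _ (hP _ _ _ hi hi' hk hk')
  · rcases h3 i with rfl | rfl | ⟨hi, hi'⟩
    · rcases h3 k with rfl | rfl | ⟨hk, hk'⟩
      · exact h2 _ _ _ (hd _ _)
      · exact h2 _ _ _ (h01 _)
      · exact hP _ _ _ hj hj' hk hk'
    · rcases h3 k with rfl | rfl | ⟨hk, hk'⟩
      · exact h2 _ _ _ (h1 _ _ _ (h01 _))
      · exact h2 _ _ _ (hd _ _)
      · exact hP _ _ _ hj hj' hk hk'
    · rcases h3 k with rfl | rfl | ⟨hk, hk'⟩
      · exact h2 _ _ _ (h1 _ _ _ (hP _ _ _ hi hi' hj hj'))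
      · exact h2 _ _ _ (h1 _ _ _ (hP _ _ _ hi hi' hj hj'))
      · exact hP _ _ _ hj hj' hk hk'

namespace IsTripleFamily

variable {F : Fin 6 → Fin 6 → Fin 6 → V}

theorem span_eq_top (hF : IsTripleFamily ρ F) (hρ : ρ.IsIrreducible) (h0 : F 0 1 2 ≠ 0) :
    Submodule.span ℂ (Set.range fun x : Fin 6 × Fin 6 × Fin 6 => F x.1 x.2.1 x.2.2) = ⊤ :=
  span_eq_top_of_irreducible hρ _ (fun σ v hv => by
    obtain ⟨x, rfl⟩ := hv
    exact Submodule.subset_span ⟨(σ x.1, σ x.2.1, σ x.2.2), (hF.apply σ _ _ _).symm⟩)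
    ⟨(0, 1, 2), rfl⟩ h0

/-- Put z_{jk} = F_{0jk} - F_{1jk} for j, k in {2, 3, 4, 5}. These six vectors span the image of 1 -
(0 1), and ∑_k z_{jk} = 0 for each j. Solving for z_{34}, z_{35}, z_{45}, whence the factors 1/2,
leaves three generators. -/
theorem negDim_le_of_symm (hF : IsTripleFamily ρ F) (hρ : ρ.IsIrreducible)
    (h1 : ∀ i j k, F j i k = F i j k) (h2 : ∀ i j k, F i k j = F i j k) (h0 : F 0 1 2 ≠ 0)
    {x y : Fin 6} (hxy : x ≠ y) : negDim ρ (swap x y) ≤ 3 := by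
  rw [negDim_swap_eq hxy (show (0 : Fin 6) ≠ 1 by decide)]
  refine (negDim_le_of_span (ρ := ρ) (hF.span_eq_top hρ h0) (g := swap 0 1)
    ![F 0 2 3 - F 1 2 3, F 0 2 4 - F 1 2 4, F 0 2 5 - F 1 2 5] ?_).trans_eq (Fintype.card_fin 3)
  set U := Submodule.span ℂ
    (Set.range ![F 0 2 3 - F 1 2 3, F 0 2 4 - F 1 2 4, F 0 2 5 - F 1 2 5])
  have m3 : F 0 2 3 - F 1 2 3 ∈ U := Submodule.subset_span ⟨0, rfl⟩
  have m4 : F 0 2 4 - F 1 2 4 ∈ U := Submodule.subset_span ⟨1, rfl⟩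
  have m5 : F 0 2 5 - F 1 2 5 ∈ U := Submodule.subset_span ⟨2, rfl⟩
  have s : ∀ j, F 0 j 2 - F 1 j 2 + (F 0 j 3 - F 1 j 3) + (F 0 j 4 - F 1 j 4) +
      (F 0 j 5 - F 1 j 5) = 0 := by
    intro j
    have a1 := hF.sum₃ 0 j
    have a2 := hF.sum₃ 1 j
    simp only [Fin.sum_univ_six, hF.diag₂] at a1 a2
    have a3 : F 0 j 1 = F 1 j 0 := by rw [← h1, h2, h1]
    linear_combination (norm := module) a1 - a2 - a3
  have hz : ∀ j k, j ≠ 0 → j ≠ 1 → k ≠ 0 → k ≠ 1 → F 0 j k - F 1 j k ∈ U := by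
    have r1 := h2 0 2 3
    have r2 := h2 0 2 4
    have r3 := h2 0 2 5
    have r4 := h2 0 3 4
    have r5 := h2 0 3 5
    have r6 := h2 0 4 5
    have t1 := h2 1 2 3
    have t2 := h2 1 2 4
    have t3 := h2 1 2 5
    have t4 := h2 1 3 4
    have t5 := h2 1 3 5
    have t6 := h2 1 4 5
    have s3 := s 3
    have s4 := s 4
    have s5 := s 5
    simp only [r1, r2, r3, r4, r5, r6, t1, t2, t3, t4, t5, t6, hF.diag₃] at s3 s4 s5
    have m34 : F 0 3 4 - F 1 3 4 ∈ U := by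
      convert U.smul_mem (1 / 2 : ℂ) (U.sub_mem (U.sub_mem m5 m4) m3) using 1
      linear_combination (norm := module) (1 / 2 : ℂ) • (s3 + s4 - s5)
    have m35 : F 0 3 5 - F 1 3 5 ∈ U := by
      convert U.smul_mem (1 / 2 : ℂ) (U.sub_mem (U.sub_mem m4 m5) m3) using 1
      linear_combination (norm := module) (1 / 2 : ℂ) • (s3 + s5 - s4)
    have m45 : F 0 4 5 - F 1 4 5 ∈ U := by
      convert U.smul_mem (1 / 2 : ℂ) (U.sub_mem (U.sub_mem m3 m5) m4) using 1
      linear_combination (norm := module) (1 / 2 : ℂ) • (s5 + s4 - s3)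
    intro j k hj hj' hk hk'
    by_cases hjk : j = k
    · rw [hjk, hF.diag₃, hF.diag₃, sub_zero]; exact U.zero_mem
    wlog hlt : j < k generalizing j k
    · rw [h2 0 k j, h2 1 k j]
      exact this k j hk hk' hj hj' (Ne.symm hjk) (lt_of_le_of_ne (not_lt.1 hlt) (Ne.symm hjk))
    have hcase : ∀ x y : Fin 6, x ≠ 0 → x ≠ 1 → y ≠ 0 → y ≠ 1 → x < y →
        (x, y) ∈ ({(2, 3), (2, 4), (2, 5), (3, 4), (3, 5), (4, 5)} : Finset (Fin 6 × Fin 6)) := by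
      decide
    have h := hcase j k hj hj' hk hk' hlt
    simp only [Finset.mem_insert, Finset.mem_singleton, Prod.mk.injEq] at h
    clear hcase hlt hjk hj hj' hk hk'
    rcases h with ⟨rfl, rfl⟩ | ⟨rfl, rfl⟩ | ⟨rfl, rfl⟩ | ⟨rfl, rfl⟩ | ⟨rfl, rfl⟩ | ⟨rfl, rfl⟩ <;>
      assumption
  rintro _ ⟨⟨i, j, k⟩, rfl⟩
  refine forall_of_symm (P := fun i j k => F i j k - ρ (swap 0 1) (F i j k) ∈ U)
    (fun i j k h => by rwa [h1]) (fun i j k h => by rwa [h2]) (fun i k => ?_) (fun k => ?_)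
    (fun i j k hj hj' hk hk' => ?_) i j k
  · rw [hF.diag₁, map_zero, sub_zero]; exact U.zero_mem
  · by_cases hk : k = 0
    · rw [hk, hF.diag₂, map_zero, sub_zero]; exact U.zero_mem
    by_cases hk' : k = 1
    · rw [hk', hF.diag₃, map_zero, sub_zero]; exact U.zero_mem
    rw [hF.apply, swap_apply_left, swap_apply_right, swap_apply_of_ne_of_ne hk hk', h1 0 1,
      sub_self]
    exact U.zero_mem
  · rw [hF.apply, swap_apply_of_ne_of_ne hj hj', swap_apply_of_ne_of_ne hk hk']
    by_cases hi : i = 0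
    · rw [hi, swap_apply_left]; exact hz j k hj hj' hk hk'
    by_cases hi' : i = 1
    · rw [hi', swap_apply_right, ← neg_sub]; exact U.neg_mem (hz j k hj hj' hk hk')
    rw [swap_apply_of_ne_of_ne hi hi', sub_self]
    exact U.zero_mem

/-- The F_{01k} span the image of 1 + (0 1): a triple avoiding 0 and 1 has a complement {0, 1, l},
so `compl_of_symm` applies. The zero sum of the four F_{01k} removes one. -/
theorem posDim_le_of_symm (hF : IsTripleFamily ρ F) (hρ : ρ.IsIrreducible)
    (h1 : ∀ i j k, F j i k = F i j k) (h2 : ∀ i j k, F i k j = F i j k) (h0 : F 0 1 2 ≠ 0)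
    {x y : Fin 6} (hxy : x ≠ y) : posDim ρ (swap x y) ≤ 3 := by
  rw [posDim_swap_eq hxy (show (0 : Fin 6) ≠ 1 by decide)]
  refine (posDim_le_of_span (ρ := ρ) (hF.span_eq_top hρ h0) (g := swap 0 1)
    ![F 0 1 2, F 0 1 3, F 0 1 4] ?_).trans_eq (Fintype.card_fin 3)
  set U := Submodule.span ℂ (Set.range ![F 0 1 2, F 0 1 3, F 0 1 4])
  have m2 : F 0 1 2 ∈ U := Submodule.subset_span ⟨0, rfl⟩
  have m3 : F 0 1 3 ∈ U := Submodule.subset_span ⟨1, rfl⟩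
  have m4 : F 0 1 4 ∈ U := Submodule.subset_span ⟨2, rfl⟩
  have s := hF.sum₃ 0 1
  simp only [Fin.sum_univ_six, hF.diag₂, hF.diag₃, zero_add] at s
  have m5 : F 0 1 5 ∈ U := by
    rw [← neg_eq_of_add_eq_zero_right s]
    exact U.neg_mem (U.add_mem (U.add_mem m2 m3) m4)
  have m : ∀ k, F 0 1 k ∈ U := by
    intro k
    fin_cases k
    · exact (hF.diag₂ 0 1).symm ▸ U.zero_mem
    · exact (hF.diag₃ 0 1).symm ▸ U.zero_mem
    all_goals assumption
  have hz : ∀ i j k, i ≠ 0 → i ≠ 1 → j ≠ 0 → j ≠ 1 → k ≠ 0 → k ≠ 1 → F i j k ∈ U := by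
    intro i j k hi hi' hj hj' hk hk'
    by_cases hij : i = j
    · rw [hij, hF.diag₁]; exact U.zero_mem
    by_cases hik : i = k
    · rw [hik, hF.diag₂]; exact U.zero_mem
    by_cases hjk : j = k
    · rw [hjk, hF.diag₃]; exact U.zero_mem
    have hl : ∀ i j k : Fin 6, i ≠ 0 → i ≠ 1 → j ≠ 0 → j ≠ 1 → k ≠ 0 → k ≠ 1 → i ≠ j → i ≠ k →
        j ≠ k → ∃ l, Function.Injective ![i, j, k, 0, 1, l] := by
      intro i j k hi hi' hj hj' hk hk' hij hik hjk
      obtain ⟨l, hl⟩ : ∃ l, l ∉ ({i, j, k, 0, 1} : Finset (Fin 6)) := by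
        by_contra! h
        have h3 := Finset.card_le_card (fun x _ => h x : Finset.univ ⊆ _)
        have h4 := Finset.card_le_five (a := i) (b := j) (c := k) (d := 0) (e := (1 : Fin 6))
        simp only [Finset.card_univ, Fintype.card_fin] at h3
        omega
      refine ⟨l, fun x y hxy => ?_⟩
      simp only [Finset.mem_insert, Finset.mem_singleton, not_or] at hl
      fin_cases x <;> fin_cases y <;> simp_all [eq_comm]
    obtain ⟨l, hl⟩ := hl i j k hi hi' hj hj' hk hk' hij hik hjk
    have := hF.compl_of_symm h1 h2 hl
    simp only [Matrix.cons_val] at this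
    rw [this]
    exact U.neg_mem (m l)
  rintro _ ⟨⟨i, j, k⟩, rfl⟩
  refine forall_of_symm (P := fun i j k => F i j k + ρ (swap 0 1) (F i j k) ∈ U)
    (fun i j k h => by rwa [h1]) (fun i j k h => by rwa [h2]) (fun i k => ?_) (fun k => ?_)
    (fun i j k hj hj' hk hk' => ?_) i j k
  · rw [hF.diag₁, map_zero, add_zero]; exact U.zero_mem
  · rw [hF.apply, swap_apply_left, swap_apply_right, h1 0 1]
    exact U.add_mem (m _) (m _)
  · rw [hF.apply, swap_apply_of_ne_of_ne hj hj', swap_apply_of_ne_of_ne hk hk']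
    have hs : F 0 j k + F 1 j k ∈ U := by
      have s := hF.sum₁ j k
      rw [← Finset.sum_add_sum_compl {0, 1}, Finset.sum_pair (by decide)] at s
      rw [eq_neg_of_add_eq_zero_left s]
      refine U.neg_mem (U.sum_mem fun i hi => ?_)
      simp only [Finset.mem_compl, Finset.mem_insert, Finset.mem_singleton, not_or] at hi
      exact hz i j k hi.1 hi.2 hj hj' hk hk'
    by_cases hi : i = 0
    · rw [hi, swap_apply_left]; exact hs
    by_cases hi' : i = 1
    · rw [hi', swap_apply_right, add_comm]; exact hs
    rw [swap_apply_of_ne_of_ne hi hi']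
    exact U.add_mem (hz i j k hi hi' hj hj' hk hk') (hz i j k hi hi' hj hj' hk hk')

end IsTripleFamily

theorem exists_symm_triple {u : V}
    (h : ∀ x y : Fin 6, x ≠ y → x.val / 3 = y.val / 3 → ρ (swap x y) u = u) :
    ∃ F : Fin 6 → Fin 6 → Fin 6 → V, F 0 1 2 = u ∧
      (∀ σ i j k, ρ σ (F i j k) = F (σ i) (σ j) (σ k)) ∧
      (∀ i k, F i i k = 0) ∧ (∀ i j, F i j i = 0) ∧ (∀ i j, F i j j = 0) ∧
      (∀ i j k, F j i k = F i j k) ∧ ∀ i j k, F i k j = F i j k := by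
  obtain ⟨F, h0, hF, d1, d2, d3⟩ := exists_family_three (ρ := ρ) (v := u)
    (show (0 : Fin 6) ≠ 1 by decide)
    (show (0 : Fin 6) ≠ 2 by decide) (show (1 : Fin 6) ≠ 2 by decide)
    (fixed_three_of_swap (h 3 4 (by decide) (by decide)) (h 3 5 (by decide) (by decide))
      (h 4 5 (by decide) (by decide)))
  have e1 : F 1 0 2 = F 0 1 2 := by
    have := h 0 1 (by decide) (by decide)
    rwa [← h0, hF] at this
  have e2 : F 0 2 1 = F 0 1 2 := by
    have := h 1 2 (by decide) (by decide)
    rwa [← h0, hF] at this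
  refine ⟨F, h0, hF, d1, d2, d3, fun i j k => ?_, fun i j k => ?_⟩
  all_goals
    by_cases hij : i = j
    · subst hij; simp only [d1, d2]
    by_cases hik : i = k
    · subst hik; simp only [d1, d2, d3]
    by_cases hjk : j = k
    · subst hjk; simp only [d2, d3]
    obtain ⟨σ, h1, h2, h3⟩ := IsTripleFamily.exists_perm_three (show (0 : Fin 6) ≠ 1 by decide)
      (show (0 : Fin 6) ≠ 2 by decide) (show (1 : Fin 6) ≠ 2 by decide) hij hik hjk
    rw [← h1, ← h2, ← h3, ← hF, ← hF]
    congr 1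

theorem isTripleFamily_of_symm {F : Fin 6 → Fin 6 → Fin 6 → V}
    (hF : ∀ σ i j k, ρ σ (F i j k) = F (σ i) (σ j) (σ k)) (d1 : ∀ i k, F i i k = 0)
    (d2 : ∀ i j, F i j i = 0) (d3 : ∀ i j, F i j j = 0) (h1 : ∀ i j k, F j i k = F i j k)
    (h2 : ∀ i j k, F i k j = F i j k) (hs : ∀ i j, i ≠ j → ∑ k, F i j k = 0) :
    IsTripleFamily ρ F := by
  have h3 : ∀ i j, ∑ k, F i j k = 0 := fun i j => by
    by_cases hij : i = j
    · exact Finset.sum_eq_zero fun k _ => by rw [hij, d1]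
    · exact hs i j hij
  refine ⟨hF, d1, d2, d3, fun j k => ?_, fun i k => ?_, h3⟩
  · rw [← h3 j k]
    exact Finset.sum_congr rfl fun i _ => by rw [← h1, ← h2]
  · rw [← h3 i k]
    exact Finset.sum_congr rfl fun j _ => by rw [← h2]

theorem apply_partial_sum {F : Fin 6 → Fin 6 → Fin 6 → V}
    (hF : ∀ σ i j k, ρ σ (F i j k) = F (σ i) (σ j) (σ k)) (σ : Perm (Fin 6)) (i j : Fin 6) :
    ρ σ (∑ k, F i j k) = ∑ k, F (σ i) (σ j) k := by
  rw [map_sum]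
  exact Fintype.sum_equiv σ _ _ fun k => hF σ i j k

/-- If the partial sums do not vanish, a nonzero one starts a symmetric pair family, which gives the
same bound 6 - 3. -/
theorem negDim_le_three_of_fixed (hρ : ρ.IsIrreducible) {w : V} (hw0 : w ≠ 0)
    (h : ∀ x y : Fin 6, x ≠ y → x.val / 3 = y.val / 3 → ρ (swap x y) w = w)
    {x y : Fin 6} (hxy : x ≠ y) : negDim ρ (swap x y) ≤ 3 := by
  obtain ⟨F, h0, hF, d1, d2, d3, h1, h2⟩ := exists_symm_triple h
  by_cases hs : ∀ i j, i ≠ j → ∑ k, F i j k = 0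
  · exact (isTripleFamily_of_symm hF d1 d2 d3 h1 h2 hs).negDim_le_of_symm hρ h1 h2
      (h0 ▸ hw0) hxy
  push Not at hs
  obtain ⟨i, j, hij, hs⟩ := hs
  rcases pair_family_cases (e := 1) (by decide) hρ hij
    (v := ∑ k, F i j k) (fun σ hi hj => by rw [apply_partial_sum hF, hi, hj])
    (by
      rw [apply_partial_sum hF, swap_apply_left, swap_apply_right, one_smul]
      exact Finset.sum_congr rfl fun k _ => h1 i j k) with ⟨⟨e⟩⟩ | ⟨⟨e⟩⟩ | ⟨F', hF', h3⟩
  · rw [negDim_equiv e, negDim_trivial]; omega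
  · rw [negDim_equiv e]; exact (negDim_standardRep_le hxy).trans (by omega)
  · have := hF'.negDim_le_of_symm hρ (h3 ▸ hs) hxy (by simp)
    simpa using this

theorem negDim_le_three_of_anti (hρ : ρ.IsIrreducible) {w : V} (hw0 : w ≠ 0)
    (h : ∀ x y : Fin 6, x ≠ y → x.val / 3 = y.val / 3 → ρ (swap x y) w = -w)
    (hv : ∀ a b, a ≠ b → ∀ v, (∀ x y, x ≠ y → x ≠ a → x ≠ b → y ≠ a → y ≠ b →
      ρ (swap x y) v = -v) → v = 0) {x y : Fin 6} (hxy : x ≠ y) : negDim ρ (swap x y) ≤ 3 := by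
  obtain ⟨F, h0, hF, d1, d2, d3, h1, h2⟩ := exists_symm_triple (ρ := twist ρ)
    fun x y hxy h' => by rw [twist_swap hxy, h x y hxy h', neg_neg]
  have hs : ∀ i j, i ≠ j → ∑ k, F i j k = 0 := fun i j hij =>
    hv i j hij _ fun x y hxy hxi hxj hyi hyj => by
      rw [← neg_eq_iff_eq_neg, ← twist_swap hxy, apply_partial_sum hF,
        swap_apply_of_ne_of_ne hxi.symm hyi.symm, swap_apply_of_ne_of_ne hxj.symm hyj.symm]
  rw [← posDim_twist hxy]
  exact (isTripleFamily_of_symm hF d1 d2 d3 h1 h2 hs).posDim_le_of_symm (twist_irreducible hρ) h1 h2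
    (h0 ▸ hw0) hxy

theorem negDim_specht33_le {x y : Fin 6} (hxy : x ≠ y) :
    negDim (V := (spechtSub 6 shape33).toSubmodule) (spechtRep 6 shape33) (swap x y) ≤ 3 := by
  obtain ⟨w, hw0, hw⟩ := exists_row_fixed tableau33
  have hrow : ∀ x y : Fin 6, x.val / 3 = y.val / 3 → rowOf tableau33 x = rowOf tableau33 y := by
    decide
  exact negDim_le_three_of_fixed (spechtRep_irreducible tableau33) hw0
    (fun x y _ h => hw _ (apply_swap_of_eq (hrow x y h))) hxy

theorem specht222_apply_eq_zero {v : (Fin 6 → ℕ) →₀ ℂ}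
    (hv : v ∈ (spechtSub 6 shape222).toSubmodule) {f : Fin 6 → ℕ} {i : Fin 6} (hf : 3 ≤ f i) :
    v f = 0 := by
  have hle : (spechtSub 6 shape222).toSubmodule ≤ LinearMap.ker (Finsupp.lapply (R := ℂ) f) := by
    refine Submodule.span_le.2 ?_
    rintro _ ⟨t, rfl⟩
    change polytabloid t f = 0
    rw [polytabloid, Finsupp.finsetSum_apply]
    refine Finset.sum_eq_zero fun q _ => ?_
    rw [Finsupp.smul_apply, tabloidRep_apply, Finsupp.single_apply, if_neg, smul_zero]
    intro h
    have h1 := congrFun h (q.1⁻¹ i)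
    have h2 : ∀ c ∈ shape222.cells, c.1 < 3 := by decide
    have h3 := h2 _ (t (q.1⁻¹ i)).2
    rw [Function.comp_apply, show q.1 (q.1⁻¹ i) = i from q.1.apply_symm_apply i] at h1
    omega
  exact hle hv

theorem specht222_eq_zero {v : (spechtSub 6 shape222).toSubmodule} {a b : Fin 6} (hab : a ≠ b)
    (h : ∀ x y, x ≠ y → x ≠ a → x ≠ b → y ≠ a → y ≠ b →
      spechtRep 6 shape222 (swap x y) v = -v) : v = 0 := by
  apply Subtype.ext
  ext f
  rw [Submodule.coe_zero, Finsupp.zero_apply]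
  by_cases hf : ∃ i, 3 ≤ f i
  · obtain ⟨i, hi⟩ := hf
    exact specht222_apply_eq_zero v.2 hi
  push Not at hf
  obtain ⟨x, hx, y, hy, hxy, hfxy⟩ := Finset.exists_ne_map_eq_of_card_lt_of_maps_to
    (s := ({a, b} : Finset (Fin 6))ᶜ) (t := Finset.range 3) (f := f)
    (by rw [Finset.card_compl, Finset.card_pair hab]; simp) (fun i _ => by simpa using hf i)
  simp only [Finset.mem_compl, Finset.mem_insert, Finset.mem_singleton, not_or] at hx hy
  have h1 := congrArg (fun w : (spechtSub 6 shape222).toSubmodule => (w : (Fin 6 → ℕ) →₀ ℂ) f)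
    (h x y hxy hx.1 hx.2 hy.1 hy.2)
  simp only [spechtRep_apply_coe, tabloidRep_apply, Submodule.coe_neg, Finsupp.neg_apply] at h1
  rw [show f ∘ swap x y = f from funext fun i => apply_swap_of_eq hfxy i] at h1
  exact eq_zero_of_eq_neg h1

theorem negDim_specht222_le {x y : Fin 6} (hxy : x ≠ y) :
    negDim (V := (spechtSub 6 shape222).toSubmodule) (spechtRep 6 shape222) (swap x y) ≤ 3 := by
  have hcol : ∀ x y : Fin 6, x.val / 3 = y.val / 3 →
      colOf tableau222 x = colOf tableau222 y := by decide
  exact negDim_le_three_of_anti (spechtRep_irreducible tableau222)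
    (w := ⟨polytabloid tableau222, polytabloid_mem _⟩)
    (fun h => polytabloid_ne_zero tableau222 (congrArg Subtype.val h))
    (fun x y hxy h => spechtRep_swap_polytabloid tableau222 hxy (hcol x y h))
    (fun a b hab v h => specht222_eq_zero hab h) hxy

end DegreeSix

/-! ### Classification by the multiplicity of `-1` for a transposition -/

section Classification

open Equiv Module

variable {V : Type*} [AddCommGroup V] [Module ℂ V]

theorem negDim_eq_zero_of_fixed {G : Type*} [Group G] {ρ : Representation ℂ G V} {g : G}
    (h : ∀ v, ρ g v = v) : negDim ρ g = 0 := by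
  have : LinearMap.ker (ρ g + 1) = ⊥ := by
    rw [Submodule.eq_bot_iff]
    intro x hx
    rw [mem_ker_add_one, h] at hx
    exact eq_zero_of_eq_neg hx
  rw [negDim, this, finrank_bot]

variable [FiniteDimensional ℂ V]

theorem negDim_signRep_le {m : ℕ} {τ : Representation ℂ (Perm (Fin m)) V}
    (e : τ.Equiv (signRep m)) (g : Perm (Fin m)) : negDim τ g ≤ 1 :=
  (negDim_le_finrank τ g).trans_eq (finrank_eq_one_of_equiv e)

theorem negDim_le_one_iff {m : ℕ} (hm : 3 ≤ m) {τ : Representation ℂ (Perm (Fin m)) V}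
    (hτ : τ.IsIrreducible) {a b : Fin m} (hab : a ≠ b) :
    negDim τ (swap a b) ≤ 1 ↔
      Nonempty (τ.Equiv (Representation.trivial ℂ (Perm (Fin m)) ℂ)) ∨
      Nonempty (τ.Equiv (signRep m)) ∨ Nonempty (τ.Equiv (standardRep m)) ∨
      (m = 4 ∧ Nonempty (τ.Equiv (spechtRep m shape22))) := by
  refine ⟨cases_of_negDim_le_one hm hτ hab, ?_⟩
  rintro (⟨⟨e⟩⟩ | ⟨⟨e⟩⟩ | ⟨⟨e⟩⟩ | ⟨rfl, ⟨e⟩⟩)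
  · rw [negDim_equiv e, negDim_trivial]; exact Nat.zero_le _
  · exact negDim_signRep_le e _
  · rw [negDim_equiv e]; exact negDim_standardRep_le hab
  · rw [negDim_equiv (V' := (spechtSub 4 shape22).toSubmodule) e]
    exact negDim_specht22_le hab

theorem negDim_le_three_iff {m : ℕ} (hm : 3 ≤ m) {τ : Representation ℂ (Perm (Fin m)) V}
    (hτ : τ.IsIrreducible) {a b : Fin m} (hab : a ≠ b) :
    negDim τ (swap a b) ≤ 3 ↔
      Nonempty (τ.Equiv (Representation.trivial ℂ (Perm (Fin m)) ℂ)) ∨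
      Nonempty (τ.Equiv (signRep m)) ∨ Nonempty (τ.Equiv (standardRep m)) ∨ m ≤ 5 ∨
      (m = 6 ∧ (Nonempty (τ.Equiv (spechtRep m shape33)) ∨
        Nonempty (τ.Equiv (spechtRep m shape222)) ∨
        Nonempty (τ.Equiv (spechtRep m shape42)))) := by
  constructor
  · intro h
    by_cases h5 : m ≤ 5
    · exact Or.inr (Or.inr (Or.inr (Or.inl h5)))
    by_cases h6 : m = 6
    · subst h6
      rcases cases_of_negDim_le_three_of_six hτ hab h with h | h | h | h | h | h <;>
        simp only [h, true_or, or_true, and_self]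
    · rcases cases_of_negDim_le_three_of_seven_le (by omega) hτ hab h with h | h | h <;>
        simp only [h, true_or, or_true]
  · rintro (⟨⟨e⟩⟩ | ⟨⟨e⟩⟩ | ⟨⟨e⟩⟩ | h5 | ⟨rfl, ⟨⟨e⟩⟩ | ⟨⟨e⟩⟩ | ⟨⟨e⟩⟩⟩)
    · rw [negDim_equiv e, negDim_trivial]; exact Nat.zero_le _
    · exact (negDim_signRep_le e _).trans (by omega)
    · rw [negDim_equiv e]; exact (negDim_standardRep_le hab).trans (by omega)
    · exact negDim_le_three_of_le_five hm h5 hτ hab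
    · rw [negDim_equiv (V' := (spechtSub 6 shape33).toSubmodule) e]
      exact negDim_specht33_le hab
    · rw [negDim_equiv (V' := (spechtSub 6 shape222).toSubmodule) e]
      exact negDim_specht222_le hab
    · rw [negDim_equiv (V' := (spechtSub 6 shape42).toSubmodule) e]
      exact negDim_specht42_le hab

end Classification

/-! ### Representations of the product of the factors -/

section Factors

open Equiv Module

variable {d : ℕ} {n : Fin d → ℕ} {W : Type*} [AddCommGroup W] [Module ℂ W]
  {ρ : Representation ℂ (YoungGroup n) W}

theorem apply_eq_smul_of_mulSingle (c : YoungGroup n →* ℂˣ)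
    (h : ∀ k σ v, ρ (Pi.mulSingle k σ) v = (c (Pi.mulSingle k σ) : ℂ) • v) (g : YoungGroup n)
    (v : W) : ρ g v = (c g : ℂ) • v := by
  let f : YoungGroup n →* Module.End ℂ W :=
    ((algebraMap ℂ (Module.End ℂ W) : ℂ →+* Module.End ℂ W) : ℂ →* Module.End ℂ W).comp
      ((Units.coeHom ℂ).comp c)
  have hf : ∀ g v, f g v = (c g : ℂ) • v := fun g v => by
    simp [f, Module.algebraMap_end_apply]
  have h1 : g ∈ MonoidHom.eqLocus (ρ : YoungGroup n →* Module.End ℂ W) f :=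
    Subgroup.pi_mem_of_mulSingle_mem g fun k => LinearMap.ext fun v => by rw [hf]; exact h k _ v
  rw [← hf]
  exact LinearMap.congr_fun h1 v

/-- The restriction of `ρ` to a factor. -/
def factorRep (ρ : Representation ℂ (YoungGroup n) W) (j : Fin d) :
    Representation ℂ (Perm (Fin (n j))) W :=
  ρ.comp (MonoidHom.mulSingle (fun i : Fin d => Perm (Fin (n i))) j)

theorem factorRep_apply (j : Fin d) (σ : Perm (Fin (n j))) (v : W) :
    factorRep ρ j σ v = ρ (Pi.mulSingle j σ) v := rfl

theorem negDim_factorRep {j : Fin d} {x y : Fin (n j)} (hxy : x ≠ y) :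
    negDim (factorRep ρ j) (swap x y) = factorNeg ρ j := negDim_mulSingle_swap ρ j hxy

theorem factorNeg_le_finrank [FiniteDimensional ℂ W] (j : Fin d) :
    factorNeg ρ j ≤ finrank ℂ W := by
  rw [factorNeg]
  split_ifs
  · exact negDim_le_finrank ρ _
  · exact Nat.zero_le _

theorem factorNeg_eq_zero_of_fixed [FiniteDimensional ℂ W] {j : Fin d}
    (h : ∀ σ v, ρ (Pi.mulSingle j σ) v = v) : factorNeg ρ j = 0 := by
  rw [factorNeg]
  split_ifs
  · exact negDim_eq_zero_of_fixed (h _)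
  · rfl

theorem fixed_of_factorNeg_eq_zero [FiniteDimensional ℂ W] {j : Fin d} (h : factorNeg ρ j = 0)
    (σ : Perm (Fin (n j))) (v : W) : ρ (Pi.mulSingle j σ) v = v := by
  rw [← factorRep_apply]
  refine fixed_all_of_swap (fun x y hxy => ?_) σ
  exact fixed_of_negDim_eq_zero (swap_mul_self x y) (by rwa [negDim_factorRep hxy]) v

theorem isTrivialRep_of_factorNeg [FiniteDimensional ℂ W] (hρ : ρ.IsIrreducible)
    (h : ∀ j, factorNeg ρ j = 0) : IsTrivialRep ρ :=
  nonempty_equiv_of_scalar hρ _ fun g v => by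
    rw [apply_eq_smul_of_mulSingle 1 (fun k σ v => by
      rw [fixed_of_factorNeg_eq_zero (h k)]; simp) g v]
    simp

theorem isSign_of_factorNeg [FiniteDimensional ℂ W] (hρ : ρ.IsIrreducible) {k : Fin d}
    (h1 : finrank ℂ W = 1) (hk : factorNeg ρ k = 1) (h : ∀ j, j ≠ k → factorNeg ρ j = 0) :
    IsSign ρ k := by
  have hneg : ∀ (x y : Fin (n k)), x ≠ y → ∀ v, ρ (Pi.mulSingle k (swap x y)) v = -v := by
    intro x y hxy v
    have h2 : LinearMap.ker (ρ (Pi.mulSingle k (swap x y)) + 1) = ⊤ :=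
      Submodule.eq_top_of_finrank_eq ((negDim_mulSingle_swap ρ k hxy).trans (hk.trans h1.symm))
    rw [← mem_ker_add_one, h2]
    trivial
  let c : YoungGroup n →* ℂˣ := (Units.map (Int.castRingHom ℂ : ℤ →* ℂ)).comp
    (Perm.sign.comp (Pi.evalMonoidHom (fun i : Fin d => Perm (Fin (n i))) k))
  have hc : ∀ g, (c g : ℂ) = ((Perm.sign (g k) : ℤ) : ℂ) := fun g => rfl
  refine nonempty_equiv_of_scalar hρ _ fun g v => ?_
  rw [apply_eq_smul_of_mulSingle c (fun l σ v => ?_) g v, hc]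
  · simp [signRep]
  · rw [hc]
    by_cases hl : l = k
    · subst hl
      have h3 := fixed_all_of_swap (ρ := twist (factorRep ρ l)) (v := v) (fun x y hxy => by
        rw [twist_swap hxy, factorRep_apply, hneg x y hxy, neg_neg]) σ
      rw [twist_apply, factorRep_apply] at h3
      conv_rhs => rw [← h3, smul_smul, Pi.mulSingle_eq_same, sign_mul_sign, one_smul]
    · rw [fixed_of_factorNeg_eq_zero (h l hl), Pi.mulSingle_eq_of_ne (Ne.symm hl)]
      simp

theorem IsTrivialRep.finrank_eq_one (h : IsTrivialRep ρ) : finrank ℂ W = 1 :=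
  let ⟨e⟩ := h
  finrank_eq_one_of_equiv e

theorem IsTrivialRep.factorNeg_eq_zero [FiniteDimensional ℂ W] (h : IsTrivialRep ρ) (j : Fin d) :
    factorNeg ρ j = 0 := by
  obtain ⟨e⟩ := h
  obtain ⟨f, hf⟩ := exists_linearEquiv e
  exact factorNeg_eq_zero_of_fixed fun σ v => f.injective (by rw [hf]; simp)

theorem IsFactorRep.factorNeg_eq_zero [FiniteDimensional ℂ W] {U : Type*} [AddCommGroup U]
    [Module ℂ U] {k : Fin d} {σ : Representation ℂ (Perm (Fin (n k))) U} (h : IsFactorRep ρ k σ)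
    {j : Fin d} (hj : j ≠ k) : factorNeg ρ j = 0 := by
  obtain ⟨e⟩ := h
  obtain ⟨f, hf⟩ := exists_linearEquiv e
  refine factorNeg_eq_zero_of_fixed fun τ v => f.injective ?_
  rw [hf, MonoidHom.comp_apply, Pi.evalMonoidHom_apply, Pi.mulSingle_eq_of_ne (Ne.symm hj), map_one,
    Module.End.one_apply]

theorem IsFactorRep.finrank_eq {U : Type*} [AddCommGroup U]
    [Module ℂ U] {k : Fin d} {σ : Representation ℂ (Perm (Fin (n k))) U} (h : IsFactorRep ρ k σ) :
    finrank ℂ W = finrank ℂ U :=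
  let ⟨e⟩ := h
  e.toLinearEquiv.finrank_eq

theorem finrank_eq_factorNeg_or [FiniteDimensional ℂ W] (hρ : ρ.IsIrreducible) {k : Fin d}
    (hk : n k = 2) : finrank ℂ W = factorNeg ρ k ∨ factorNeg ρ k = 0 := by
  have hcomm : ∀ m, m = 2 → ∀ σ τ : Perm (Fin m), σ * τ = τ * σ := by
    rintro _ rfl
    decide
  have h01 : (⟨0, by omega⟩ : Fin (n k)) ≠ ⟨1, by omega⟩ := by simp
  rw [← negDim_mulSingle_swap ρ k h01]
  set s : YoungGroup n := Pi.mulSingle k (swap ⟨0, by omega⟩ ⟨1, by omega⟩)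
  have hs : ∀ g, g * s = s * g := by
    intro g
    funext i
    by_cases hi : i = k
    · subst hi; exact hcomm _ hk _ _
    · simp [s, Pi.mulSingle_eq_of_ne hi]
  by_cases h0 : LinearMap.ker (ρ s + 1) = ⊥
  · right
    rw [negDim, h0, finrank_bot]
  · left
    obtain ⟨v, hv, hv0⟩ := (Submodule.ne_bot_iff _).1 h0
    have := eq_top_of_irreducible hρ _ (fun g x hx => ?_) hv hv0
    · rw [negDim, this, finrank_top]
    · rw [mem_ker_add_one] at hx ⊢
      rw [← Module.End.mul_apply, ← map_mul, ← hs, map_mul, Module.End.mul_apply, hx, map_neg]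

section Single

variable {j : Fin d}

theorem mulSingle_eval (h : ∀ i, i ≠ j → n i = 0) (g : YoungGroup n) :
    Pi.mulSingle j (g j) = g := by
  funext i
  by_cases hi : i = j
  · subst hi; rw [Pi.mulSingle_eq_same]
  · rw [Pi.mulSingle_eq_of_ne hi]
    refine Perm.ext fun x => ?_
    have h0 := h i hi
    exact absurd x.2 (by omega)

theorem isFactorRep_iff (h : ∀ i, i ≠ j → n i = 0) {U : Type*} [AddCommGroup U] [Module ℂ U]
    (σ : Representation ℂ (Perm (Fin (n j))) U) :
    IsFactorRep ρ j σ ↔ Nonempty ((factorRep ρ j).Equiv σ) := by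
  constructor
  · rintro ⟨e⟩
    obtain ⟨f, hf⟩ := exists_linearEquiv e
    refine ⟨Representation.Equiv.mk f fun g => LinearMap.ext fun v => ?_⟩
    have := hf (Pi.mulSingle j g) v
    rw [MonoidHom.comp_apply, Pi.evalMonoidHom_apply, Pi.mulSingle_eq_same] at this
    exact this
  · rintro ⟨e⟩
    obtain ⟨f, hf⟩ := exists_linearEquiv e
    refine ⟨Representation.Equiv.mk f fun g => LinearMap.ext fun v => ?_⟩
    have := hf (g j) v
    rw [factorRep_apply, mulSingle_eval h] at this
    exact this

theorem isTrivialRep_iff (h : ∀ i, i ≠ j → n i = 0) :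
    IsTrivialRep ρ ↔
      Nonempty ((factorRep ρ j).Equiv (Representation.trivial ℂ (Perm (Fin (n j))) ℂ)) :=
  isFactorRep_iff h (Representation.trivial ℂ (Perm (Fin (n j))) ℂ)

theorem factorRep_irreducible (h : ∀ i, i ≠ j → n i = 0) (hρ : ρ.IsIrreducible) :
    (factorRep ρ j).IsIrreducible := by
  obtain ⟨v, hv⟩ := exists_ne_zero_of_irreducible hρ
  refine isIrreducible_of_forall hv fun p hp h0 => ?_
  obtain ⟨w, hw, hw0⟩ := (Submodule.ne_bot_iff _).1 h0
  refine eq_top_of_irreducible hρ p (fun g x hx => ?_) hw hw0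
  rw [← mulSingle_eval h g]
  exact hp _ x hx

end Single

end Factors

/-! ### Shapes and dimensions -/

section Shapes

open scoped Nat
open Module

theorem add_le_choose {p q : ℕ} (hp : 1 ≤ p) (hq : 1 ≤ q) : p + q ≤ (p + q).choose p := by
  obtain ⟨p, rfl⟩ := Nat.exists_eq_add_of_le' hp
  induction q, hq using Nat.le_induction with
  | base => rw [Nat.choose_succ_self_right]
  | succ q hq ih =>
    rw [← add_assoc, Nat.choose_succ_succ']
    have : 1 ≤ (p + 1 + q).choose p := Nat.choose_pos (by omega)
    omega

theorem factorial_add_eq (a b : ℕ) : (a + b)! = (a + b).choose a * (a ! * b !) := by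
  rw [← Nat.add_choose_mul_factorial_mul_factorial, Nat.choose_symm_add, mul_assoc]

theorem eq_of_two_blocks {a b r D x y m : ℕ} (ha : 1 ≤ a) (hb : 1 ≤ b) (hr : a + b = r)
    (h : m * (a ! * b !) = (r - 2)! * (a * b * D + a * (a - 1) * x + b * (b - 1) * y)) (hD : 1 ≤ D)
    (hm : m ≤ 3) : a = 1 ∨ b = 1 ∨ a = 2 ∧ b = 2 ∨ a = 2 ∧ b = 3 ∨ a = 3 ∧ b = 2 := by
  obtain ⟨a, rfl⟩ := Nat.exists_eq_add_of_le' ha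
  obtain ⟨b, rfl⟩ := Nat.exists_eq_add_of_le' hb
  subst hr
  have h1 : a + 1 + (b + 1) - 2 = a + b := by omega
  have hpos : 0 < (a + 1)! * (b + 1)! := by positivity
  have h2 : (a + b).choose a * ((a + 1)! * (b + 1)!) ≤ m * ((a + 1)! * (b + 1)!) := by
    rw [h, h1, factorial_add_eq a b, Nat.factorial_succ, Nat.factorial_succ]
    calc _ = (a + b).choose a * (a ! * b !) * ((a + 1) * (b + 1) * 1) := by ring
      _ ≤ _ := by
        refine Nat.mul_le_mul le_rfl ?_
        have := Nat.mul_le_mul (le_refl ((a + 1) * (b + 1))) hD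
        omega
  have h3 := Nat.le_of_mul_le_mul_right h2 hpos
  by_cases ha0 : a = 0
  · exact Or.inl (by omega)
  by_cases hb0 : b = 0
  · exact Or.inr (Or.inl (by omega))
  have := add_le_choose (p := a) (q := b) (by omega) (by omega)
  omega

theorem four_le_of_three_blocks {a b c r P m N : ℕ} (ha : 1 ≤ a) (hb : 1 ≤ b) (hc : 1 ≤ c)
    (hr : a + b + c = r) (hr4 : 4 ≤ r) (hP0 : 0 < P) (hP : P ≤ a ! * b ! * c !)
    (hN : 2 * (a * b + c * (a + b)) ≤ N) (h : 2 * m * P = (r - 2)! * N) : 4 ≤ m := by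
  suffices hle : 4 * (a ! * b ! * c !) ≤ (r - 2)! * (a * b + c * (a + b)) by
    have h1 := Nat.mul_le_mul (le_refl (r - 2)!) hN
    have h2 := Nat.mul_le_mul (le_refl 8) hP
    refine Nat.le_of_mul_le_mul_right (c := P) ?_ hP0
    nlinarith
  · by_cases hs : a + b = 2
    · obtain rfl : a = 1 := by omega
      obtain rfl : b = 1 := by omega
      have h1 : r - 2 = c := by omega
      rw [h1, Nat.factorial_one, one_mul, one_mul, mul_comm]
      exact Nat.mul_le_mul le_rfl (by omega)
    obtain ⟨a, rfl⟩ := Nat.exists_eq_add_of_le' ha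
    obtain ⟨b, rfl⟩ := Nat.exists_eq_add_of_le' hb
    obtain ⟨c, rfl⟩ := Nat.exists_eq_add_of_le' hc
    have h1 : r - 2 = a + b + 1 + c := by omega
    have h2 := Nat.le_of_dvd (Nat.factorial_pos _)
      (Nat.factorial_mul_factorial_dvd_factorial_add (a + b + 1) c)
    have h3 : (a + b)! * (c + 1)! ≤ (a + b + 1 + c)! := by
      have := Nat.le_of_dvd (Nat.factorial_pos _)
        (Nat.factorial_mul_factorial_dvd_factorial_add (a + b) (c + 1))
      rwa [show a + b + (c + 1) = a + b + 1 + c by ring] at this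
    have h4 := Nat.le_of_dvd (Nat.factorial_pos _)
      (Nat.factorial_mul_factorial_dvd_factorial_add a b)
    have h5 := add_le_choose (p := a + 1) (q := b + 1) (by omega) (by omega)
    have h6 := factorial_add_eq (a + 1) (b + 1)
    have h7 : 3 * ((a + 1)! * (b + 1)!) ≤ (a + 1 + (b + 1)) * (a + b + 1)! := by
      have h8 : (a + 1 + (b + 1))! = (a + 1 + (b + 1)) * (a + b + 1)! := by
        rw [show a + 1 + (b + 1) = a + b + 1 + 1 by ring, Nat.factorial_succ]
      rw [← h8, h6]
      exact Nat.mul_le_mul (by omega) le_rfl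
    rw [h1, mul_add]
    calc 4 * ((a + 1)! * (b + 1)! * (c + 1)!)
        = (a ! * b !) * (c + 1)! * ((a + 1) * (b + 1)) +
          3 * ((a + 1)! * (b + 1)!) * (c !) * (c + 1) := by
          simp only [Nat.factorial_succ]; ring
      _ ≤ (a + b)! * (c + 1)! * ((a + 1) * (b + 1)) +
          (a + 1 + (b + 1)) * (a + b + 1)! * (c !) * (c + 1) := by gcongr
      _ = (a + b)! * (c + 1)! * ((a + 1) * (b + 1)) +
          ((a + b + 1)! * c !) * ((c + 1) * (a + 1 + (b + 1))) := by ring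
      _ ≤ _ := by gcongr

theorem shape_cases {d r : ℕ} (hr : r ≠ 0) {n : Fin d → ℕ} (hn : ∑ j, n j = r) :
    (∃ j, n = Pi.single j r) ∨
    (∃ j k a b, j < k ∧ 1 ≤ a ∧ 1 ≤ b ∧ a + b = r ∧ n = Pi.single j a + Pi.single k b) ∨
    ∃ i j k, i < j ∧ j < k ∧ 1 ≤ n i ∧ 1 ≤ n j ∧ 1 ≤ n k := by
  have hex : ∀ s : Finset (Fin d), (∀ l, l ∉ s → n l = 0) → ∑ j ∈ s, n j = r := fun s h => by
    rw [← hn]; exact Finset.sum_subset (Finset.subset_univ s) fun l _ hl => h l hl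
  by_cases h1 : ∃ j, ∀ l, l ≠ j → n l = 0
  · obtain ⟨j, h1⟩ := h1
    have := hex {j} fun l hl => h1 l (by simpa using hl)
    rw [Finset.sum_singleton] at this
    refine Or.inl ⟨j, funext fun l => ?_⟩
    by_cases hl : l = j
    · subst hl; simp [this]
    · simp [hl, h1 l hl]
  by_cases h2 : ∃ j k, j < k ∧ ∀ l, l ≠ j → l ≠ k → n l = 0
  · obtain ⟨j, k, hjk, h2⟩ := h2
    have := hex {j, k} fun l hl => by
      simp only [Finset.mem_insert, Finset.mem_singleton, not_or] at hl
      exact h2 l hl.1 hl.2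
    rw [Finset.sum_pair hjk.ne] at this
    have hj : n j ≠ 0 := fun h => h1 ⟨k, fun l hl => by
      by_cases hlj : l = j
      · rw [hlj, h]
      · exact h2 l hlj hl⟩
    have hk : n k ≠ 0 := fun h => h1 ⟨j, fun l hl => by
      by_cases hlk : l = k
      · rw [hlk, h]
      · exact h2 l hl hlk⟩
    refine Or.inr (Or.inl ⟨j, k, n j, n k, hjk, by omega, by omega, this, funext fun l => ?_⟩)
    by_cases hlj : l = j
    · subst hlj; simp [hjk.ne]
    by_cases hlk : l = k
    · subst hlk; simp [hlj]
    · simp [hlj, hlk, h2 l hlj hlk]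
  right; right
  let s := Finset.univ.filter fun j => n j ≠ 0
  have hs : 3 ≤ s.card := by
    by_contra! hs
    obtain h | h | h : s.card = 0 ∨ s.card = 1 ∨ s.card = 2 := by omega
    · rw [Finset.card_eq_zero] at h
      refine hr ((hex ∅ fun l _ => ?_).symm.trans Finset.sum_empty)
      by_contra hl
      have : l ∈ s := by simp [s, hl]
      simp [h] at this
    · obtain ⟨j, hj⟩ := Finset.card_eq_one.1 h
      refine h1 ⟨j, fun l hl => ?_⟩
      by_contra hl0
      have : l ∈ s := by simp [s, hl0]
      rw [hj, Finset.mem_singleton] at this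
      exact hl this
    · obtain ⟨j, k, hjk, hs2⟩ := Finset.card_eq_two.1 h
      have h3 : ∀ l, l ≠ j → l ≠ k → n l = 0 := fun l hlj hlk => by
        by_contra hl0
        have : l ∈ s := by simp [s, hl0]
        rw [hs2, Finset.mem_insert, Finset.mem_singleton] at this
        tauto
      rcases lt_or_gt_of_ne hjk with hlt | hlt
      · exact h2 ⟨j, k, hlt, h3⟩
      · exact h2 ⟨k, j, hlt, fun l hl hl' => h3 l hl' hl⟩
  obtain ⟨t, hts, ht⟩ := Finset.exists_subset_card_eq hs
  let e := t.orderIsoOfFin ht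
  have hmem : ∀ x, 1 ≤ n (e x) := fun x => by
    have := hts (e x).2
    simp only [s, Finset.mem_filter] at this
    omega
  exact ⟨e 0, e 1, e 2, e.strictMono (by decide), e.strictMono (by decide), hmem 0, hmem 1, hmem 2⟩

end Shapes

section BetaValues

open scoped Nat
open Module

variable {d r : ℕ} {n : Fin d → ℕ} (hn : ∑ j, n j = r)
variable {W : Type*} [AddCommGroup W] [Module ℂ W] [FiniteDimensional ℂ W]
  {ρ : Representation ℂ (YoungGroup n) W}

theorem finrank_pos_of_irreducible {G : Type*} [Group G] {ρ : Representation ℂ G W}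
    (hρ : ρ.IsIrreducible) : 1 ≤ finrank ℂ W := by
  obtain ⟨v, hv⟩ := exists_ne_zero_of_irreducible hρ
  have : Nontrivial W := ⟨v, 0, hv⟩
  exact finrank_pos

theorem negDim_beta_single (hd : d ≠ 0) {p q : Fin r} (hpq : p ≠ q)
    {j : Fin d} (hj : n = Pi.single j r) (hr : 2 ≤ r) :
    negDim (beta hn ρ) (permElt d (Equiv.swap p q)) = factorNeg ρ j := by
  have h := two_mul_negDim_beta hn ρ hd hpq
  have hnj : n j = r := by rw [hj, Pi.single_eq_same]
  have h0 : ∀ l, l ≠ j → n l = 0 := fun l hl => by rw [hj, Pi.single_eq_of_ne hl]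
  rw [Fintype.prod_eq_single j (fun l hl => by rw [h0 l hl, Nat.factorial_zero]),
    Fintype.sum_eq_single j (fun l hl => by rw [h0 l hl, zero_mul]), hnj] at h
  obtain ⟨r, rfl⟩ := Nat.exists_eq_add_of_le' hr
  rw [Nat.factorial_succ, Nat.factorial_succ, Nat.add_sub_cancel, Nat.sub_self, zero_mul, zero_add,
    show r + 2 - 1 = r + 1 by omega] at h
  refine Nat.eq_of_mul_eq_mul_right (show 0 < 2 * ((r + 1 + 1) * ((r + 1) * r !)) by positivity) ?_
  linarith

theorem negDim_beta_two (hd : d ≠ 0) {p q : Fin r} (hpq : p ≠ q)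
    {j k : Fin d} (hjk : j ≠ k) {a b : ℕ}
    (hjk' : n = Pi.single j a + Pi.single k b) (hab : a + b = r) :
    negDim (beta hn ρ) (permElt d (Equiv.swap p q)) * (a ! * b !) =
      (r - 2)! * (a * b * finrank ℂ W + a * (a - 1) * factorNeg ρ j +
        b * (b - 1) * factorNeg ρ k) := by
  have h := two_mul_negDim_beta hn ρ hd hpq
  have hnj : n j = a := by simp [hjk', hjk]
  have hnk : n k = b := by simp [hjk', hjk.symm]
  have h0 : ∀ l, l ≠ j ∧ l ≠ k → n l = 0 := fun l hl => by simp [hjk', hl.1, hl.2]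
  rw [Fintype.prod_eq_mul j k hjk (fun l hl => by rw [h0 l hl, Nat.factorial_zero]),
    Fintype.sum_eq_add j k hjk (fun l hl => by rw [h0 l hl, zero_mul]), hnj, hnk,
    show r - a = b by omega, show r - b = a by omega] at h
  refine Nat.eq_of_mul_eq_mul_left (two_pos) ?_
  linarith

theorem two_eq_sum {j k : Fin d} {a b : ℕ} (hjk' : n = Pi.single j a + Pi.single k b) :
    a + b = ∑ l, n l := by
  simp [hjk', Finset.sum_add_distrib]

theorem negDim_beta_one (hd : d ≠ 0) {p q : Fin r} (hpq : p ≠ q)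
    {j k : Fin d} (hjk : j ≠ k)
    (hjk' : n = Pi.single j 1 + Pi.single k (r - 1)) (hr : 2 ≤ r) :
    negDim (beta hn ρ) (permElt d (Equiv.swap p q)) = finrank ℂ W + (r - 2) * factorNeg ρ k := by
  have h := negDim_beta_two hn (ρ := ρ) hd hpq hjk hjk' (by omega)
  obtain ⟨r, rfl⟩ := Nat.exists_eq_add_of_le' hr
  simp only [Nat.add_sub_cancel, show r + 2 - 1 = r + 1 by omega, Nat.factorial_succ r,
    Nat.factorial_one, Nat.sub_self] at h ⊢
  refine Nat.eq_of_mul_eq_mul_right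
    (show 0 < (r + 1) * _ from Nat.mul_pos r.succ_pos r.factorial_pos) ?_
  linarith

theorem negDim_beta_two_two (hd : d ≠ 0) {p q : Fin r} (hpq : p ≠ q)
    {j k : Fin d} (hjk : j ≠ k)
    (hjk' : n = Pi.single j 2 + Pi.single k 2) :
    negDim (beta hn ρ) (permElt d (Equiv.swap p q)) =
      2 * finrank ℂ W + factorNeg ρ j + factorNeg ρ k := by
  have h4 := (two_eq_sum hjk').trans hn
  have h := negDim_beta_two hn (ρ := ρ) hd hpq hjk hjk' h4
  subst h4
  simp only [Nat.factorial, Nat.reduceAdd, Nat.reduceSub, Nat.reduceMul] at h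
  omega

theorem negDim_beta_two_three (hd : d ≠ 0) {p q : Fin r} (hpq : p ≠ q)
    {j k : Fin d} (hjk : j ≠ k)
    (hjk' : n = Pi.single j 2 + Pi.single k 3) :
    negDim (beta hn ρ) (permElt d (Equiv.swap p q)) =
      3 * finrank ℂ W + factorNeg ρ j + 3 * factorNeg ρ k := by
  have h4 := (two_eq_sum hjk').trans hn
  have h := negDim_beta_two hn (ρ := ρ) hd hpq hjk hjk' h4
  subst h4
  simp only [Nat.factorial, Nat.reduceAdd, Nat.reduceSub, Nat.reduceMul] at h
  omega

theorem negDim_beta_of_le_one (hd : d ≠ 0) {p q : Fin r} (hpq : p ≠ q)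
    (h1 : ∀ l, n l ≤ 1) (hr : r = 3) :
    negDim (beta hn ρ) (permElt d (Equiv.swap p q)) = 3 * finrank ℂ W := by
  have h := two_mul_negDim_beta hn ρ hd hpq
  rw [Finset.prod_eq_one (fun l _ => Nat.factorial_eq_one.2 (h1 l)),
    Finset.sum_congr rfl (g := fun l => n l * (2 * finrank ℂ W)) (fun l _ => by
      obtain h0 | h0 : n l = 0 ∨ n l = 1 := by have := h1 l; omega
      · rw [h0, zero_mul, zero_mul]
      · rw [h0, hr]; simp), ← Finset.sum_mul, hn] at h
  subst hr
  simp only [Nat.factorial, Nat.reduceSub] at h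
  omega

theorem four_le_negDim_beta (hd : d ≠ 0) {p q : Fin r} (hpq : p ≠ q)
    (hρ : ρ.IsIrreducible) {i j k : Fin d} (hij : i ≠ j) (hik : i ≠ k)
    (hjk : j ≠ k) (hi : 1 ≤ n i) (hj : 1 ≤ n j) (hk : 1 ≤ n k) (hr : 4 ≤ r) :
    4 ≤ negDim (beta hn ρ) (permElt d (Equiv.swap p q)) := by
  have h := two_mul_negDim_beta hn ρ hd hpq
  have hD := finrank_pos_of_irreducible hρ
  set D := finrank ℂ W
  let s : Finset (Fin d) := {i, j}
  have hs : n i + n j + ∑ l ∈ sᶜ, n l = r := by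
    rw [← hn, ← Finset.sum_add_sum_compl s, Finset.sum_pair hij]
  have hc : n k ≤ ∑ l ∈ sᶜ, n l :=
    Finset.single_le_sum (f := n) (fun _ _ => Nat.zero_le _) (by simp [s, hik.symm, hjk.symm])
  set c := ∑ l ∈ sᶜ, n l with hcdef
  have hN : 2 * (n i * n j + c * (n i + n j)) ≤
      ∑ k, n k * ((r - n k) * D + (n k - 1) * (2 * factorNeg ρ k)) := by
    have h1 : ∀ l, n l * (r - n l) ≤ n l * ((r - n l) * D + (n l - 1) * (2 * factorNeg ρ l)) :=
      fun l => Nat.mul_le_mul le_rfl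
        ((Nat.le_mul_of_pos_right _ hD).trans (Nat.le_add_right _ _))
    refine le_trans ?_ (Finset.sum_le_sum fun l _ => h1 l)
    have h2 : c * (n i + n j) ≤ ∑ l ∈ sᶜ, n l * (r - n l) := by
      rw [hcdef, Finset.sum_mul]
      refine Finset.sum_le_sum fun l hl => Nat.mul_le_mul le_rfl ?_
      have := Finset.single_le_sum (f := n) (fun _ _ => Nat.zero_le _) hl
      omega
    rw [← Finset.sum_add_sum_compl s, Finset.sum_pair hij, show r - n i = n j + c by omega,
      show r - n j = n i + c by omega]
    linarith
  have hP : ∏ l, (n l)! ≤ (n i)! * (n j)! * c ! := by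
    rw [← Finset.prod_mul_prod_compl s, Finset.prod_pair hij]
    exact Nat.mul_le_mul le_rfl
      (Nat.le_of_dvd (Nat.factorial_pos _) (Nat.prod_factorial_dvd_factorial_sum _ _))
  have hP0 : 0 < ∏ l, (n l)! := Finset.prod_pos fun l _ => Nat.factorial_pos _
  exact four_le_of_three_blocks hi hj (hk.trans hc) hs hr hP0 hP hN h

end BetaValues

/-! ### The lists -/

section ListIffs

open Module

variable {d r : ℕ} {n : Fin d → ℕ} (hn : ∑ j, n j = r)
variable {W : Type*} [AddCommGroup W] [Module ℂ W] {ρ : Representation ℂ (YoungGroup n) W}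

theorem factorNeg_eq_zero_of_le_one {j : Fin d} (h : n j ≤ 1) : factorNeg ρ j = 0 := by
  rw [factorNeg, dif_neg (by omega)]

variable [FiniteDimensional ℂ W]

theorem isTrivialRep_iff_factorNeg {j : Fin d} (hρ : ρ.IsIrreducible) (h : ∀ l, l ≠ j → n l ≤ 1) :
    IsTrivialRep ρ ↔ factorNeg ρ j = 0 := by
  refine ⟨fun ht => ht.factorNeg_eq_zero j, fun h0 => isTrivialRep_of_factorNeg hρ fun l => ?_⟩
  by_cases hl : l = j
  · rwa [hl]
  · exact factorNeg_eq_zero_of_le_one (h l hl)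

theorem factorNeg_le_one_iff {j : Fin d} (hρ : ρ.IsIrreducible) (hj : n = Pi.single j r)
    (hr : 3 ≤ r) : factorNeg ρ j ≤ 1 ↔
      IsTrivialRep ρ ∨ IsSign ρ j ∨ IsStandard ρ j ∨ (r = 4 ∧ IsSpecht ρ j shape22) := by
  obtain rfl : n j = r := by rw [hj, Pi.single_eq_same]
  have h0 : ∀ l, l ≠ j → n l = 0 := fun l hl => by rw [hj, Pi.single_eq_of_ne hl]
  have hab : (⟨0, by omega⟩ : Fin (n j)) ≠ ⟨1, by omega⟩ := by simp
  rw [← negDim_factorRep hab, negDim_le_one_iff hr (factorRep_irreducible h0 hρ) hab,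
    isTrivialRep_iff h0, IsSign, isFactorRep_iff h0, IsStandard, isFactorRep_iff h0, IsSpecht,
    isFactorRep_iff (U := (spechtSub (n j) shape22).toSubmodule) h0]

theorem factorNeg_le_three_iff {j : Fin d} (hρ : ρ.IsIrreducible) (hj : n = Pi.single j r)
    (hr : 3 ≤ r) : factorNeg ρ j ≤ 3 ↔
      IsTrivialRep ρ ∨ IsSign ρ j ∨ IsStandard ρ j ∨ r ≤ 5 ∨
        (r = 6 ∧ (IsSpecht ρ j shape33 ∨ IsSpecht ρ j shape222 ∨ IsSpecht ρ j shape42)) := by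
  obtain rfl : n j = r := by rw [hj, Pi.single_eq_same]
  have h0 : ∀ l, l ≠ j → n l = 0 := fun l hl => by rw [hj, Pi.single_eq_of_ne hl]
  have hab : (⟨0, by omega⟩ : Fin (n j)) ≠ ⟨1, by omega⟩ := by simp
  rw [← negDim_factorRep hab, negDim_le_three_iff hr (factorRep_irreducible h0 hρ) hab,
    isTrivialRep_iff h0, IsSign, isFactorRep_iff h0, IsStandard, isFactorRep_iff h0, IsSpecht,
    IsSpecht, IsSpecht, isFactorRep_iff (U := (spechtSub (n j) shape33).toSubmodule) h0,
    isFactorRep_iff (U := (spechtSub (n j) shape222).toSubmodule) h0,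
    isFactorRep_iff (U := (spechtSub (n j) shape42).toSubmodule) h0]

theorem eq_single_add_three (hn : ∑ l, n l = 3) {i j k : Fin d} (hij : i ≠ j) (hik : i ≠ k)
    (hjk : j ≠ k) (hi : 1 ≤ n i) (hj : 1 ≤ n j) (hk : 1 ≤ n k) :
    n = Pi.single i 1 + Pi.single j 1 + Pi.single k 1 := by
  have h := Finset.sum_add_sum_compl ({i, j, k} : Finset (Fin d)) n
  rw [hn, Finset.sum_insert (by simp [hij, hik]), Finset.sum_pair hjk] at h
  have h0 : ∀ l, l ≠ i → l ≠ j → l ≠ k → n l = 0 := fun l h1 h2 h3 => by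
    have := Finset.single_le_sum (f := n) (s := ({i, j, k} : Finset (Fin d))ᶜ)
      (fun _ _ => Nat.zero_le _) (show l ∈ _ by simp [h1, h2, h3])
    omega
  funext l
  by_cases h1 : l = i
  · subst h1; simp [hij, hik]; omega
  by_cases h2 : l = j
  · subst h2; simp [h1, hjk]; omega
  by_cases h3 : l = k
  · subst h3; simp [h1, h2]; omega
  · simp [h1, h2, h3, h0]

theorem le_one_of_eq_single_add_three {i j k : Fin d} (hij : i ≠ j) (hik : i ≠ k)
    (hjk : j ≠ k) (h : n = Pi.single i 1 + Pi.single j 1 + Pi.single k 1) (l : Fin d) :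
    n l ≤ 1 := by
  rw [h]
  by_cases h1 : l = i
  · subst h1; simp [hij, hik]
  by_cases h2 : l = j
  · subst h2; simp [h1, hjk]
  by_cases h3 : l = k
  · subst h3; simp [h1, h2]
  · simp [h1, h2, h3]

theorem le_one_of_eq_single_add {j k : Fin d} {b : ℕ} (h : n = Pi.single j 1 + Pi.single k b)
    (l : Fin d) (hl : l ≠ k) : n l ≤ 1 := by
  rw [h]
  by_cases h1 : l = j
  · subst h1; simp [hl]
  · simp [h1, hl]

theorem eq_zero_of_eq_single_add {j k : Fin d} {a b : ℕ} (h : n = Pi.single j a + Pi.single k b)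
    {l : Fin d} (hj : l ≠ j) (hk : l ≠ k) : n l ≤ 1 := by
  simp [h, hj, hk]

/-- The cases where `n` has the entries `1` and `r - 1`. -/
theorem cases_of_negDim_one (hρ : ρ.IsIrreducible) {j k : Fin d} (hjk : j ≠ k)
    (h : n = Pi.single j 1 + Pi.single k (r - 1)) (hr : 3 ≤ r) :
    finrank ℂ W + (r - 2) * factorNeg ρ k ≤ 3 ↔
      IsTrivialRep ρ ∨ ((r = 3 ∨ r = 4) ∧ IsSign ρ k) ∨ (r = 3 ∧ IsStandard ρ k) := by
  have h1 := le_one_of_eq_single_add h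
  have hD := finrank_pos_of_irreducible hρ
  have hx := factorNeg_le_finrank (ρ := ρ) k
  constructor
  · intro hm
    by_cases h0 : factorNeg ρ k = 0
    · exact Or.inl ((isTrivialRep_iff_factorNeg hρ h1).2 h0)
    have h2 := Nat.mul_le_mul (show 1 ≤ r - 2 by omega) (le_refl (factorNeg ρ k))
    have h3 : factorNeg ρ k = 1 := by omega
    rw [h3, mul_one] at hm
    have hD1 : finrank ℂ W = 1 := by
      by_contra hD1
      have hk : n k = 2 := by
        rw [h, Pi.add_apply, Pi.single_eq_same, Pi.single_eq_of_ne hjk.symm]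
        omega
      rcases finrank_eq_factorNeg_or hρ hk with h4 | h4 <;> omega
    exact Or.inr (Or.inl ⟨by omega, isSign_of_factorNeg hρ hD1 h3 fun l hl =>
      factorNeg_eq_zero_of_le_one (h1 l hl)⟩)
  · rintro (ht | ⟨hr4, hs⟩ | ⟨rfl, hs⟩)
    · rw [ht.factorNeg_eq_zero, ht.finrank_eq_one]
      omega
    · have h2 : finrank ℂ W = 1 := (IsFactorRep.finrank_eq hs).trans (finrank_self ℂ)
      have h3 := Nat.mul_le_mul (show r - 2 ≤ 2 by omega) hx
      omega
    · have h2 : finrank ℂ W = _ :=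
        IsFactorRep.finrank_eq (U := (standardSub (n k)).toSubmodule) hs
      have hk : n k = 2 := by
        rw [h, Pi.add_apply, Pi.single_eq_same, Pi.single_eq_of_ne hjk.symm]
      have h3 := finrank_standardSub (n := n k) (by omega)
      omega

theorem finrank_add_le_one_iff (hρ : ρ.IsIrreducible) {j k : Fin d}
    (h : n = Pi.single j 1 + Pi.single k (r - 1)) (hr : 3 ≤ r) :
    finrank ℂ W + (r - 2) * factorNeg ρ k ≤ 1 ↔ IsTrivialRep ρ := by
  have hD := finrank_pos_of_irreducible hρ
  rw [isTrivialRep_iff_factorNeg hρ (le_one_of_eq_single_add h)]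
  constructor
  · intro hm
    have h2 := Nat.mul_le_mul (show 1 ≤ r - 2 by omega) (le_refl (factorNeg ρ k))
    omega
  · intro h0
    have := ((isTrivialRep_iff_factorNeg hρ (le_one_of_eq_single_add h)).2 h0).finrank_eq_one
    rw [h0, this]
    omega

theorem negDim_beta_three_blocks (hd : d ≠ 0) {p q : Fin r} (hpq : p ≠ q) (hr : 3 ≤ r)
    (hρ : ρ.IsIrreducible) {i j k : Fin d} (hij : i < j) (hjk : j < k) (hi : 1 ≤ n i)
    (hj : 1 ≤ n j) (hk : 1 ≤ n k)
    (h : negDim (beta hn ρ) (permElt d (Equiv.swap p q)) ≤ 3) :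
    n = Pi.single i 1 + Pi.single j 1 + Pi.single k 1 ∧ IsTrivialRep ρ ∧
      negDim (beta hn ρ) (permElt d (Equiv.swap p q)) = 3 := by
  have hD := finrank_pos_of_irreducible hρ
  obtain rfl : r = 3 := by
    by_contra hr3
    have := four_le_negDim_beta hn hd hpq hρ hij.ne (hij.trans hjk).ne hjk.ne hi hj hk (by omega)
    omega
  have hs := eq_single_add_three hn hij.ne (hij.trans hjk).ne hjk.ne hi hj hk
  have h1 := le_one_of_eq_single_add_three hij.ne (hij.trans hjk).ne hjk.ne hs
  rw [negDim_beta_of_le_one hn hd hpq h1 rfl] at h ⊢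
  exact ⟨hs, (isTrivialRep_iff_factorNeg (j := i) hρ fun l _ => h1 l).2
    (factorNeg_eq_zero_of_le_one (h1 i)), by omega⟩

theorem negDim_beta_eq_zero_iff (hd : d ≠ 0) {p q : Fin r} (hpq : p ≠ q) (hr : 3 ≤ r)
    (hρ : ρ.IsIrreducible) :
    negDim (beta hn ρ) (permElt d (Equiv.swap p q)) = 0 ↔ ListTwo ρ r := by
  have hD := finrank_pos_of_irreducible hρ
  have h0 : ∀ {j}, n = Pi.single j r → ∀ l, l ≠ j → n l ≤ 1 := fun hj l hl => by
    rw [hj, Pi.single_eq_of_ne hl]; omega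
  constructor
  · intro h
    rcases shape_cases (by omega) hn with ⟨j, hj⟩ | ⟨j, k, a, b, hjk, ha, hb, hab, hs⟩ |
      ⟨i, j, k, hij, hjk, hi, hj, hk⟩
    · refine ⟨j, hj, (isTrivialRep_iff_factorNeg hρ (h0 hj)).2 ?_⟩
      rwa [negDim_beta_single hn hd hpq hj (by omega)] at h
    · have h1 := negDim_beta_two hn (ρ := ρ) hd hpq hjk.ne hs hab
      rw [h, zero_mul, eq_comm, mul_eq_zero] at h1
      have h2 : 0 < a * b * finrank ℂ W := by positivity
      rcases h1 with h1 | h1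
      · exact absurd h1 (Nat.factorial_ne_zero _)
      · omega
    · have := negDim_beta_three_blocks hn hd hpq hr hρ hij hjk hi hj hk (by omega)
      omega
  · rintro ⟨j, hj, ht⟩
    rw [negDim_beta_single hn hd hpq hj (by omega), ht.factorNeg_eq_zero]

theorem negDim_beta_le_one_iff (hd : d ≠ 0) {p q : Fin r} (hpq : p ≠ q) (hr : 3 ≤ r)
    (hρ : ρ.IsIrreducible) :
    negDim (beta hn ρ) (permElt d (Equiv.swap p q)) ≤ 1 ↔ ListOne ρ r := by
  have hD := finrank_pos_of_irreducible hρ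
  constructor
  · intro h
    rcases shape_cases (by omega) hn with ⟨j, hj⟩ | ⟨j, k, a, b, hjk, ha, hb, hab, hs⟩ |
      ⟨i, j, k, hij, hjk, hi, hj, hk⟩
    · rw [negDim_beta_single hn hd hpq hj (by omega)] at h
      exact Or.inl ⟨j, hj, (factorNeg_le_one_iff hρ hj hr).1 h⟩
    · rcases eq_of_two_blocks ha hb hab (negDim_beta_two hn (ρ := ρ) hd hpq hjk.ne hs hab) hD
        (by omega) with rfl | rfl | ⟨rfl, rfl⟩ | ⟨rfl, rfl⟩ | ⟨rfl, rfl⟩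
      · obtain rfl : b = r - 1 := by omega
        rw [negDim_beta_one hn hd hpq hjk.ne hs (by omega)] at h
        exact Or.inr (Or.inl ⟨j, k, hjk, hs, (finrank_add_le_one_iff hρ hs hr).1 h⟩)
      · obtain rfl : a = r - 1 := by omega
        have hs' := hs.trans (add_comm _ _)
        rw [negDim_beta_one hn hd hpq hjk.ne' hs' (by omega)] at h
        exact Or.inr (Or.inr ⟨j, k, hjk, hs, (finrank_add_le_one_iff hρ hs' hr).1 h⟩)
      · rw [negDim_beta_two_two hn hd hpq hjk.ne hs] at h
        omega
      · rw [negDim_beta_two_three hn hd hpq hjk.ne hs] at h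
        omega
      · rw [negDim_beta_two_three hn hd hpq hjk.ne' (hs.trans (add_comm _ _))] at h
        omega
    · have := negDim_beta_three_blocks hn hd hpq hr hρ hij hjk hi hj hk (by omega)
      omega
  · rintro (⟨j, hj, h⟩ | ⟨j, k, hjk, hs, ht⟩ | ⟨j, k, hjk, hs, ht⟩)
    · rw [negDim_beta_single hn hd hpq hj (by omega)]
      exact (factorNeg_le_one_iff hρ hj hr).2 h
    · rw [negDim_beta_one hn hd hpq hjk.ne hs (by omega)]
      exact (finrank_add_le_one_iff hρ hs hr).2 ht
    · have hs' := hs.trans (add_comm _ _)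
      rw [negDim_beta_one hn hd hpq hjk.ne' hs' (by omega)]
      exact (finrank_add_le_one_iff hρ hs' hr).2 ht

theorem two_two_iff (hρ : ρ.IsIrreducible) {j k : Fin d} (hjk : j ≠ k)
    (h : n = Pi.single j 2 + Pi.single k 2) :
    2 * finrank ℂ W + factorNeg ρ j + factorNeg ρ k ≤ 3 ↔
      IsTrivialRep ρ ∨ IsSign ρ j ∨ IsSign ρ k := by
  have hD := finrank_pos_of_irreducible hρ
  have h0 : ∀ l, l ≠ j → l ≠ k → factorNeg ρ l = 0 := fun l hj hk =>
    factorNeg_eq_zero_of_le_one (eq_zero_of_eq_single_add h hj hk)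
  have hsum : ∀ {i}, IsSign ρ i → finrank ℂ W = 1 := fun hs =>
    (IsFactorRep.finrank_eq hs).trans (finrank_self ℂ)
  have hle := factorNeg_le_finrank (ρ := ρ)
  constructor
  · intro hm
    have hD1 : finrank ℂ W = 1 := by omega
    by_cases hj0 : factorNeg ρ j = 0
    · by_cases hk0 : factorNeg ρ k = 0
      · refine Or.inl (isTrivialRep_of_factorNeg hρ fun l => ?_)
        by_cases hlj : l = j
        · rwa [hlj]
        by_cases hlk : l = k
        · rwa [hlk]
        exact h0 l hlj hlk
      · refine Or.inr (Or.inr (isSign_of_factorNeg hρ hD1 (by omega) fun l hl => ?_))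
        by_cases hlj : l = j
        · rwa [hlj]
        exact h0 l hlj hl
    · refine Or.inr (Or.inl (isSign_of_factorNeg hρ hD1 (by omega) fun l hl => ?_))
      by_cases hlk : l = k
      · rw [hlk]; omega
      exact h0 l hl hlk
  · rintro (ht | hs | hs)
    · rw [ht.factorNeg_eq_zero, ht.factorNeg_eq_zero, ht.finrank_eq_one]
      omega
    · have := IsFactorRep.factorNeg_eq_zero hs hjk.symm
      have := hle j
      have := hsum hs
      omega
    · have := IsFactorRep.factorNeg_eq_zero hs hjk
      have := hle k
      have := hsum hs
      omega

theorem two_three_iff (hρ : ρ.IsIrreducible) {j k : Fin d}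
    (h : n = Pi.single j 2 + Pi.single k 3) :
    3 * finrank ℂ W + factorNeg ρ j + 3 * factorNeg ρ k ≤ 3 ↔ IsTrivialRep ρ := by
  have hD := finrank_pos_of_irreducible hρ
  constructor
  · intro hm
    refine isTrivialRep_of_factorNeg hρ fun l => ?_
    by_cases hlj : l = j
    · rw [hlj]; omega
    by_cases hlk : l = k
    · rw [hlk]; omega
    exact factorNeg_eq_zero_of_le_one (eq_zero_of_eq_single_add h hlj hlk)
  · intro ht
    rw [ht.factorNeg_eq_zero, ht.factorNeg_eq_zero, ht.finrank_eq_one]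

theorem negDim_beta_le_three_iff (hd : d ≠ 0) {p q : Fin r} (hpq : p ≠ q) (hr : 3 ≤ r)
    (hρ : ρ.IsIrreducible) :
    negDim (beta hn ρ) (permElt d (Equiv.swap p q)) ≤ 3 ↔ ListThree ρ r := by
  have hD := finrank_pos_of_irreducible hρ
  constructor
  · intro h
    rcases shape_cases (by omega) hn with ⟨j, hj⟩ | ⟨j, k, a, b, hjk, ha, hb, hab, hs⟩ |
      ⟨i, j, k, hij, hjk, hi, hj, hk⟩
    · rw [negDim_beta_single hn hd hpq hj (by omega)] at h
      exact Or.inl ⟨j, hj, (factorNeg_le_three_iff hρ hj hr).1 h⟩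
    · rcases eq_of_two_blocks ha hb hab (negDim_beta_two hn (ρ := ρ) hd hpq hjk.ne hs hab) hD
        h with rfl | rfl | ⟨rfl, rfl⟩ | ⟨rfl, rfl⟩ | ⟨rfl, rfl⟩
      · obtain rfl : b = r - 1 := by omega
        rw [negDim_beta_one hn hd hpq hjk.ne hs (by omega)] at h
        exact Or.inr (Or.inl ⟨j, k, hjk, hs, (cases_of_negDim_one hρ hjk.ne hs hr).1 h⟩)
      · obtain rfl : a = r - 1 := by omega
        have hs' := hs.trans (add_comm _ _)
        rw [negDim_beta_one hn hd hpq hjk.ne' hs' (by omega)] at h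
        exact Or.inr (Or.inr (Or.inl
          ⟨j, k, hjk, hs, (cases_of_negDim_one hρ hjk.ne' hs' hr).1 h⟩))
      · rw [negDim_beta_two_two hn hd hpq hjk.ne hs] at h
        exact Or.inr (Or.inr (Or.inr (Or.inr (Or.inr (Or.inl
          ⟨j, k, hjk, hs, (two_two_iff hρ hjk.ne hs).1 h⟩)))))
      · rw [negDim_beta_two_three hn hd hpq hjk.ne hs] at h
        exact Or.inr (Or.inr (Or.inr (Or.inl ⟨j, k, hjk, hs, (two_three_iff hρ hs).1 h⟩)))
      · have hs' := hs.trans (add_comm _ _)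
        rw [negDim_beta_two_three hn hd hpq hjk.ne' hs'] at h
        exact Or.inr (Or.inr (Or.inr (Or.inr (Or.inl
          ⟨j, k, hjk, hs, (two_three_iff hρ hs').1 h⟩))))
    · obtain ⟨hs, ht, -⟩ := negDim_beta_three_blocks hn hd hpq hr hρ hij hjk hi hj hk h
      exact Or.inr (Or.inr (Or.inr (Or.inr (Or.inr (Or.inr ⟨i, j, k, hij, hjk, hs, ht⟩)))))
  · rintro (⟨j, hj, h⟩ | ⟨j, k, hjk, hs, h⟩ | ⟨j, k, hjk, hs, h⟩ | ⟨j, k, hjk, hs, h⟩ |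
      ⟨j, k, hjk, hs, h⟩ | ⟨j, k, hjk, hs, h⟩ | ⟨i, j, k, hij, hjk, hs, h⟩)
    · rw [negDim_beta_single hn hd hpq hj (by omega)]
      exact (factorNeg_le_three_iff hρ hj hr).2 h
    · rw [negDim_beta_one hn hd hpq hjk.ne hs (by omega)]
      exact (cases_of_negDim_one hρ hjk.ne hs hr).2 h
    · have hs' := hs.trans (add_comm _ _)
      rw [negDim_beta_one hn hd hpq hjk.ne' hs' (by omega)]
      exact (cases_of_negDim_one hρ hjk.ne' hs' hr).2 h
    · rw [negDim_beta_two_three hn hd hpq hjk.ne hs]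
      exact (two_three_iff hρ hs).2 h
    · have hs' := hs.trans (add_comm _ _)
      rw [negDim_beta_two_three hn hd hpq hjk.ne' hs']
      exact (two_three_iff hρ hs').2 h
    · rw [negDim_beta_two_two hn hd hpq hjk.ne hs]
      exact (two_two_iff hρ hjk.ne hs).2 h
    · have hr3 : r = 3 := by
        rw [← hn, hs]
        simp [Finset.sum_add_distrib]
      rw [negDim_beta_of_le_one hn hd hpq (le_one_of_eq_single_add_three hij.ne
        (hij.trans hjk).ne hjk.ne hs) hr3, h.finrank_eq_one]

end ListIffs

end HyperplaneTypes
end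

open HyperplaneTypes in
theorem mainTheorem12 (d r : ℕ) (hd : 2 ≤ d) (hr : 3 ≤ r)
    (H : Submodule ℂ (Fin r → ℂ)) (hH : IsNonDiagonalHyperplane d r H)
    (χ : groupG d r →* ℂˣ)
    (n : Fin d → ℕ) (hn : ∑ j, n j = r)
    {W : Type*} [AddCommGroup W] [Module ℂ W] [FiniteDimensional ℂ W]
    (ρ : Representation ℂ (YoungGroup n) W) (hρ : ρ.IsIrreducible)
    {M : Type*} [AddCommGroup M] [Module ℂ M]
    (ρ' : Representation ℂ (groupG d r) M) (hρ' : Nonempty (ρ'.Equiv (beta hn ρ))) :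
    ((IsExcellent (groupG d r) H ρ' ↔ ListOne ρ r) ∧
      (IsGood (groupG d r) H ρ' ↔ ListOne ρ r) ∧
      ((∀ g ∈ fixer (groupG d r) H, χ g = 1) →
        (IsGoodFor (groupG d r) H ρ' χ ↔ ListOne ρ r)) ∧
      ((¬ ∀ g ∈ fixer (groupG d r) H, χ g = 1) →
        (IsAcceptable (groupG d r) H ρ' χ ↔ ListOne ρ r))) ∧
    ((¬ ∀ g ∈ fixer (groupG d r) H, χ g = 1) →
      (IsGoodFor (groupG d r) H ρ' χ ↔ ListTwo ρ r)) ∧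
    ((∀ g ∈ fixer (groupG d r) H, χ g = 1) →
      (IsAcceptable (groupG d r) H ρ' χ ↔ ListThree ρ r)) := by
  have hd0 : d ≠ 0 := by omega
  obtain ⟨s, h, i, j, hij, hs, hf⟩ := exists_generator hH
  obtain ⟨e⟩ := hρ'
  have := finiteDimensional_beta hn ρ hd0
  have : FiniteDimensional ℂ M := e.toLinearEquiv.symm.finiteDimensional
  have hss : s * s = 1 := by
    have h1 := permElt_swap_mul_self (d := d) i j
    calc s * s = h * (permElt d (Equiv.swap i j) * permElt d (Equiv.swap i j)) * h⁻¹ := by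
          rw [hs]; group
      _ = 1 := by rw [h1]; group
  have hdet : detV (groupG d r) s = -1 := by
    rw [hs, detV_mul, detV_mul, mul_right_comm, ← detV_mul, mul_inv_cancel, detV_one, one_mul,
      detV_permElt_swap hij]
  have hm : negDim ρ' s = negDim (beta hn ρ) (permElt d (Equiv.swap i j)) := by
    rw [negDim_equiv e, hs, negDim_conj]
  have hzero := negDim_beta_eq_zero_iff hn hd0 hij hr hρ
  have hone := negDim_beta_le_one_iff hn hd0 hij hr hρ
  have hthree := negDim_beta_le_three_iff hn hd0 hij hr hρ
  rw [← hm] at hzero hone hthree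
  refine ⟨⟨(isExcellent_iff ρ' hss hdet hf).trans hone, (isGood_iff ρ' hdet hf).trans hone,
    fun hχ => ?_, fun hχ => ?_⟩, fun hχ => ?_, fun hχ => ?_⟩
  · rw [← hone, IsGoodFor, nH_eq ρ' hdet hf, nH_charRep_of_trivial hdet hf χ hχ,
      orderE_eq_two hdet hf]
    omega
  · rw [← hone, isAcceptable_iff ρ' hdet hf, nH_charRep_of_nontrivial hss hdet hf χ hχ]
    omega
  · rw [← hzero, IsGoodFor, nH_eq ρ' hdet hf, nH_charRep_of_nontrivial hss hdet hf χ hχ,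
      orderE_eq_two hdet hf]
    omega
  · rw [← hthree, isAcceptable_iff ρ' hdet hf, nH_charRep_of_trivial hdet hf χ hχ,
      mul_zero, add_zero]
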